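/- **Setting.** Let $M\subseteq\mathbb R^d$ be open with a smooth Poisson structure $\pi=(\pi^{ij})$, $T^*M=M\times(\mathbb R^d)^*\ni(x,p)$, $X=(\mathbb R^d)^*\times(\mathbb R^d)^*\times M\ni(p_1,p_2,x)$, $X_0=\{(0,0,x):x\in M\}$. For a smooth family $f_t$, $t\in[0,1]$, put $\mathrm{Tay}_\epsilon(f_t)_t=\sum_{n\ge0}\frac{\epsilon^n}{n!}\partial_t^nf_t|_{t=0}$. For a function $H$ on (an open subset of) $T^*M$ let $\phi^H_u$ be the flow of $\dot x^j=-\partial_{p_j}H$, $\dot p_j=\partial_{x^j}H$, let $L_E$ be the derivative along $E=p_j\partial_{p_j}$, and $q(x,p)=x$. **Trees.** $[RT]_m$ is the (finite) set of isomorphism classes of rooted trees with $m$ vertices, and $\sigma(\tau)$ is the number of automorphisms of $\tau$. For a vector field $X$ put $D^u_\bullet X=X^u$ and $D^u_{[\tau_1,\dots,\tau_r]}X=D^{i_1}_{\tau_1}X\cdots D^{i_r}_{\tau_r}X\;\partial_{i_1}\cdots\partial_{i_r}X^u$. **Kontsevich graphs.** A Kontsevich graph of type $(n,2)$ has aerial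 vertices $1,\dots,n$ and terrestrial vertices $\bar1,\bar2$; from each aerial vertex $k$ start exactly two edges $e_k^1$ (left), $e_k^2$ (right), there are no loops and no parallel edges, and no edge starts at a terrestrial vertex. It is a Kontsevich tree if the graph formed by the aerial vertices and the edges between them is a tree. Its operator is $$B_\Gamma(\pi)(f_1,f_2)=\sum_{I:E_\Gamma\to\{1,\dots,d\}}\Big[\prod_{k}\Big(\prod_{e=(*,k)}\partial_{I(e)}\Big)\pi^{I(e_k^1)I(e_k^2)}\Big]\prod_{i=1,2}\Big(\prod_{e=(*,\bar i)}\partial_{I(e)}\Big)f_i,$$ and its symbol $\hat B^\pi_\Gamma(p_1,p_2,x)$ is defined by $B_\Gamma(\pi)(e^{p_1x},e^{p_2x})=\hat B^\pi_\Gamma(p_1,p_2,x)\,e^{(p_1+p_2)x}$. **Networks.** A network of rooted trees $\rho$ consists of a rooted tree $\gamma$ (the skeleton) whose edges carry an additional orientation; for each vertex $v$ of $\gamma$, a rooted tree $\rho(v)$; and for each edge $e$ of $\gamma$, additionally oriented from $v$ to $w$, vertices $\rho(e)_1\in\rho(v)$ (its source) and $\rho(e)_2\in\rho(w)$. We require that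 no vertex of the trees $\rho(v)$ is the source of two skeleton edges. $NRT_m$ is the (finite) set of isomorphism classes of networks for which the trees $\rho(v)$ have $m$ vertices in total, $NRT=\bigcup_mNRT_m$, and $|\rho|=m$ for $\rho\in NRT_m$. The graph $\Gamma_\rho$ of type $(m,2)$ has these $m$ vertices as aerial vertices. The edges of the trees $\rho(v)$, oriented towards the roots, are right edges; the skeleton edges, from $\rho(e)_1$ to $\rho(e)_2$, are left edges. Each vertex that is not the source of a skeleton edge has a left edge to $\bar1$, and the root of each $\rho(v)$ has a right edge to $\bar2$. **Proposition.** Each $\Gamma_\rho$ is a Kontsevich tree. There is a recursion $$\tilde w_\rho=R_\rho\big((c_\tau)_{|\tau|\le|\rho|},(\tilde w_{\rho'})_{|\rho'|<|\rho|}\big),\qquad\rho\in NRT,$$ with universal polynomials $R_\rho$ with rational coefficients, such that for every coefficient function $c:[RT]\to\mathbb R$ the function $\tilde w:NRT\to\mathbb R$ defined by it has the following property, for all $d$, $M$, $\pi$, $\alpha$, $S$ as below. Let $\alpha$ be a smooth map from an open neighbourhood of $M\times0$ in $T^*M$ to $M$ with $\alpha(x,0)=x$ and, for all $x\in M$ and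 $p\in(\mathbb R^d)^*$, $$\mathrm{Tay}_\epsilon(\alpha^j(x,tp))_t=x^j+\sum_{m\ge1}\epsilon^m\sum_{\tau\in[RT]_m}\frac{c_\tau}{\sigma(\tau)}D^{x^j}_\tau V_\pi(x,p),\qquad V_\pi|_{(x,p)}=\pi^{jk}(x)p_k\partial_{x^j}.$$ Let $S_t$, $t\in[0,1]$, be a smooth family of functions, defined on a neighbourhood of $X_0\times[0,1]$ in $X\times[0,1]$ and given there for $t>0$ by $$S_t(p_1,p_2,x(t))=p_1(x_1)+p_2\alpha(x_1,tp_1)-\frac1t\int_0^t[L_E(p_2\alpha)](\phi_u^{p_2\alpha}(x_1,tp_1))\,du,\qquad x(t)=q\,\phi_t^{p_2\alpha}(x_1,tp_1),$$ that is, whenever the trajectory exists on $[0,t]$ in the domain of $\alpha$ and both $(p_1,p_2,x_1,t)$ and $(p_1,p_2,x(t),t)$ lie in the domain of the family. Then, for all $(p_1,p_2,x)$ in the domain of $S_0$, $$\mathrm{Tay}_\epsilon(S_t)_t(p_1,p_2,x)=(p_1+p_2)(x)+\sum_{m\ge1}\epsilon^m\sum_{\rho\in NRT_m}\tilde w_\rho\,\hat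 B^\pi_{\Gamma_\rho}(p_1,p_2,x).$$ -/

import Mathlib

open scoped ContDiff Matrix

noncomputable section

namespace TreeExpansion

/-! ## Formal Taylor expansions and partial derivatives -/

/-- The formal Taylor expansion at `t = 0` of a function of `t ∈ [0,1]` (one-sided at `0`):
the power series with `n`-th coefficient `(1/n!) ∂ₜⁿ f|_{t=0}`. -/
def tay (f : ℝ → ℝ) : PowerSeries ℝ :=
  PowerSeries.mk fun n => iteratedDerivWithin n f (Set.Icc 0 1) 0 / (n.factorial : ℝ)

/-- The partial derivative `∂_i f` of a function on `ℝ^d`. -/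
def pderiv {d : ℕ} (i : Fin d) (f : (Fin d → ℝ) → ℝ) : (Fin d → ℝ) → ℝ :=
  fun x => fderiv ℝ f x (Pi.single i 1)

/-- The mixed partial derivative `∂_{i₁} ⋯ ∂_{i_r} f` for a multiset `{i₁, …, i_r}` of indices.
(For a function that is not smooth, the derivatives are taken in the order of the indices.) -/
def mixedPartial {d : ℕ} (s : Multiset (Fin d)) (f : (Fin d → ℝ) → ℝ) : (Fin d → ℝ) → ℝ :=
  s.sort.foldr pderiv f

/-! ## Rooted trees -/

/-- A rooted tree with vertex set `V`. Its edges, oriented towards the root, are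
`v ⟶ parent v` for `v ≠ root`. -/
@[ext]
structure RootedTree (V : Type) where
  root : V
  parent : V → V
  parent_root : parent root = root
  reaches : ∀ v, ∃ k : ℕ, parent^[k] v = root

namespace RootedTree

variable {V : Type}

theorem root_of_parent_eq (T : RootedTree V) {v : V} (h : T.parent v = v) : v = T.root := by
  obtain ⟨k, hk⟩ := T.reaches v
  rw [← hk, Function.iterate_fixed h]

/-- The edges of a rooted tree, labelled by the vertex they start from (the root has none). -/
def Edge (T : RootedTree V) : Type := {v : V // v ≠ T.root}

/-- Isomorphism of rooted trees: a bijection of the vertices that respects the edges. (The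
root is the only vertex with `parent v = v`, so it is preserved too.) -/
def Iso (T T' : RootedTree V) : Prop :=
  ∃ e : Equiv.Perm V, ∀ v, e (T.parent v) = T'.parent (e v)

theorem map_root {T T' : RootedTree V} {e : Equiv.Perm V}
    (h : ∀ v, e (T.parent v) = T'.parent (e v)) : e T.root = T'.root :=
  T'.root_of_parent_eq (by rw [← h, T.parent_root])

instance setoid (V : Type) : Setoid (RootedTree V) where
  r := Iso
  iseqv :=
    { refl := fun T => ⟨Equiv.refl V, fun _ => rfl⟩
      symm := by
        rintro T T' ⟨e, h⟩
        refine ⟨e.symm, fun v => ?_⟩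
        rw [Equiv.symm_apply_eq, h, Equiv.apply_symm_apply]
      trans := by
        rintro T T' T'' ⟨e, h⟩ ⟨e', h'⟩
        exact ⟨e.trans e', fun v => by simp [h, h']⟩ }

/-- The symmetry coefficient `σ(T)`: the number of automorphisms of `T`. -/
def symmetry (T : RootedTree V) : ℕ :=
  Nat.card {e : Equiv.Perm V // ∀ v, e (T.parent v) = T.parent (e v)}

theorem symmetry_congr {T T' : RootedTree V} (h : Iso T T') : T.symmetry = T'.symmetry := by
  obtain ⟨e, h⟩ := h
  have h2 : ∀ v, e.symm (T'.parent v) = T.parent (e.symm v) := fun v => by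
    rw [Equiv.symm_apply_eq, h, Equiv.apply_symm_apply]
  refine Nat.card_congr
    { toFun := fun a => ⟨(e.symm.trans a.1).trans e, fun v => by simp [h, h2, a.2]⟩
      invFun := fun a => ⟨(e.trans a.1).trans e.symm, fun v => by simp [h, h2, a.2]⟩
      left_inv := fun a => by ext; simp
      right_inv := fun a => by ext; simp }

variable [Fintype V] [DecidableEq V]

/-- The elementary differential `D_T^u X (x)` of a vector field `X` on `ℝ^d`. The recursion
`D_T^u X = D_{T₁}^{i₁} X ⋯ D_{T_r}^{i_r} X ∂_{i₁} ⋯ ∂_{i_r} X^u` for `T = [T₁, …, T_r]`, unfolded: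
one index is summed over for each vertex other than the root, the root carries the index `u`, and a
vertex `v` contributes the component `X^{I(v)}`, differentiated once for each child of `v`. -/
def elemDiff {d : ℕ} (T : RootedTree V) (u : Fin d) (X : (Fin d → ℝ) → (Fin d → ℝ))
    (x : Fin d → ℝ) : ℝ :=
  ∑ I : V → Fin d, if I T.root = u then
    ∏ v : V, mixedPartial
      ((Finset.univ.filter fun w => w ≠ T.root ∧ T.parent w = v).val.map I)
      (fun y => X y (I v)) x
  else 0

theorem elemDiff_congr {d : ℕ} {T T' : RootedTree V} (h : Iso T T') :
    (T.elemDiff : Fin d → _) = T'.elemDiff := by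
  obtain ⟨e, h⟩ := h
  have hr := map_root h
  funext u X x
  refine Fintype.sum_equiv (Equiv.arrowCongr e (Equiv.refl (Fin d))) _ _ fun I => ?_
  have h1 : (Equiv.arrowCongr e (Equiv.refl (Fin d))) I = I ∘ e.symm := rfl
  rw [h1]
  have h2 : (I ∘ e.symm) T'.root = I T.root := by simp [← hr]
  rw [h2]
  split_ifs
  · refine Fintype.prod_equiv e _ _ fun v => ?_
    have h3 : (Finset.univ.filter fun w => w ≠ T'.root ∧ T'.parent w = e v) =
        (Finset.univ.filter fun w => w ≠ T.root ∧ T.parent w = v).map e.toEmbedding := by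
      ext w
      obtain ⟨w, rfl⟩ := e.surjective w
      simp [← h, ← hr]
    rw [h3]
    simp [Finset.map_val, Multiset.map_map, Function.comp_def]
  · rfl

end RootedTree

/-- Topological rooted trees with `n` vertices, `[RT]_n`. (There is none for `n = 0`.) -/
def TopTree (n : ℕ) : Type := Quotient (RootedTree.setoid (Fin n))

namespace TopTree

instance (V : Type) [Finite V] : Finite (RootedTree V) :=
  Finite.of_injective (fun T : RootedTree V => (T.root, T.parent)) fun T T' h => by
    simp only [Prod.mk.injEq] at h
    exact RootedTree.ext h.1 h.2

instance (n : ℕ) : Fintype (TopTree n) :=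
  haveI : Finite (TopTree n) := inferInstanceAs (Finite (Quotient _))
  Fintype.ofFinite _

/-- The symmetry coefficient `σ(τ)`. -/
def symmetry {n : ℕ} : TopTree n → ℕ :=
  Quotient.lift RootedTree.symmetry fun _ _ h => RootedTree.symmetry_congr h

/-- The elementary differential `D_τ^u X (x)`. -/
def elemDiff {n d : ℕ} (τ : TopTree n) :
    Fin d → ((Fin d → ℝ) → (Fin d → ℝ)) → (Fin d → ℝ) → ℝ :=
  Quotient.lift RootedTree.elemDiff (fun _ _ h => RootedTree.elemDiff_congr h) τ

end TopTree

/-! ## Kontsevich graphs and their symbols -/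

/-- A Kontsevich graph of type `(n, m)`: aerial vertices `Fin n`, terrestrial vertices `Fin m`,
and exactly two edges `(k, 0)` (left) and `(k, 1)` (right) out of each aerial vertex `k`;
no loops, no parallel edges. -/
@[ext]
structure KontsevichGraph (n m : ℕ) where
  target : Fin n → Fin 2 → Fin n ⊕ Fin m
  no_loop : ∀ k s, target k s ≠ Sum.inl k
  no_parallel : ∀ k, target k 0 ≠ target k 1

namespace KontsevichGraph

variable {n m : ℕ}

/-- The interior: the aerial vertices and the aerial edges (with orientations forgotten). -/
def interior (Γ : KontsevichGraph n m) : SimpleGraph (Fin n) :=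
  SimpleGraph.fromRel fun k l => ∃ s, Γ.target k s = Sum.inl l

/-- A Kontsevich tree: the interior has no cycles (of any length, so also no two distinct aerial
edges join the same two vertices) and is connected. -/
def IsKontsevichTree (Γ : KontsevichGraph n m) : Prop :=
  Γ.interior.IsTree ∧
    ∀ k l, Γ.interior.Adj k l →
      ∃! e : Fin n × Fin 2, (e.1 = k ∧ Γ.target e.1 e.2 = Sum.inl l) ∨
        (e.1 = l ∧ Γ.target e.1 e.2 = Sum.inl k)

/-- The multiset of the indices that an assignment `I` gives to the edges arriving at `y`. -/
def incoming {d : ℕ} (Γ : KontsevichGraph n m) (I : Fin n × Fin 2 → Fin d) (y : Fin n ⊕ Fin m) :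
    Multiset (Fin d) :=
  (Finset.univ.filter fun e : Fin n × Fin 2 => Γ.target e.1 e.2 = y).val.map I

/-- The `m`-differential operator `B_Γ(π)(f₁, …, f_m)`. -/
def operator {d : ℕ} (Γ : KontsevichGraph n m) (π : (Fin d → ℝ) → Matrix (Fin d) (Fin d) ℝ)
    (f : Fin m → (Fin d → ℝ) → ℝ) (x : Fin d → ℝ) : ℝ :=
  ∑ I : Fin n × Fin 2 → Fin d,
    (∏ k : Fin n, mixedPartial (Γ.incoming I (Sum.inl k)) (fun y => π y (I (k, 0)) (I (k, 1))) x) *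
      ∏ i : Fin m, mixedPartial (Γ.incoming I (Sum.inr i)) (f i) x

/-- The Kontsevich symbol, `B_Γ(π)(e^{p₁x}, …, e^{p_m x}) = B̂_Γ(p₁, …, p_m, x) e^{(p₁+⋯+p_m)x}`. -/
def symbol {d : ℕ} (Γ : KontsevichGraph n m) (π : (Fin d → ℝ) → Matrix (Fin d) (Fin d) ℝ)
    (p : Fin m → Fin d → ℝ) (x : Fin d → ℝ) : ℝ :=
  Γ.operator π (fun i y => Real.exp (p i ⬝ᵥ y)) x / Real.exp ((∑ i, p i) ⬝ᵥ x)

theorem operator_congr {d : ℕ} {Γ Γ' : KontsevichGraph n m} (e : Equiv.Perm (Fin n))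
    (h : ∀ k s, Γ'.target (e k) s = (Γ.target k s).map e id)
    (π : (Fin d → ℝ) → Matrix (Fin d) (Fin d) ℝ) : Γ.operator π = Γ'.operator π := by
  funext f x
  have key : ∀ (I : Fin n × Fin 2 → Fin d) (y : Fin n ⊕ Fin m),
      Γ'.incoming (I ∘ (e.prodCongr (Equiv.refl (Fin 2))).symm) (y.map e id) =
        Γ.incoming I y := by
    intro I y
    have h3 : (Finset.univ.filter fun a : Fin n × Fin 2 => Γ'.target a.1 a.2 = y.map e id) =
        (Finset.univ.filter fun a : Fin n × Fin 2 => Γ.target a.1 a.2 = y).map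
          (e.prodCongr (Equiv.refl (Fin 2))).toEmbedding := by
      ext a
      obtain ⟨a, rfl⟩ := (e.prodCongr (Equiv.refl (Fin 2))).surjective a
      have h4 : (e.prodCongr (Equiv.refl (Fin 2))).symm ((e.prodCongr (Equiv.refl (Fin 2))) a) = a :=
        Equiv.symm_apply_apply _ _
      rw [Finset.mem_map_equiv, h4]
      simp only [Finset.mem_filter, Finset.mem_univ, true_and, Equiv.prodCongr_apply,
        Equiv.coe_refl, Prod.map_fst, Prod.map_snd, id, h]
      exact (Sum.map_injective.2 ⟨e.injective, Function.injective_id⟩).eq_iff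
    simp only [incoming]
    rw [h3, Finset.map_val, Multiset.map_map]
    congr 1
    funext a
    exact congrArg I (Equiv.symm_apply_apply (e.prodCongr (Equiv.refl (Fin 2))) a)
  refine Fintype.sum_equiv
    (Equiv.arrowCongr (e.prodCongr (Equiv.refl (Fin 2))) (Equiv.refl (Fin d))) _ _ fun I => ?_
  have h1 : (Equiv.arrowCongr (e.prodCongr (Equiv.refl (Fin 2))) (Equiv.refl (Fin d))) I =
    I ∘ (e.prodCongr (Equiv.refl (Fin 2))).symm := rfl
  rw [h1]
  congr 1
  · refine Fintype.prod_equiv e _ _ fun k => ?_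
    rw [← key I (Sum.inl k)]
    simp
  · refine Finset.prod_congr rfl fun i _ => ?_
    rw [← key I (Sum.inr i)]
    simp

end KontsevichGraph

/-! ## Networks of rooted trees -/

/-- A disjoint union of rooted trees with vertex set `V`, oriented towards the roots: the edges are
`v ⟶ parent v` for `parent v ≠ v`, and the vertices with `parent v = v` are the roots. -/
@[ext]
structure RootedForest (V : Type) where
  parent : V → V
  reaches : ∀ v, ∃ k : ℕ, parent (parent^[k] v) = parent^[k] v

namespace RootedForest

variable {V : Type}

/-- The roots of a forest; they also label its trees. -/
def Root (F : RootedForest V) : Type := {v : V // F.parent v = v}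

open Classical in
/-- The root of the tree that contains `v`. -/
def rootOf (F : RootedForest V) (v : V) : F.Root :=
  ⟨F.parent^[Nat.find (F.reaches v)] v, Nat.find_spec (F.reaches v)⟩

theorem rootOf_eq (F : RootedForest V) {v : V} {k : ℕ}
    (h : F.parent (F.parent^[k] v) = F.parent^[k] v) : (F.rootOf v).1 = F.parent^[k] v := by
  classical
  have h1 := Nat.find_spec (F.reaches v)
  have h2 : Nat.find (F.reaches v) ≤ k := Nat.find_min' _ h
  obtain ⟨j, rfl⟩ := Nat.exists_eq_add_of_le h2
  show F.parent^[Nat.find (F.reaches v)] v = _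
  rw [add_comm, Function.iterate_add_apply, Function.iterate_fixed h1]

theorem rootOf_parent (F : RootedForest V) (v : V) : F.rootOf (F.parent v) = F.rootOf v := by
  obtain ⟨k, hk⟩ := F.reaches (F.parent v)
  refine Subtype.ext ?_
  rw [F.rootOf_eq hk, F.rootOf_eq (v := v) (k := k + 1) hk]
  rfl

instance [Finite V] : Finite (RootedForest V) :=
  Finite.of_injective (fun F : RootedForest V => F.parent) fun _ _ h => RootedForest.ext h

end RootedForest

/-- A network of rooted trees with vertices numbered by `Fin m`. The trees `ρ(v)` are the components
of `forest`, and `skeleton` is the rooted tree `γ(ρ)` on the set of these components. Each skeleton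
edge has an additional orientation (`inward`: towards the root of the skeleton) and an endpoint in
each of the two trees that it joins. No vertex is the source of two oriented skeleton edges. -/
structure Network (m : ℕ) where
  forest : RootedForest (Fin m)
  skeleton : RootedTree forest.Root
  inward : skeleton.Edge → Bool
  /-- the endpoint in the tree farther from the root of the skeleton -/
  low : skeleton.Edge → Fin m
  /-- the endpoint in the tree closer to the root of the skeleton -/
  high : skeleton.Edge → Fin m
  rootOf_low : ∀ e, forest.rootOf (low e) = e.1
  rootOf_high : ∀ e, forest.rootOf (high e) = skeleton.parent e.1
  source_injective : Function.Injective fun e => if inward e then low e else high e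

namespace Network

variable {m : ℕ}

/-- The source of a skeleton edge, in its additional orientation. -/
def source (ρ : Network m) (e : ρ.skeleton.Edge) : Fin m :=
  if ρ.inward e then ρ.low e else ρ.high e

/-- The end of a skeleton edge, in its additional orientation. -/
def sink (ρ : Network m) (e : ρ.skeleton.Edge) : Fin m :=
  if ρ.inward e then ρ.high e else ρ.low e

/-- There is an oriented skeleton edge from the vertex `a` to the vertex `b`. -/
def SkelEdge (ρ : Network m) (a b : Fin m) : Prop :=
  ∃ e, ρ.source e = a ∧ ρ.sink e = b

theorem SkelEdge.unique {ρ : Network m} {a b b' : Fin m} (h : ρ.SkelEdge a b)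
    (h' : ρ.SkelEdge a b') : b = b' := by
  obtain ⟨e, he, rfl⟩ := h
  obtain ⟨e', he', rfl⟩ := h'
  have : e = e' := ρ.source_injective (he.trans he'.symm)
  rw [this]

theorem SkelEdge.rootOf_ne {ρ : Network m} {a b : Fin m} (h : ρ.SkelEdge a b) :
    ρ.forest.rootOf b ≠ ρ.forest.rootOf a := by
  obtain ⟨e, rfl, rfl⟩ := h
  have h1 : ρ.skeleton.parent e.1 ≠ e.1 := fun h => e.2 (ρ.skeleton.root_of_parent_eq h)
  unfold source sink
  split_ifs
  · rw [ρ.rootOf_low, ρ.rootOf_high]; exact h1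
  · rw [ρ.rootOf_low, ρ.rootOf_high]; exact h1.symm

open Classical in
/-- The Kontsevich graph `Γ_ρ`. The internal edges become right edges, oriented towards the root;
the skeleton edges become left edges, with their additional orientation. A vertex that is not
the source of a skeleton edge gets a left edge into the first terrestrial vertex, and the root of
each of the trees gets a right edge into the second terrestrial vertex. -/
def kontsevichGraph (ρ : Network m) : KontsevichGraph m 2 where
  target v := ![if h : ∃ b, ρ.SkelEdge v b then Sum.inl h.choose else Sum.inr 0,
    if ρ.forest.parent v = v then Sum.inr 1 else Sum.inl (ρ.forest.parent v)]
  no_loop k s := by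
    fin_cases s
    · dsimp
      split_ifs with h
      · intro h2
        have h3 := h.choose_spec.rootOf_ne
        rw [Sum.inl.inj h2] at h3
        exact h3 rfl
      · simp
    · dsimp
      split_ifs with h
      · simp
      · intro h2; exact h (Sum.inl.inj h2)
  no_parallel k := by
    dsimp
    split_ifs with h h2 h2
    · simp
    · intro h3
      have h4 := h.choose_spec.rootOf_ne
      rw [Sum.inl.inj h3, ρ.forest.rootOf_parent] at h4
      exact h4 rfl
    · simp
    · simp

/-- Isomorphism of networks: a bijection of the vertices that respects the internal edges, the
oriented skeleton edges, and the root of the skeleton. (The skeleton is a tree on the components,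
so these data determine it as a rooted tree.) -/
def Iso (ρ ρ' : Network m) : Prop :=
  ∃ e : Equiv.Perm (Fin m), (∀ v, e (ρ.forest.parent v) = ρ'.forest.parent (e v)) ∧
    (∀ a b, ρ.SkelEdge a b ↔ ρ'.SkelEdge (e a) (e b)) ∧
    e ρ.skeleton.root.1 = ρ'.skeleton.root.1

instance setoid (m : ℕ) : Setoid (Network m) where
  r := Iso
  iseqv :=
    { refl := fun ρ => ⟨Equiv.refl _, fun _ => rfl, fun _ _ => Iff.rfl, rfl⟩
      symm := by
        rintro ρ ρ' ⟨e, h1, h2, h3⟩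
        refine ⟨e.symm, fun v => ?_, fun a b => ?_, ?_⟩
        · rw [Equiv.symm_apply_eq, h1, Equiv.apply_symm_apply]
        · rw [h2]; simp
        · rw [Equiv.symm_apply_eq, h3]
      trans := by
        rintro ρ ρ' ρ'' ⟨e, h1, h2, h3⟩ ⟨e', h1', h2', h3'⟩
        exact ⟨e.trans e', fun v => by simp [h1, h1'], fun a b => by simp [h2, h2'],
          by simp [h3, h3']⟩ }

theorem symbol_congr {d : ℕ} {ρ ρ' : Network m} (h : Iso ρ ρ') :
    (ρ.kontsevichGraph.symbol : ((Fin d → ℝ) → Matrix (Fin d) (Fin d) ℝ) → _) =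
      ρ'.kontsevichGraph.symbol := by
  obtain ⟨e, h1, h2, -⟩ := h
  funext π p x
  unfold KontsevichGraph.symbol
  rw [KontsevichGraph.operator_congr e]
  intro k s
  fin_cases s
  · simp only [kontsevichGraph, Fin.zero_eta, Matrix.cons_val_zero]
    by_cases hk : ∃ b, ρ.SkelEdge k b
    · have hk' : ∃ b, ρ'.SkelEdge (e k) b := ⟨e hk.choose, (h2 _ _).1 hk.choose_spec⟩
      rw [dif_pos hk, dif_pos hk', hk'.choose_spec.unique ((h2 _ _).1 hk.choose_spec)]
      rfl
    · have hk' : ¬ ∃ b, ρ'.SkelEdge (e k) b := by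
        rintro ⟨b, hb⟩
        exact hk ⟨e.symm b, (h2 _ _).2 (by simpa using hb)⟩
      rw [dif_neg hk, dif_neg hk']
      rfl
  · simp only [kontsevichGraph, Fin.mk_one, Matrix.cons_val_one, ← h1, e.injective.eq_iff]
    split_ifs <;> rfl

instance : Finite (Network m) := by
  have : ∀ F : RootedForest (Fin m), Finite F.Root := fun F =>
    inferInstanceAs (Finite {v : Fin m // _})
  have : ∀ (F : RootedForest (Fin m)) (T : RootedTree F.Root), Finite T.Edge := fun F T =>
    inferInstanceAs (Finite {v : F.Root // _})
  refine Finite.of_injective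
    (β := Σ F : RootedForest (Fin m), Σ T : RootedTree F.Root,
      (T.Edge → Bool) × (T.Edge → Fin m) × (T.Edge → Fin m))
    (fun ρ => ⟨ρ.forest, ρ.skeleton, ρ.inward, ρ.low, ρ.high⟩) ?_
  rintro ⟨F, T, a, b, c, _, _, _⟩ ⟨F', T', a', b', c', _, _, _⟩ h
  simp only [Sigma.mk.injEq] at h
  obtain ⟨rfl, h⟩ := h
  simp only [heq_eq_eq, Sigma.mk.injEq] at h
  obtain ⟨rfl, h⟩ := h
  simp only [heq_eq_eq, Prod.mk.injEq] at h
  obtain ⟨rfl, rfl, rfl⟩ := h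
  rfl

end Network

/-- Networks of rooted trees with `m` vertices up to isomorphism, `NRT_m`. (There is none for
`m = 0`.) -/
def NRT (m : ℕ) : Type := Quotient (Network.setoid m)

namespace NRT

instance (m : ℕ) : Fintype (NRT m) :=
  haveI : Finite (NRT m) := inferInstanceAs (Finite (Quotient _))
  Fintype.ofFinite _

/-- The Kontsevich symbol `B̂^π_{Γ_ρ}(p₁, p₂, x)`. -/
def symbol {m d : ℕ} (ρ : NRT m) (π : (Fin d → ℝ) → Matrix (Fin d) (Fin d) ℝ)
    (p₁ p₂ x : Fin d → ℝ) : ℝ :=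
  Quotient.lift (fun ρ : Network m => ρ.kontsevichGraph.symbol)
    (fun _ _ h => Network.symbol_congr h) ρ π ![p₁, p₂] x

end NRT

/-! ## Poisson structures, the map `α` and the family `S_t` -/

/-- `π` is a smooth Poisson structure on the open set `M ⊆ ℝ^d`. -/
structure IsPoisson {d : ℕ} (M : Set (Fin d → ℝ))
    (π : (Fin d → ℝ) → Matrix (Fin d) (Fin d) ℝ) : Prop where
  smooth : ∀ i j, ContDiffOn ℝ ∞ (fun x => π x i j) M
  skew : ∀ x ∈ M, ∀ i j, π x i j = -π x j i
  jacobi : ∀ x ∈ M, ∀ i j k, ∑ l, (π x i l * pderiv l (fun y => π y j k) x +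
    π x j l * pderiv l (fun y => π y k i) x + π x k l * pderiv l (fun y => π y i j) x) = 0

/-- The vector field `V_π|_{(x,p)} = π^{jk}(x) p_k ∂_{x^j}`, for a given value of `p`. -/
def sprayField {d : ℕ} (π : (Fin d → ℝ) → Matrix (Fin d) (Fin d) ℝ) (p x : Fin d → ℝ) :
    Fin d → ℝ :=
  π x *ᵥ p

/-- `α` is a smooth map into `M`, defined on the open neighbourhood `U` of `M × 0` in
`T^*M = M × (ℝ^d)^*`, with `α(x,0) = x`, and the formal Taylor expansion of `α(x,tp)` at `t = 0` is
the Butcher series `x^j + ∑_{m ≥ 1} ε^m ∑_{τ ∈ [RT]_m} (c_τ/σ(τ)) D_τ^{x^j} V_π (x,p)`. -/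
structure IsButcherMap {d : ℕ} (c : (Σ m, TopTree m) → ℝ) (M : Set (Fin d → ℝ))
    (π : (Fin d → ℝ) → Matrix (Fin d) (Fin d) ℝ) (U : Set ((Fin d → ℝ) × (Fin d → ℝ)))
    (α : (Fin d → ℝ) × (Fin d → ℝ) → (Fin d → ℝ)) : Prop where
  isOpen : IsOpen U
  base : ∀ z ∈ U, z.1 ∈ M
  zero_mem : ∀ x ∈ M, (x, 0) ∈ U
  smooth : ContDiffOn ℝ ∞ α U
  mapsTo : Set.MapsTo α U M
  unit : ∀ x ∈ M, α (x, 0) = x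
  expansion : ∀ x ∈ M, ∀ p j, tay (fun t => α (x, t • p) j) =
    PowerSeries.C (x j) + PowerSeries.mk fun m =>
      ∑ τ : TopTree m, c ⟨m, τ⟩ / (τ.symmetry : ℝ) * τ.elemDiff j (sprayField π p) x

/-- The hamiltonian vector field `-∂_{p_j}H ∂_{x^j} + ∂_{x^j}H ∂_{p_j}` at `z = (x, p)`. -/
def hamiltonianField {d : ℕ} (H : (Fin d → ℝ) × (Fin d → ℝ) → ℝ)
    (z : (Fin d → ℝ) × (Fin d → ℝ)) : (Fin d → ℝ) × (Fin d → ℝ) :=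
  (fun j => -fderiv ℝ H z (0, Pi.single j 1), fun j => fderiv ℝ H z (Pi.single j 1, 0))

/-- The derivative `L_E H` along the Euler vector field `E = p_j ∂_{p_j}`. -/
def eulerDeriv {d : ℕ} (H : (Fin d → ℝ) × (Fin d → ℝ) → ℝ)
    (z : (Fin d → ℝ) × (Fin d → ℝ)) : ℝ :=
  fderiv ℝ H z (0, z.2)

/-- `S` is a smooth family of functions `S_t(p₁,p₂,x) = S ((p₁,p₂,x),t)`, `t ∈ [0,1]`, defined near
`X₀ = {(0,0,x) : x ∈ M}` in `X = (ℝ^d)^* × (ℝ^d)^* × M` and given by the formula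
`S_t(p₁,p₂,x(t)) = p₁(x₁) + p₂α(x₁,tp₁) - (1/t) ∫_0^t [L_E(p₂α)](φ_u^{p₂α}(x₁,tp₁)) du`,
`x(t) = qφ_t^{p₂α}(x₁,tp₁)`. Here `u ↦ z u`, `0 ≤ u ≤ t`, is the trajectory of `(x₁,tp₁)` under the
hamiltonian flow of `p₂α` on `U`. -/
structure IsGeneratedFamily {d : ℕ} (M : Set (Fin d → ℝ))
    (U : Set ((Fin d → ℝ) × (Fin d → ℝ))) (α : (Fin d → ℝ) × (Fin d → ℝ) → (Fin d → ℝ))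
    (Ω : Set (((Fin d → ℝ) × (Fin d → ℝ) × (Fin d → ℝ)) × ℝ))
    (S : ((Fin d → ℝ) × (Fin d → ℝ) × (Fin d → ℝ)) × ℝ → ℝ) : Prop where
  isOpen : IsOpen Ω
  base : ∀ y ∈ Ω, y.1.2.2 ∈ M
  unit_mem : ∀ x ∈ M, ∀ t ∈ Set.Icc (0 : ℝ) 1, ((0, 0, x), t) ∈ Ω
  smooth : ContDiffOn ℝ ∞ S (Ω ∩ Set.univ ×ˢ Set.Icc (0 : ℝ) 1)
  formula : ∀ (p₁ p₂ x₁ : Fin d → ℝ) (t : ℝ) (z : ℝ → (Fin d → ℝ) × (Fin d → ℝ)),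
    0 < t → t ≤ 1 → ((p₁, p₂, x₁), t) ∈ Ω → z 0 = (x₁, t • p₁) →
    (∀ u ∈ Set.Icc 0 t, z u ∈ U) →
    IsIntegralCurveOn z (fun _ => hamiltonianField fun w => p₂ ⬝ᵥ α w) (Set.Icc 0 t) →
    ((p₁, p₂, (z t).1), t) ∈ Ω →
    S ((p₁, p₂, (z t).1), t) = p₁ ⬝ᵥ x₁ + p₂ ⬝ᵥ α (x₁, t • p₁) -
      1 / t * ∫ u in (0 : ℝ)..t, eulerDeriv (fun w => p₂ ⬝ᵥ α w) (z u)

end TreeExpansion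

end

set_option linter.unusedSectionVars false

noncomputable section

namespace TreeExpansion

/-! ## Mixed partial derivatives of smooth functions -/

section MixedPartial

variable {d : ℕ} {M : Set (Fin d → ℝ)} {f g : (Fin d → ℝ) → ℝ}

/-! The scalar `s` in `s p₂` serves as a time variable. Put `H = p₂ · α`. The formula for `S_t` is
the method of characteristics for the Hamilton-Jacobi equation `∂_s W = H(x, t ∇_x W)` with `W = p₁
· x` at `s = 0`. Along a trajectory one sets `s = u/t`; the momentum is `t ∇W`, `H` is conserved,
and `dW/du = (1/t)(H - L_E H)`. Integration up to `u = t` gives `S_t` at `s = 1`.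

The equation is first solved formally, by `W = (p₁ + s p₂) · x + ∑ t^m W_m`. The symbol of a network
is homogeneous in `p₂`, of degree the number of its component trees, so at `s = 1` the operator
`∂_s` multiplies it by this positive number. The other side, in degree `m`, is the degree `m` part
of the Butcher series contracted with `p₂`, at the covector `p₁ + p₂ + ∑ t^n dW_n`. As a tree has at
least one vertex, only `W_n` with `n < m` enter, and dividing by the number of components gives a
recursion.

It must be seen that this part is again a combination of network symbols
(`isCombination_val_of_isLeg`). Expand it multilinearly in the covectors at the vertices. A covector
`p₁` is a left edge to the first terrestrial vertex. A covector `p₂` is removed by skew symmetry of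
`π`: the right edge to the parent becomes a left edge, the vertex becomes a root and the sign
changes; at a root the term is zero (`val_turn`, `val_eq_zero_of_root`). A covector `dW_n` becomes,
by the Leibniz rule, a left edge into some vertex of a network of `W_n` (`val_join`). In each case
trees of right edges remain joined to a tree by left edges, and every such graph comes from a
network (`exists_toGraph_eq`).

For the analytic part no exact solution is constructed. The series truncated at order `N` has
residual `O(t^(N+1))` (`isBigO_residual`), uniformly on compact sets and together with its space
derivatives (`uniform_bound_of_isBigO`). Along a true trajectory the truncated series therefore
differs from the action by `O(t^(N+1))` (`action_estimate`, `exists_trajectory`). So `S_t` and the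
series agree to this order at the endpoint of the trajectory, which moves with `t`. Uniform Taylor
remainders and continuity of the coefficients then identify these one at a time
(`limit_eq_zero_of_isBigO`, `IsGeneratedFamily.coeff_tay_eq`). -/

theorem pderiv_contDiffOn (hM : IsOpen M) (hf : ContDiffOn ℝ ∞ f M) (i : Fin d) :
    ContDiffOn ℝ ∞ (pderiv i f) M :=
  (hf.fderiv_of_isOpen hM (m := ∞) (by simp)).clm_apply contDiffOn_const

theorem pderiv_congr (hM : IsOpen M) (h : Set.EqOn f g M) (i : Fin d) :
    Set.EqOn (pderiv i f) (pderiv i g) M := fun x hx => by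
  unfold pderiv
  rw [(h.eventuallyEq_of_mem (hM.mem_nhds hx)).fderiv_eq]

theorem differentiableAt_of_contDiffOn {E F : Type*} [NormedAddCommGroup E] [NormedSpace ℝ E]
    [NormedAddCommGroup F] [NormedSpace ℝ F] {O : Set E} {f : E → F} (hO : IsOpen O)
    (hf : ContDiffOn ℝ ∞ f O) {x : E} (hx : x ∈ O) : DifferentiableAt ℝ f x :=
  (hf.contDiffAt (hO.mem_nhds hx)).differentiableAt (by simp)

theorem pderiv_comm (hM : IsOpen M) (hf : ContDiffOn ℝ ∞ f M) (i j : Fin d) :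
    Set.EqOn (pderiv i (pderiv j f)) (pderiv j (pderiv i f)) M := fun x hx => by
  have hd : DifferentiableAt ℝ (fderiv ℝ f) x :=
    differentiableAt_of_contDiffOn hM (hf.fderiv_of_isOpen hM (m := ∞) (by simp)) hx
  have h : ∀ v w : Fin d → ℝ, fderiv ℝ (fun y => fderiv ℝ f y v) x w =
      fderiv ℝ (fderiv ℝ f) x w v := fun v w => by
    rw [fderiv_clm_apply hd (differentiableAt_const v)]
    simp
  unfold pderiv
  rw [h, h]
  exact ((hf.contDiffAt (hM.mem_nhds hx)).isSymmSndFDerivAt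
    (by simpa using WithTop.coe_le_coe.2 (le_top (a := (2 : ℕ∞))))).eq _ _

theorem foldr_pderiv_contDiffOn (hM : IsOpen M) (hf : ContDiffOn ℝ ∞ f M) (l : List (Fin d)) :
    ContDiffOn ℝ ∞ (l.foldr pderiv f) M := by
  induction l with
  | nil => exact hf
  | cons i l ih => exact pderiv_contDiffOn hM ih i

/-- Adjacent transpositions generate all permutations, and each is an instance of the symmetry of
second derivatives. The sorted order built into `mixedPartial` is therefore immaterial on `M`. -/
theorem foldr_pderiv_perm (hM : IsOpen M) (hf : ContDiffOn ℝ ∞ f M) {l l' : List (Fin d)}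
    (h : l.Perm l') : Set.EqOn (l.foldr pderiv f) (l'.foldr pderiv f) M := by
  induction h with
  | nil => exact fun _ _ => rfl
  | cons i _ ih => exact pderiv_congr hM ih i
  | swap i j l => exact pderiv_comm hM (foldr_pderiv_contDiffOn hM hf l) j i
  | trans _ _ ih ih' => exact ih.trans ih'

theorem mixedPartial_contDiffOn (hM : IsOpen M) (hf : ContDiffOn ℝ ∞ f M)
    (s : Multiset (Fin d)) : ContDiffOn ℝ ∞ (mixedPartial s f) M :=
  foldr_pderiv_contDiffOn hM hf _

@[simp]
theorem mixedPartial_zero : mixedPartial 0 f = f := by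
  simp [mixedPartial]

theorem mixedPartial_cons (hM : IsOpen M) (hf : ContDiffOn ℝ ∞ f M) (i : Fin d)
    (s : Multiset (Fin d)) :
    Set.EqOn (mixedPartial (i ::ₘ s) f) (pderiv i (mixedPartial s f)) M := by
  refine foldr_pderiv_perm hM hf (l' := i :: s.sort) (Multiset.coe_eq_coe.1 ?_)
  rw [Multiset.sort_eq, ← Multiset.cons_coe, Multiset.sort_eq]

theorem mixedPartial_sum {ι : Type*} (hM : IsOpen M) (t : Finset ι) (a : ι → ℝ)
    {f : ι → (Fin d → ℝ) → ℝ} (hf : ∀ k, ContDiffOn ℝ ∞ (f k) M) (s : Multiset (Fin d)) :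
    Set.EqOn (mixedPartial s fun y => ∑ k ∈ t, a k * f k y)
      (fun y => ∑ k ∈ t, a k * mixedPartial s (f k) y) M := by
  induction s using Multiset.induction_on with
  | empty => simp [Set.EqOn]
  | cons i s ih =>
    have h : ContDiffOn ℝ ∞ (fun y => ∑ k ∈ t, a k * f k y) M :=
      ContDiffOn.sum fun k _ => contDiffOn_const.mul (hf k)
    refine (mixedPartial_cons hM h i s).trans ((pderiv_congr hM ih i).trans fun x hx => ?_)
    have hd : ∀ k, DifferentiableAt ℝ (mixedPartial s (f k)) x := fun k =>
      differentiableAt_of_contDiffOn hM (mixedPartial_contDiffOn hM (hf k) s) hx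
    unfold pderiv
    rw [fderiv_fun_sum fun k _ => (hd k).const_mul (a k)]
    simp only [_root_.sum_apply]
    refine Finset.sum_congr rfl fun k _ => ?_
    rw [fderiv_const_mul (hd k), mixedPartial_cons hM (hf k) i s hx]
    rfl

theorem mixedPartial_congr (hM : IsOpen M) (h : Set.EqOn f g M) (s : Multiset (Fin d)) :
    Set.EqOn (mixedPartial s f) (mixedPartial s g) M := by
  unfold mixedPartial
  induction s.sort with
  | nil => exact h
  | cons i l ih => exact pderiv_congr hM ih i

theorem mixedPartial_eq_neg (hM : IsOpen M) (hg : ContDiffOn ℝ ∞ g M)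
    (h : ∀ x ∈ M, f x = -g x) (s : Multiset (Fin d)) {x : Fin d → ℝ} (hx : x ∈ M) :
    mixedPartial s f x = -mixedPartial s g x := by
  have h1 := mixedPartial_sum hM {()} (fun _ => -1) (fun _ : Unit => hg) s hx
  rw [mixedPartial_congr hM (g := fun y => ∑ k ∈ {()}, (-1) * g y) (fun y hy => by simp [h y hy])
    s hx, h1]
  simp

/-- Exponentials are joint eigenfunctions of the partial derivatives; thus edges into terrestrial
vertices become contractions with `p`. -/
theorem mixedPartial_exp (p : Fin d → ℝ) (s : Multiset (Fin d)) (x : Fin d → ℝ) :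
    mixedPartial s (fun y => Real.exp (p ⬝ᵥ y)) x = (s.map p).prod * Real.exp (p ⬝ᵥ x) := by
  have hc : ContDiff ℝ ∞ fun y : Fin d → ℝ => Real.exp (p ⬝ᵥ y) := by
    unfold dotProduct; fun_prop
  revert x
  induction s using Multiset.induction_on with
  | empty => simp
  | cons i s ih =>
    intro x
    rw [mixedPartial_cons isOpen_univ hc.contDiffOn i s (Set.mem_univ x), funext ih]
    unfold pderiv
    have h1 : HasFDerivAt (fun y : Fin d → ℝ => p ⬝ᵥ y)
        (∑ j, p j • ContinuousLinearMap.proj (R := ℝ) (φ := fun _ : Fin d => ℝ) j) x := by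
      unfold dotProduct
      exact HasFDerivAt.fun_sum fun j _ => (hasFDerivAt_apply j x).const_mul (p j)
    rw [((h1.exp).const_mul _).fderiv]
    simp [Pi.single_apply]
    ring

theorem pderiv_prod {ι : Type*} [DecidableEq ι] (t : Finset ι) {f : ι → (Fin d → ℝ) → ℝ}
    {x : Fin d → ℝ} (hf : ∀ k, DifferentiableAt ℝ (f k) x) (i : Fin d) :
    pderiv i (fun y => ∏ k ∈ t, f k y) x =
      ∑ b ∈ t, ∏ k ∈ t, if k = b then pderiv i (f k) x else f k x := by
  unfold pderiv
  rw [(HasFDerivAt.finsetProd fun k (_ : k ∈ t) => (hf k).hasFDerivAt).fderiv]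
  simp only [_root_.sum_apply]
  refine Finset.sum_congr rfl fun b hb => ?_
  rw [← Finset.mul_prod_erase _ _ hb, if_pos rfl, _root_.smul_apply, smul_eq_mul,
    mul_comm]
  congr 1
  exact Finset.prod_congr rfl fun k hk => (if_neg (Finset.ne_of_mem_erase hk)).symm

end MixedPartial

end TreeExpansion

end

noncomputable section

namespace TreeExpansion

/-! ## Graphs of right and left edges -/

/-- A forest of right edges on `V` with a partially defined left edge from each vertex. -/
structure LeftRightGraph (V : Type) where
  forest : RootedForest V
  left : V → Option V

namespace LeftRightGraph

variable {V W : Type} [Fintype V] [DecidableEq V] [Fintype W] [DecidableEq W] {d : ℕ}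

/-- The right edge of `v`, with `parent v = v` at a root. -/
abbrev parent {V : Type} (G : LeftRightGraph V) : V → V := G.forest.parent

/-- The indices that the assignment `K` of a (left, right) pair of indices to each vertex gives to
the edges arriving at `v`. -/
def incoming (G : LeftRightGraph V) (K : V → Fin d × Fin d) (v : V) : Multiset (Fin d) :=
  ∑ w, ((if G.left w = some v then {(K w).1} else 0) +
    (if w ≠ v ∧ G.parent w = v then {(K w).2} else 0))

/-- The contribution of a vertex: the coefficient `π^{ij}`, differentiated along `s`, contracted
with `θ` at a free left leg and with `q` at a free right leg. -/
def vertexTerm (π : (Fin d → ℝ) → Matrix (Fin d) (Fin d) ℝ) (θ q : Fin d → ℝ) (l r : Bool)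
    (s : Multiset (Fin d)) (k : Fin d × Fin d) (x : Fin d → ℝ) : ℝ :=
  mixedPartial s (fun y => π y k.1 k.2) x * (if l then 1 else θ k.1) * (if r then q k.2 else 1)

/-- The contraction of the coefficients `π^{ij}` along a graph. The free left leg of `v` is
contracted with `θ v`, the free right legs with `q`. -/
def val (G : LeftRightGraph V) (π : (Fin d → ℝ) → Matrix (Fin d) (Fin d) ℝ)
    (θ : V → Fin d → ℝ) (q x : Fin d → ℝ) : ℝ :=
  ∑ K : V → Fin d × Fin d, ∏ v, vertexTerm π (θ v) q (G.left v).isSome (decide (G.parent v = v))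
    (G.incoming K v) (K v) x

variable {M : Set (Fin d → ℝ)} {π : (Fin d → ℝ) → Matrix (Fin d) (Fin d) ℝ}

theorem vertexTerm_contDiffOn (hM : IsOpen M) (hπ : ∀ i j, ContDiffOn ℝ ∞ (fun x => π x i j) M)
    (θ q : Fin d → ℝ) (l r : Bool) (s : Multiset (Fin d)) (k : Fin d × Fin d) :
    ContDiffOn ℝ ∞ (vertexTerm π θ q l r s k) M :=
  ((mixedPartial_contDiffOn hM (hπ _ _) s).mul contDiffOn_const).mul contDiffOn_const

theorem pderiv_vertexTerm (hM : IsOpen M) (hπ : ∀ i j, ContDiffOn ℝ ∞ (fun x => π x i j) M)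
    (θ q : Fin d → ℝ) (l r : Bool) (s : Multiset (Fin d)) (k : Fin d × Fin d) (i : Fin d)
    {x : Fin d → ℝ} (hx : x ∈ M) :
    pderiv i (vertexTerm π θ q l r s k) x = vertexTerm π θ q l r (i ::ₘ s) k x := by
  have h := differentiableAt_of_contDiffOn hM (mixedPartial_contDiffOn hM (hπ k.1 k.2) s) hx
  unfold vertexTerm
  rw [mixedPartial_cons hM (hπ _ _) i s hx]
  unfold pderiv
  rw [fderiv_mul_const (h.mul_const _), fderiv_mul_const h]
  simp only [_root_.smul_apply, smul_eq_mul]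
  ring

theorem val_contDiffOn (hM : IsOpen M) (hπ : ∀ i j, ContDiffOn ℝ ∞ (fun x => π x i j) M)
    (G : LeftRightGraph V) (θ : V → Fin d → ℝ) (q : Fin d → ℝ) :
    ContDiffOn ℝ ∞ (G.val π θ q) M :=
  ContDiffOn.sum fun _ _ => contDiffOn_prod fun _ _ => vertexTerm_contDiffOn hM hπ _ _ _ _ _ _

/-- By the Leibniz rule the derivative falls on one vertex `b`, where it acts like one more incoming
edge with index `i`. -/
theorem pderiv_val (hM : IsOpen M) (hπ : ∀ i j, ContDiffOn ℝ ∞ (fun x => π x i j) M)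
    (G : LeftRightGraph V) (θ : V → Fin d → ℝ) (q : Fin d → ℝ) (i : Fin d) {x : Fin d → ℝ}
    (hx : x ∈ M) :
    pderiv i (G.val π θ q) x = ∑ b, ∑ K : V → Fin d × Fin d, ∏ v,
      vertexTerm π (θ v) q (G.left v).isSome (decide (G.parent v = v))
        ((if v = b then {i} else 0) + G.incoming K v) (K v) x := by
  have hd : ∀ (K : V → Fin d × Fin d) (v : V), DifferentiableAt ℝ (vertexTerm π (θ v) q
      (G.left v).isSome (decide (G.parent v = v)) (G.incoming K v) (K v)) x := fun K v =>
    differentiableAt_of_contDiffOn hM (vertexTerm_contDiffOn hM hπ _ _ _ _ _ _) hx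
  have h1 : pderiv i (G.val π θ q) x = ∑ K : V → Fin d × Fin d, pderiv i (fun y => ∏ v,
      vertexTerm π (θ v) q (G.left v).isSome (decide (G.parent v = v)) (G.incoming K v) (K v) y)
      x := by
    unfold pderiv val
    rw [fderiv_fun_sum fun K _ => (HasFDerivAt.finsetProd fun v _ =>
      (hd K v).hasFDerivAt).differentiableAt]
    simp only [_root_.sum_apply]
  rw [h1, Finset.sum_comm]
  refine Finset.sum_congr rfl fun K _ => ?_
  rw [pderiv_prod Finset.univ (hd K) i]
  refine Finset.sum_congr rfl fun b _ => Finset.prod_congr rfl fun v _ => ?_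
  split_ifs
  · rw [pderiv_vertexTerm hM hπ _ _ _ _ _ _ _ hx, Multiset.singleton_add]
  · rw [zero_add]

/-! ### Linearity in the covectors at the free legs -/

/-- Only the factor of `v` sees the covector at `v`, and it does so linearly because the left leg of
`v` is free. -/
theorem val_update_sum {ι : Type*} (G : LeftRightGraph V) {v : V} (hv : G.left v = none)
    (t : Finset ι) (a : ι → ℝ) (η : ι → Fin d → ℝ) (θ : V → Fin d → ℝ) (q x : Fin d → ℝ) :
    G.val π (Function.update θ v fun i => ∑ k ∈ t, a k * η k i) q x =
      ∑ k ∈ t, a k * G.val π (Function.update θ v (η k)) q x := by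
  unfold val
  simp only [Finset.mul_sum]
  rw [Finset.sum_comm]
  refine Finset.sum_congr rfl fun K _ => ?_
  rw [← Finset.mul_prod_erase _ _ (Finset.mem_univ v)]
  have h : ∀ k ∈ t, a k * ∏ w, vertexTerm π (Function.update θ v (η k) w) q (G.left w).isSome
        (decide (G.parent w = w)) (G.incoming K w) (K w) x =
      a k * vertexTerm π (η k) q (G.left v).isSome (decide (G.parent v = v)) (G.incoming K v)
        (K v) x * ∏ w ∈ Finset.univ.erase v, vertexTerm π (θ w) q (G.left w).isSome
        (decide (G.parent w = w)) (G.incoming K w) (K w) x := fun k _ => by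
    rw [← Finset.mul_prod_erase _ _ (Finset.mem_univ v), Function.update_self, mul_assoc]
    congr 2
    exact Finset.prod_congr rfl fun w hw => by
      rw [Function.update_of_ne (Finset.ne_of_mem_erase hw)]
  rw [Finset.sum_congr rfl h, ← Finset.sum_mul]
  congr 1
  · simp only [Function.update_self, hv, vertexTerm, Option.isSome_none, Bool.false_eq_true,
      if_false, Finset.mul_sum, Finset.sum_mul]
    exact Finset.sum_congr rfl fun k _ => by ring
  · exact Finset.prod_congr rfl fun w hw => by
      rw [Function.update_of_ne (Finset.ne_of_mem_erase hw)]

theorem val_update_add (G : LeftRightGraph V) {v : V} (hv : G.left v = none)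
    (η η' : Fin d → ℝ) (θ : V → Fin d → ℝ) (q x : Fin d → ℝ) :
    G.val π (Function.update θ v (η + η')) q x =
      G.val π (Function.update θ v η) q x + G.val π (Function.update θ v η') q x := by
  have h := G.val_update_sum (π := π) hv Finset.univ (fun _ : Bool => 1)
    (fun b => if b then η else η') θ q x
  simpa [← Pi.add_def] using h

theorem val_congr (G : LeftRightGraph V) {θ θ' : V → Fin d → ℝ}
    (h : ∀ v, G.left v = none → θ v = θ' v) (q x : Fin d → ℝ) :
    G.val π θ q x = G.val π θ' q x := by
  refine Finset.sum_congr rfl fun K _ => Finset.prod_congr rfl fun v _ => ?_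
  cases hv : G.left v with
  | none => rw [h v hv]
  | some b => simp [vertexTerm]

/-- Distributing the product of the vertex factors over the sums leaves one term for each choice `n`
of a summand at every vertex. -/
theorem val_sum_of_left_eq_none {ι : Type*} [DecidableEq ι] (G : LeftRightGraph V)
    (hG : ∀ v, G.left v = none)
    (t : Finset ι) (a : ι → ℝ) (η : ι → Fin d → ℝ) (q x : Fin d → ℝ) :
    G.val π (fun _ i => ∑ k ∈ t, a k * η k i) q x =
      ∑ n ∈ Fintype.piFinset fun _ : V => t, (∏ v, a (n v)) * G.val π (fun v => η (n v)) q x := by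
  unfold val
  simp only [Finset.mul_sum]
  rw [Finset.sum_comm]
  refine Finset.sum_congr rfl fun K _ => ?_
  have h : ∀ v, vertexTerm π (fun i => ∑ k ∈ t, a k * η k i) q (G.left v).isSome
      (decide (G.parent v = v)) (G.incoming K v) (K v) x =
      ∑ k ∈ t, a k * vertexTerm π (η k) q (G.left v).isSome
      (decide (G.parent v = v)) (G.incoming K v) (K v) x := fun v => by
    simp only [hG, vertexTerm, Option.isSome_none, Bool.false_eq_true,
      if_false, Finset.mul_sum, Finset.sum_mul]
    exact Finset.sum_congr rfl fun k _ => by ring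
  rw [Finset.prod_congr rfl fun v _ => h v, Finset.prod_univ_sum]
  exact Finset.sum_congr rfl fun n _ => Finset.prod_mul_distrib

/-- The covector `q` occurs once for each root. This homogeneity is what makes Euler's identity
available in the Hamilton-Jacobi equation. -/
theorem val_smul (G : LeftRightGraph V) (θ : V → Fin d → ℝ) (s : ℝ) (q x : Fin d → ℝ) :
    G.val π θ (s • q) x =
      s ^ (Finset.univ.filter fun v => G.parent v = v).card * G.val π θ q x := by
  unfold val
  rw [Finset.mul_sum]
  refine Finset.sum_congr rfl fun K _ => ?_
  have h : ∀ v, vertexTerm π (θ v) (s • q) (G.left v).isSome (decide (G.parent v = v))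
      (G.incoming K v) (K v) x = (if G.parent v = v then s else 1) * vertexTerm π (θ v) q
      (G.left v).isSome (decide (G.parent v = v)) (G.incoming K v) (K v) x := fun v => by
    by_cases hv : G.parent v = v
    · simp only [vertexTerm, hv, decide_true, if_true, Pi.smul_apply, smul_eq_mul]; ring
    · simp [vertexTerm, hv]
  rw [Finset.prod_congr rfl fun v _ => h v, Finset.prod_mul_distrib, Finset.prod_ite]
  simp

/-! ### Relabelling the vertices -/

/-- The image of a graph under a bijection of the vertices. -/
def map (G : LeftRightGraph V) (e : V ≃ W) : LeftRightGraph W where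
  forest :=
    { parent := fun w => e (G.parent (e.symm w))
      reaches := fun w => by
        obtain ⟨k, hk⟩ := G.forest.reaches (e.symm w)
        have h : ∀ j, (fun w => e (G.parent (e.symm w)))^[j] w =
            e (G.parent^[j] (e.symm w)) := fun j => by
          induction j with
          | zero => simp
          | succ j ih => rw [Function.iterate_succ_apply', Function.iterate_succ_apply', ih]; simp
        exact ⟨k, by rw [h, e.symm_apply_apply]; exact congrArg e hk⟩ }
  left w := (G.left (e.symm w)).map e

theorem val_map (G : LeftRightGraph V) (e : V ≃ W) (θ : Fin d → ℝ) (q x : Fin d → ℝ) :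
    (G.map e).val π (fun _ => θ) q x = G.val π (fun _ => θ) q x := by
  symm
  refine Fintype.sum_equiv (Equiv.arrowCongr e (Equiv.refl _)) _ _ fun K => ?_
  have h1 : (Equiv.arrowCongr e (Equiv.refl (Fin d × Fin d))) K = K ∘ e.symm := rfl
  rw [h1]
  refine Fintype.prod_equiv e _ _ fun v => ?_
  have h2 : (G.map e).incoming (K ∘ e.symm) (e v) = G.incoming K v := by
    symm
    refine Fintype.sum_equiv e _ _ fun w => ?_
    have h3 : ∀ o : Option V, o.map e = some (e v) ↔ o = some v := fun o => by
      cases o <;> simp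
    simp [map, parent, h3]
  have h4 : ((G.map e).left (e v)).isSome = (G.left v).isSome := by simp [map]
  have h5 : decide ((G.map e).parent (e v) = e v) = decide (G.parent v = v) := by
    simp [map, parent]
  rw [h2, h4, h5]
  simp

/-! ### Turning a left leg contracted with `q` -/

/-- The graph in which the right edge of `v` has become the left edge. -/
def turn (G : LeftRightGraph V) (v : V) : LeftRightGraph V where
  forest :=
    { parent := Function.update G.parent v v
      reaches := fun w => by
        obtain ⟨k, hk⟩ := G.forest.reaches w
        -- Follow the old path to the root, but stop if it meets `v`, which is now a root itself.
        induction k generalizing w with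
        | zero =>
          refine ⟨0, ?_⟩
          by_cases hw : w = v
          · simp [hw]
          · simpa [Function.update_of_ne hw] using hk
        | succ k ih =>
          by_cases hw : w = v
          · exact ⟨0, by simp [hw]⟩
          · obtain ⟨j, hj⟩ := ih (G.parent w) hk
            refine ⟨j + 1, ?_⟩
            rw [Function.iterate_succ_apply, Function.update_of_ne hw]
            exact hj }
  left := Function.update G.left v (some (G.parent v))

/-- Interchanging the left and the right index at `v`. -/
def swapAt (v : V) : Equiv.Perm (V → Fin d × Fin d) :=
  { toFun := fun K => Function.update K v (K v).swap
    invFun := fun K => Function.update K v (K v).swap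
    left_inv := fun K => by simp
    right_inv := fun K => by simp }

theorem swapAt_self (v : V) (K : V → Fin d × Fin d) : swapAt v K v = (K v).swap := by
  simp [swapAt]

theorem swapAt_of_ne {v w : V} (h : w ≠ v) (K : V → Fin d × Fin d) : swapAt v K w = K w := by
  simp [swapAt, h]

theorem mixedPartial_skew (hM : IsOpen M) (hπ : ∀ i j, ContDiffOn ℝ ∞ (fun x => π x i j) M)
    (hs : ∀ x ∈ M, ∀ i j, π x i j = -π x j i) (s : Multiset (Fin d)) (i j : Fin d)
    {x : Fin d → ℝ} (hx : x ∈ M) :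
    mixedPartial s (fun y => π y i j) x = -mixedPartial s (fun y => π y j i) x :=
  mixedPartial_eq_neg hM (hπ j i) (fun y hy => hs y hy i j) s hx

/-- Rename the two indices at `v`. Skew symmetry of `π` gives the sign; the index that went to the
parent is now the left one, and the index contracted with `q` is the free right leg of a new root.
The indices arriving at each vertex are unchanged. -/
theorem val_turn (hM : IsOpen M) (hπ : ∀ i j, ContDiffOn ℝ ∞ (fun x => π x i j) M)
    (hs : ∀ x ∈ M, ∀ i j, π x i j = -π x j i) (G : LeftRightGraph V) {v : V}
    (hv : G.left v = none) (hr : G.parent v ≠ v) (θ : V → Fin d → ℝ) (q : Fin d → ℝ)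
    (hθ : θ v = q) {x : Fin d → ℝ} (hx : x ∈ M) :
    G.val π θ q x = -(G.turn v).val π θ q x := by
  unfold val
  rw [← Finset.sum_neg_distrib]
  refine Fintype.sum_equiv (swapAt v) _ _ fun K => ?_
  have hinc : ∀ w, (G.turn v).incoming (swapAt v K) w = G.incoming K w := fun w => by
    refine Finset.sum_congr rfl fun u _ => ?_
    by_cases hu : u = v
    · subst hu
      have h1 : (u ≠ w ∧ G.parent u = w) ↔ G.parent u = w :=
        ⟨And.right, fun h => ⟨fun h2 => hr (h.trans h2.symm), h⟩⟩
      have h2 : ¬(u ≠ w ∧ u = w) := fun h => h.1 h.2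
      simp only [turn, parent] at h1 ⊢
      simp [h1, h2, hv, swapAt_self]
    · simp only [turn, parent, Function.update_of_ne hu, swapAt_of_ne hu]
  rw [← Finset.mul_prod_erase _ _ (Finset.mem_univ v),
    ← Finset.mul_prod_erase Finset.univ (fun w => vertexTerm π (θ w) q ((G.turn v).left w).isSome
      (decide ((G.turn v).parent w = w)) ((G.turn v).incoming (swapAt v K) w) (swapAt v K w) x)
      (Finset.mem_univ v), ← neg_mul]
  congr 1
  · have h1 : ((G.turn v).left v).isSome = true := by simp [turn]
    have h2 : decide ((G.turn v).parent v = v) = true := by simp [turn, parent]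
    have h3 : decide (G.parent v = v) = false := by simp [hr]
    rw [hinc, swapAt_self, h1, h2, h3, hv, hθ]
    simp only [vertexTerm, Option.isSome_none, Prod.fst_swap, Prod.snd_swap, if_true,
      Bool.false_eq_true, if_false]
    rw [mixedPartial_skew hM hπ hs _ (K v).1 (K v).2 hx]
    ring
  · refine Finset.prod_congr rfl fun w hw => ?_
    have hw := Finset.ne_of_mem_erase hw
    rw [hinc, swapAt_of_ne hw]
    simp only [turn, parent, Function.update_of_ne hw]

/-- Both legs of `v` are contracted with the same covector, and the coefficient is skew in the two
indices: interchanging them maps the sum to its negative. -/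
theorem val_eq_zero_of_root (hM : IsOpen M) (hπ : ∀ i j, ContDiffOn ℝ ∞ (fun x => π x i j) M)
    (hs : ∀ x ∈ M, ∀ i j, π x i j = -π x j i) (G : LeftRightGraph V) {v : V}
    (hv : G.left v = none) (hr : G.parent v = v) (θ : V → Fin d → ℝ) (q : Fin d → ℝ)
    (hθ : θ v = q) {x : Fin d → ℝ} (hx : x ∈ M) :
    G.val π θ q x = 0 := by
  have h : G.val π θ q x = -G.val π θ q x := by
    unfold val
    rw [← Finset.sum_neg_distrib]
    refine Fintype.sum_equiv (swapAt v) _ _ fun K => ?_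
    have hinc : ∀ w, G.incoming (swapAt v K) w = G.incoming K w := fun w => by
      refine Finset.sum_congr rfl fun u _ => ?_
      by_cases hu : u = v
      · subst hu
        have h2 : ¬(u ≠ w ∧ G.parent u = w) := fun h => h.1 (hr.symm.trans h.2)
        simp [h2, hv]
      · simp only [swapAt_of_ne hu]
    rw [← Finset.mul_prod_erase _ _ (Finset.mem_univ v),
      ← Finset.mul_prod_erase Finset.univ (fun w => vertexTerm π (θ w) q (G.left w).isSome
        (decide (G.parent w = w)) (G.incoming (swapAt v K) w) (swapAt v K w) x)
        (Finset.mem_univ v), ← neg_mul]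
    congr 1
    · have h2 : decide (G.parent v = v) = true := by simp [hr]
      rw [hinc, swapAt_self, h2, hv, hθ]
      simp only [vertexTerm, Option.isSome_none, Prod.fst_swap, Prod.snd_swap, if_true,
        Bool.false_eq_true, if_false]
      rw [mixedPartial_skew hM hπ hs _ (K v).1 (K v).2 hx]
      ring
    · refine Finset.prod_congr rfl fun w hw => ?_
      rw [hinc, swapAt_of_ne (Finset.ne_of_mem_erase hw)]
  linarith

/-! ### Joining two graphs by a left edge -/

/-- The disjoint union of two graphs with a new left edge from `v` to `b`. -/
def join (G : LeftRightGraph V) (v : V) (G' : LeftRightGraph W) (b : W) :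
    LeftRightGraph (V ⊕ W) where
  forest :=
    { parent := Sum.map G.parent G'.parent
      reaches := by
        have h : ∀ k, (Sum.map G.parent G'.parent)^[k] = Sum.map G.parent^[k] G'.parent^[k] :=
          fun k => by
            induction k with
            | zero => simp
            | succ k ih => rw [Function.iterate_succ, ih, Sum.map_comp_map]; rfl
        rintro (w | w)
        · obtain ⟨k, hk⟩ := G.forest.reaches w
          exact ⟨k, by rw [h]; simpa using hk⟩
        · obtain ⟨k, hk⟩ := G'.forest.reaches w
          exact ⟨k, by rw [h]; simpa using hk⟩ }
  left := Sum.elim (Function.update (fun w => (G.left w).map Sum.inl) v (some (Sum.inr b)))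
    fun w => (G'.left w).map Sum.inr

@[simp]
theorem join_left_inl (G : LeftRightGraph V) (v : V) (G' : LeftRightGraph W) (b : W) (w : V) :
    (G.join v G' b).left (Sum.inl w) =
      if w = v then some (Sum.inr b) else (G.left w).map Sum.inl := by
  refine Eq.trans (b := Function.update (fun w => (G.left w).map Sum.inl) v (some (Sum.inr b)) w)
    rfl ?_
  rw [Function.update_apply]

@[simp]
theorem join_left_inr (G : LeftRightGraph V) (v : V) (G' : LeftRightGraph W) (b w : W) :
    (G.join v G' b).left (Sum.inr w) = (G'.left w).map Sum.inr := rfl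

@[simp]
theorem join_parent_inl (G : LeftRightGraph V) (v : V) (G' : LeftRightGraph W) (b : W) (w : V) :
    (G.join v G' b).parent (Sum.inl w) = Sum.inl (G.parent w) := rfl

@[simp]
theorem join_parent_inr (G : LeftRightGraph V) (v : V) (G' : LeftRightGraph W) (b w : W) :
    (G.join v G' b).parent (Sum.inr w) = Sum.inr (G'.parent w) := rfl

theorem incoming_join_inl (G : LeftRightGraph V) {v : V} (hv : G.left v = none)
    (G' : LeftRightGraph W) (b : W) (K : V → Fin d × Fin d) (K' : W → Fin d × Fin d) (w : V) :
    (G.join v G' b).incoming (Sum.elim K K') (Sum.inl w) = G.incoming K w := by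
  unfold incoming
  rw [Fintype.sum_sum_type]
  have h1 : ∀ u, (G.join v G' b).left (Sum.inr u) ≠ some (Sum.inl w) := fun u => by
    simp
  have h2 : ∀ u, ¬((Sum.inr u : V ⊕ W) ≠ Sum.inl w ∧
      (G.join v G' b).parent (Sum.inr u) = Sum.inl w) := fun u => by
    simp
  simp only [h1, h2, if_false, add_zero, Finset.sum_const_zero]
  refine Finset.sum_congr rfl fun u _ => ?_
  have h3 : (G.join v G' b).left (Sum.inl u) = some (Sum.inl w) ↔ G.left u = some w := by
    by_cases hu : u = v
    · subst hu; simp [hv]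
    · simp [hu]
  simp only [h3]
  simp

theorem incoming_join_inr (G : LeftRightGraph V) {v : V} (G' : LeftRightGraph W) (b : W)
    (K : V → Fin d × Fin d) (K' : W → Fin d × Fin d) (w : W) :
    (G.join v G' b).incoming (Sum.elim K K') (Sum.inr w) =
      (if w = b then {(K v).1} else 0) + G'.incoming K' w := by
  unfold incoming
  rw [Fintype.sum_sum_type]
  congr 1
  · have h2 : ∀ u, ¬((Sum.inl u : V ⊕ W) ≠ Sum.inr w ∧
        (G.join v G' b).parent (Sum.inl u) = Sum.inr w) := fun u => by
      simp
    simp only [h2, if_false, add_zero]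
    rw [Finset.sum_eq_single v]
    · simp [eq_comm]
    · intro u _ hu
      simp [hu]
    · simp
  · refine Finset.sum_congr rfl fun u _ => ?_
    simp

/-- The covector at `v` is a differential, so the Leibniz rule distributes the derivative over the
vertices `b` of `G'`. Summing over the left index of `v`, which is also the index of this
derivative, is what a left edge from `v` to `b` stands for. -/
theorem val_join (hM : IsOpen M) (hπ : ∀ i j, ContDiffOn ℝ ∞ (fun x => π x i j) M)
    (G : LeftRightGraph V) {v : V} (hv : G.left v = none) (G' : LeftRightGraph W)
    (θ : V → Fin d → ℝ) (θ' : W → Fin d → ℝ) (q : Fin d → ℝ) {x : Fin d → ℝ} (hx : x ∈ M)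
    (hθ : θ v = fun i => pderiv i (G'.val π θ' q) x) :
    G.val π θ q x = ∑ b, (G.join v G' b).val π (Sum.elim θ θ') q x := by
  have h1 : ∀ b, (G.join v G' b).val π (Sum.elim θ θ') q x = ∑ K : V → Fin d × Fin d,
      ∑ K' : W → Fin d × Fin d,
      (∏ w, vertexTerm π (θ w) q ((G.join v G' b).left (Sum.inl w)).isSome
        (decide (G.parent w = w)) (G.incoming K w) (K w) x) *
      ∏ w, vertexTerm π (θ' w) q (G'.left w).isSome (decide (G'.parent w = w))
        ((if w = b then {(K v).1} else 0) + G'.incoming K' w) (K' w) x := fun b => by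
    rw [val, ← (Equiv.sumArrowEquivProdArrow V W (Fin d × Fin d)).symm.sum_comp,
      Fintype.sum_prod_type]
    refine Finset.sum_congr rfl fun K _ => Finset.sum_congr rfl fun K' _ => ?_
    have h2 : (Equiv.sumArrowEquivProdArrow V W (Fin d × Fin d)).symm (K, K') = Sum.elim K K' :=
      rfl
    rw [h2, Fintype.prod_sum_type]
    congr 1
    · refine Finset.prod_congr rfl fun w _ => ?_
      rw [incoming_join_inl G hv]
      have h3 : ((G.join v G' b).parent (Sum.inl w) = Sum.inl w) ↔ G.parent w = w := by
        simp
      simp only [Sum.elim_inl, h3]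
    · refine Finset.prod_congr rfl fun w _ => ?_
      rw [incoming_join_inr G]
      have h3 : ((G.join v G' b).parent (Sum.inr w) = Sum.inr w) ↔ G'.parent w = w := by
        simp
      have h4 : ((G.join v G' b).left (Sum.inr w)).isSome = (G'.left w).isSome := by
        simp
      simp only [Sum.elim_inr, h3, h4]
  rw [Finset.sum_congr rfl fun b _ => h1 b, Finset.sum_comm, val]
  refine Finset.sum_congr rfl fun K _ => ?_
  rw [← Finset.mul_prod_erase _ _ (Finset.mem_univ v)]
  -- The factor coming from `G` does not depend on `b`. At `v` the left leg is now occupied, whence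
  -- the flag `true`.
  have h5 : ∀ b, (∏ w, vertexTerm π (θ w) q ((G.join v G' b).left (Sum.inl w)).isSome
        (decide (G.parent w = w)) (G.incoming K w) (K w) x) =
      vertexTerm π (θ v) q true (decide (G.parent v = v)) (G.incoming K v) (K v) x *
      ∏ w ∈ Finset.univ.erase v, vertexTerm π (θ w) q (G.left w).isSome
        (decide (G.parent w = w)) (G.incoming K w) (K w) x := fun b => by
    rw [← Finset.mul_prod_erase _ _ (Finset.mem_univ v)]
    congr 1
    · simp
    · refine Finset.prod_congr rfl fun w hw => ?_
      simp [Finset.ne_of_mem_erase hw]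
  simp only [h5, ← Finset.mul_sum]
  rw [← pderiv_val hM hπ G' θ' q (K v).1 hx]
  have h6 : vertexTerm π (θ v) q (G.left v).isSome (decide (G.parent v = v)) (G.incoming K v)
      (K v) x = vertexTerm π (θ v) q true (decide (G.parent v = v)) (G.incoming K v)
      (K v) x * pderiv (K v).1 (G'.val π θ' q) x := by
    simp only [vertexTerm, hv, hθ, Option.isSome_none, Bool.false_eq_true, if_false, if_true]
    ring
  rw [h6]
  ring

end LeftRightGraph

end TreeExpansion

end

noncomputable section

namespace TreeExpansion

/-! ## Connected graphs with few edges -/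

instance {N : Type} [Finite N] (T : RootedTree N) : Finite T.Edge :=
  inferInstanceAs (Finite {v : N // v ≠ T.root})

theorem RootedTree.card_edge {N : Type} [Finite N] (T : RootedTree N) :
    Nat.card T.Edge + 1 = Nat.card N := by
  classical
  have := Fintype.ofFinite N
  have h : Nat.card T.Edge = Nat.card {v : N // v ≠ T.root} := rfl
  have := Fintype.card_pos_iff.2 ⟨T.root⟩
  rw [h, Nat.card_eq_fintype_card, Nat.card_eq_fintype_card, Fintype.card_subtype_compl,
    Fintype.card_subtype_eq]
  omega

section Counting

variable {N α : Type} [Finite N]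

/-- Test the hypothesis on the predicate "reachable from `x`". Connectedness is expressed by
predicates invariant along edges since these restrict and transport easily when graphs are turned or
joined. -/
theorem connected_fromRel [Nonempty N] (A : Finset α) (s t : α → N)
    (hc : ∀ f : N → Prop, (∀ a ∈ A, f (t a) ↔ f (s a)) → ∀ x y, f x → f y) :
    (SimpleGraph.fromRel fun x y => ∃ a ∈ A, s a = x ∧ t a = y).Connected where
  preconnected x y := by
    refine hc (fun z => SimpleGraph.Reachable _ x z) (fun a ha => ?_) x y (.refl _)
    by_cases h : s a = t a
    · rw [h]
    · have h1 : (SimpleGraph.fromRel fun x y => ∃ a ∈ A, s a = x ∧ t a = y).Adj (s a) (t a) :=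
        (SimpleGraph.fromRel_adj _ _ _).2 ⟨h, Or.inl ⟨a, ha, rfl, rfl⟩⟩
      exact ⟨fun h2 => h2.trans h1.symm.reachable, fun h2 => h2.trans h1.reachable⟩

/-- A connected graph has at least `card N - 1` edges, and here there are at most `A.card` of them.
Equality throughout forces a tree, and forces distinct members of `A` to give distinct edges. -/
theorem isTree_fromRel_of_card (A : Finset α) (s t : α → N)
    (hc : ∀ f : N → Prop, (∀ a ∈ A, f (t a) ↔ f (s a)) → ∀ x y, f x → f y)
    (hcard : A.card + 1 = Nat.card N) :
    (SimpleGraph.fromRel fun x y => ∃ a ∈ A, s a = x ∧ t a = y).IsTree ∧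
      Set.InjOn (fun a => s(s a, t a)) A := by
  classical
  have : Nonempty N := (Nat.card_pos_iff.1 (by omega)).1
  have := Fintype.ofFinite N
  have hconn := connected_fromRel A s t hc
  set G := SimpleGraph.fromRel fun x y => ∃ a ∈ A, s a = x ∧ t a = y with hG
  have hsub : G.edgeFinset ⊆ A.image fun a => s(s a, t a) := by
    intro e he
    induction e with
    | h x y =>
      rw [SimpleGraph.mem_edgeFinset, SimpleGraph.mem_edgeSet, hG, SimpleGraph.fromRel_adj] at he
      obtain ⟨-, ⟨a, ha, rfl, rfl⟩ | ⟨a, ha, rfl, rfl⟩⟩ := he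
      · exact Finset.mem_image_of_mem _ ha
      · rw [Sym2.eq_swap]; exact Finset.mem_image_of_mem (fun a => s(s a, t a)) ha
  have h1 := hconn.card_vert_le_card_edgeSet_add_one
  have h2 : Nat.card G.edgeSet = G.edgeFinset.card := by
    rw [SimpleGraph.edgeFinset_card, Nat.card_eq_fintype_card]
  have h3 := Finset.card_le_card hsub
  have h4 : (A.image fun a => s(s a, t a)).card ≤ A.card := Finset.card_image_le
  refine ⟨SimpleGraph.isTree_iff_connected_and_card.2 ⟨hconn, by omega⟩, ?_⟩
  exact Finset.card_image_iff.1 (by omega)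

/-- Fix any root `r` and send every other vertex to a neighbour nearer to `r`, along some member of
`A`. If two vertices used the same member, each would be nearer to `r` than the other; so `ed` is
injective, and counting makes it onto `A`. -/
theorem exists_rootedTree_of_card (A : Finset α) (s t : α → N)
    (hc : ∀ f : N → Prop, (∀ a ∈ A, f (t a) ↔ f (s a)) → ∀ x y, f x → f y)
    (hcard : A.card + 1 = Nat.card N) :
    ∃ (T : RootedTree N) (ed : T.Edge → α), Function.Injective ed ∧
      (∀ e, ed e ∈ A ∧ ((s (ed e) = e.1 ∧ t (ed e) = T.parent e.1) ∨
        (t (ed e) = e.1 ∧ s (ed e) = T.parent e.1))) ∧ ∀ a ∈ A, ∃ e, ed e = a := by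
  classical
  obtain ⟨r⟩ : Nonempty N := (Nat.card_pos_iff.1 (by omega)).1
  have : Nonempty N := ⟨r⟩
  have hconn := connected_fromRel A s t hc
  set G := SimpleGraph.fromRel fun x y => ∃ a ∈ A, s a = x ∧ t a = y with hG
  have hstep : ∀ x, x ≠ r → ∃ y, (∃ a ∈ A, (s a = x ∧ t a = y) ∨ (t a = x ∧ s a = y)) ∧
      G.dist y r < G.dist x r := fun x hx => by
    obtain ⟨w, hw⟩ := hconn.exists_walk_length_eq_dist x r
    cases w with
    | nil => exact absurd rfl hx
    | @cons _ y _ h p =>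
      have h1 : G.dist y r < G.dist x r := by
        have := SimpleGraph.dist_le p
        rw [SimpleGraph.Walk.length_cons] at hw
        omega
      rw [hG, SimpleGraph.fromRel_adj] at h
      obtain ⟨-, ⟨a, ha, h2, h3⟩ | ⟨a, ha, h2, h3⟩⟩ := h
      · exact ⟨y, ⟨a, ha, Or.inl ⟨h2, h3⟩⟩, h1⟩
      · exact ⟨y, ⟨a, ha, Or.inr ⟨h3, h2⟩⟩, h1⟩
  choose! par hex hdist using hstep
  let T : RootedTree N :=
    { root := r
      parent := fun x => if x = r then r else par x
      parent_root := if_pos rfl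
      reaches := by
        have : ∀ n x, G.dist x r = n →
      ∃ k : ℕ, (fun x => if x = r then r else par x)^[k] x = r := by
          intro n
          induction n using Nat.strong_induction_on with
          | _ n ih =>
            intro x hx
            by_cases h : x = r
            · exact ⟨0, h⟩
            · obtain ⟨k, hk⟩ := ih _ (hx ▸ hdist x h) (par x) rfl
              exact ⟨k + 1, by rw [Function.iterate_succ_apply, if_neg h, hk]⟩
        exact fun x => this _ x rfl }
  have hpar : ∀ e : T.Edge, T.parent e.1 = par e.1 := fun e => if_neg e.2
  choose ed hedA hed using fun e : T.Edge => hex e.1 e.2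
  have hinj : Function.Injective ed := by
    intro e e' h
    have h1 := hed e
    have h1' := hed e'
    have h2 := hdist e.1 e.2
    have h2' := hdist e'.1 e'.2
    rw [← h] at h1'
    refine Subtype.ext ?_
    by_contra hne
    have h3 : par e.1 = e'.1 ∧ par e'.1 = e.1 := by
      rcases h1 with ⟨ha, hb⟩ | ⟨ha, hb⟩ <;> rcases h1' with ⟨hc, hd⟩ | ⟨hc, hd⟩
      · exact absurd (ha.symm.trans hc) hne
      · exact ⟨hb.symm.trans hc, hd.symm.trans ha⟩
      · exact ⟨hb.symm.trans hc, hd.symm.trans ha⟩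
      · exact absurd (ha.symm.trans hc) hne
    rw [h3.1] at h2
    rw [h3.2] at h2'
    omega
  refine ⟨T, ed, hinj, fun e => ⟨hedA e, ?_⟩, fun a ha => ?_⟩
  · rw [hpar]; exact hed e
  · have := Fintype.ofFinite T.Edge
    have h1 := T.card_edge
    rw [Nat.card_eq_fintype_card] at h1
    have h2 : (Finset.univ.image ed) = A := by
      refine Finset.eq_of_subset_of_card_le ?_ ?_
      · intro b hb
        obtain ⟨e, -, rfl⟩ := Finset.mem_image.1 hb
        exact hedA e
      · rw [Finset.card_image_of_injective _ hinj, Finset.card_univ]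
        omega
    rw [← h2] at ha
    obtain ⟨e, -, h⟩ := Finset.mem_image.1 ha
    exact ⟨e, h⟩

end Counting

theorem RootedForest.card_root {V : Type} [Fintype V] [DecidableEq V] (F : RootedForest V) :
    Nat.card F.Root = (Finset.univ.filter fun v => F.parent v = v).card := by
  rw [← Fintype.card_subtype, ← Nat.card_eq_fintype_card]
  rfl

instance {V : Type} [Finite V] (F : RootedForest V) : Finite F.Root :=
  inferInstanceAs (Finite {v : V // F.parent v = v})

theorem RootedForest.rootOf_root {V : Type} (F : RootedForest V) (r : F.Root) :
    F.rootOf r.1 = r :=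
  Subtype.ext (F.rootOf_eq (k := 0) r.2)

theorem RootedForest.iff_rootOf {V : Type} (F : RootedForest V) {f : V → Prop}
    (hf : ∀ v, f (F.parent v) ↔ f v) (v : V) : f (F.rootOf v).1 ↔ f v := by
  obtain ⟨k, hk⟩ := F.reaches v
  rw [F.rootOf_eq hk]
  clear hk
  induction k with
  | zero => rfl
  | succ k ih => rw [Function.iterate_succ_apply', hf, ih]

/-! ### Nets: right trees joined to a tree by left edges -/

namespace LeftRightGraph

variable {V W : Type} [Fintype V] [DecidableEq V] [Fintype W] [DecidableEq W] {d : ℕ}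

/-- The trees of right edges are joined to a tree by the left edges. -/
structure IsNet (G : LeftRightGraph V) : Prop where
  connected : ∀ f : V → Prop, (∀ v, f (G.parent v) ↔ f v) →
    (∀ v b, G.left v = some b → (f b ↔ f v)) → ∀ a b, f a → f b
  card : (Finset.univ.filter fun v => (G.left v).isSome).card + 1 =
    (Finset.univ.filter fun v => G.parent v = v).card

@[simp]
theorem map_left (G : LeftRightGraph V) (e : V ≃ W) (w : W) :
    (G.map e).left w = (G.left (e.symm w)).map e := rfl

@[simp]
theorem map_parent (G : LeftRightGraph V) (e : V ≃ W) (w : W) :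
    (G.map e).parent w = e (G.parent (e.symm w)) := rfl

theorem turn_left (G : LeftRightGraph V) (v w : V) :
    (G.turn v).left w = if w = v then some (G.parent v) else G.left w :=
  Function.update_apply G.left v (some (G.parent v)) w

theorem turn_parent (G : LeftRightGraph V) (v w : V) :
    (G.turn v).parent w = if w = v then v else G.parent w :=
  Function.update_apply G.parent v v w

theorem IsNet.map {G : LeftRightGraph V} (hG : G.IsNet) (e : V ≃ W) : (G.map e).IsNet where
  connected f h1 h2 a b := by
    have := hG.connected (fun v => f (e v)) (fun v => by simpa using h1 (e v))
      (fun v b hv => h2 (e v) (e b) (by simp [hv])) (e.symm a) (e.symm b)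
    simpa using this
  card := by
    convert hG.card using 2
    · exact Finset.card_equiv e.symm fun v => by simp
    · exact Finset.card_equiv e.symm fun v => by
        simp only [Finset.mem_filter, Finset.mem_univ, true_and]
        simp [Equiv.eq_symm_apply]

/-- The edge from `v` to its parent only changes its type, so connectedness persists; one left edge
and one root are gained. -/
theorem IsNet.turn {G : LeftRightGraph V} (hG : G.IsNet) {v : V} (hv : G.left v = none)
    (hr : G.parent v ≠ v) : (G.turn v).IsNet where
  connected f h1 h2 := by
    have h3 : ∀ w, w ≠ v → (G.turn v).parent w = G.parent w := fun w hw =>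
      Function.update_of_ne hw _ _
    have h4 : ∀ w, w ≠ v → (G.turn v).left w = G.left w := fun w hw =>
      Function.update_of_ne hw _ _
    refine hG.connected f (fun w => ?_) fun w b hw => ?_
    · by_cases h : w = v
      · subst h; exact h2 w _ (Function.update_self w _ G.left)
      · rw [← h3 w h]; exact h1 w
    · have h : w ≠ v := by rintro rfl; rw [hv] at hw; cases hw
      exact h2 w b (by rw [h4 w h, hw])
  card := by
    have h1 : (Finset.univ.filter fun w => ((G.turn v).left w).isSome) =
        insert v (Finset.univ.filter fun w => (G.left w).isSome) := by
      ext w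
      by_cases h : w = v
      · subst h; simp [turn_left]
      · simp [turn_left, h]
    have h2 : (Finset.univ.filter fun w => (G.turn v).parent w = w) =
        insert v (Finset.univ.filter fun w => G.parent w = w) := by
      ext w
      by_cases h : w = v
      · subst h; simp [turn_parent]
      · simp [turn_parent, h]
    rw [h1, h2, Finset.card_insert_of_notMem (by simp [hv]),
      Finset.card_insert_of_notMem (by simp [hr]), hG.card]

/-- The new edge connects the two pieces. It also accounts for the count: each piece has one root
more than left edges, and their union needs exactly one further left edge. -/
theorem IsNet.join {G : LeftRightGraph V} (hG : G.IsNet) {v : V} (hv : G.left v = none)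
    {G' : LeftRightGraph W} (hG' : G'.IsNet) (b : W) : (G.join v G' b).IsNet where
  connected f h1 h2 := by
    have h3 := hG.connected (fun w => f (Sum.inl w)) (fun w => h1 (Sum.inl w)) fun w b hw =>
      h2 _ _ (by
        have : w ≠ v := by rintro rfl; rw [hv] at hw; cases hw
        simp [this, hw])
    have h4 := hG'.connected (fun w => f (Sum.inr w)) (fun w => h1 (Sum.inr w)) fun w b hw =>
      h2 _ _ (by simp [hw])
    have h5 : f (Sum.inr b) ↔ f (Sum.inl v) := h2 _ _ (by simp)
    rintro (x | x) (y | y) hx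
    · exact h3 x y hx
    · exact h4 b y (h5.2 (h3 x v hx))
    · exact h3 v y (h5.1 (h4 x b hx))
    · exact h4 x y hx
  card := by
    have h := hG.card
    have h' := hG'.card
    simp only [Finset.card_filter, Fintype.sum_sum_type, join_left_inl, join_left_inr,
      join_parent_inl, join_parent_inr, Sum.inl.injEq, Sum.inr.injEq, Option.isSome_map] at h h' ⊢
    have h1 : (∑ w, if (if w = v then some (Sum.inr b) else (G.left w).map Sum.inl :
        Option (V ⊕ W)).isSome = true then 1 else 0) =
        (∑ w, if (G.left w).isSome = true then 1 else 0) + 1 := by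
      rw [← Finset.sum_erase_add _ _ (Finset.mem_univ v),
        ← Finset.sum_erase_add Finset.univ (fun w => if (G.left w).isSome = true then 1 else 0)
        (Finset.mem_univ v)]
      simp only [hv, if_true, Option.isSome_some, Option.isSome_none, Bool.false_eq_true, if_false,
        add_zero]
      congr 1
      exact Finset.sum_congr rfl fun w hw => by simp [Finset.ne_of_mem_erase hw]
    omega

/-- A rooted tree, without left edges. -/
def ofTree (T : RootedTree V) : LeftRightGraph V where
  forest := ⟨T.parent, fun v => by
    obtain ⟨k, hk⟩ := T.reaches v
    exact ⟨k, by rw [hk, T.parent_root]⟩⟩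
  left _ := none

@[simp]
theorem ofTree_left (T : RootedTree V) (v : V) : (ofTree T).left v = none := rfl

@[simp]
theorem ofTree_parent (T : RootedTree V) (v : V) : (ofTree T).parent v = T.parent v := rfl

theorem isNet_ofTree (T : RootedTree V) : (ofTree T).IsNet where
  connected f h1 _ := by
    have h3 : ∀ v, f T.root ↔ f v := fun v => by
      obtain ⟨k, hk⟩ := T.reaches v
      rw [← hk]
      clear hk
      induction k with
      | zero => rfl
      | succ k ih => rw [Function.iterate_succ_apply', ← ih]; exact h1 _
    exact fun a b ha => (h3 b).1 ((h3 a).2 ha)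
  card := by
    have h : (Finset.univ.filter fun v => (ofTree T).parent v = v) = {T.root} := by
      ext v
      simp only [Finset.mem_filter, Finset.mem_univ, true_and, Finset.mem_singleton]
      exact ⟨T.root_of_parent_eq, fun h => by rw [h]; exact T.parent_root⟩
    rw [h]
    simp

end LeftRightGraph

/-! ## The graph of a network -/

namespace Network

variable {m : ℕ}

open Classical in
/-- The graph of right and left aerial edges of a network. -/
def toGraph (ρ : Network m) : LeftRightGraph (Fin m) where
  forest := ρ.forest
  left v := if h : ∃ b, ρ.SkelEdge v b then some h.choose else none

theorem toGraph_left_eq_some (ρ : Network m) {a b : Fin m} :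
    ρ.toGraph.left a = some b ↔ ρ.SkelEdge a b := by
  simp only [toGraph]
  split_ifs with h
  · rw [Option.some_inj]
    exact ⟨fun h2 => h2 ▸ h.choose_spec, fun h2 => h.choose_spec.unique h2⟩
  · simp only [false_iff]
    exact fun h2 => h ⟨b, h2⟩

theorem target_zero (ρ : Network m) (v : Fin m) :
    ρ.kontsevichGraph.target v 0 = (ρ.toGraph.left v).elim (Sum.inr 0) Sum.inl := by
  simp only [kontsevichGraph, toGraph, Matrix.cons_val_zero]
  split_ifs <;> rfl

theorem target_one (ρ : Network m) (v : Fin m) :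
    ρ.kontsevichGraph.target v 1 =
      if ρ.toGraph.parent v = v then Sum.inr 1 else Sum.inl (ρ.toGraph.parent v) := rfl

/-- A predicate invariant along right edges descends to the component trees, and invariance along
left edges then carries it through the skeleton to its root. Injectivity of the sources makes the
left edges as many as the skeleton edges, one fewer than the components. -/
theorem isNet_toGraph (ρ : Network m) : ρ.toGraph.IsNet where
  connected f h1 h2 := by
    have h3 := ρ.forest.iff_rootOf h1
    have h4 : ∀ e : ρ.skeleton.Edge, f (ρ.skeleton.parent e.1).1 ↔ f e.1.1 := fun e => by
      have h6 : f (ρ.skeleton.parent e.1).1 ↔ f (ρ.high e) := by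
        rw [← h3 (ρ.high e), ρ.rootOf_high]
      have h7 : f e.1.1 ↔ f (ρ.low e) := by rw [← h3 (ρ.low e), ρ.rootOf_low]
      rw [h6, h7]
      have h5 := h2 _ _ (ρ.toGraph_left_eq_some.2 ⟨e, rfl, rfl⟩)
      unfold source sink at h5
      split_ifs at h5
      · exact h5
      · exact h5.symm
    have h6 : ∀ r : ρ.forest.Root, f ρ.skeleton.root.1 ↔ f r.1 := fun r => by
      obtain ⟨k, hk⟩ := ρ.skeleton.reaches r
      rw [← hk]
      clear hk
      induction k with
      | zero => rfl
      | succ k ih =>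
        rw [Function.iterate_succ_apply', ← ih]
        by_cases h7 : ρ.skeleton.parent^[k] r = ρ.skeleton.root
        · rw [h7, ρ.skeleton.parent_root]
        · exact h4 ⟨_, h7⟩
    exact fun a b ha => (h3 b).1 ((h6 _).1 ((h6 _).2 ((h3 a).2 ha)))
  card := by
    have := Fintype.ofFinite ρ.skeleton.Edge
    have h1 : (Finset.univ.filter fun v => (ρ.toGraph.left v).isSome) =
        Finset.univ.image ρ.source := by
      ext v
      simp only [Finset.mem_filter, Finset.mem_univ, true_and, Finset.mem_image,
        Option.isSome_iff_exists, toGraph_left_eq_some]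
      exact ⟨fun ⟨b, e, h, _⟩ => ⟨e, h⟩, fun ⟨e, h⟩ => ⟨_, e, h, rfl⟩⟩
    rw [h1, Finset.card_image_of_injective _
      (show Function.Injective ρ.source from ρ.source_injective), Finset.card_univ]
    have h2 := ρ.skeleton.card_edge
    rw [Nat.card_eq_fintype_card] at h2
    exact h2.trans ρ.forest.card_root

/-- With `r` component trees there are `r - 1` left and `m - r` right aerial edges, that is `m - 1`
edges in a connected graph on `m` vertices. -/
theorem isKontsevichTree (ρ : Network m) : ρ.kontsevichGraph.IsKontsevichTree := by
  classical
  let A : Finset (Fin m × Fin 2) :=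
    Finset.univ.filter fun e => (ρ.kontsevichGraph.target e.1 e.2).isLeft
  -- At edges into terrestrial vertices the value `e.1` is a dummy; such edges are not in `A`.
  let t : Fin m × Fin 2 → Fin m := fun e =>
    Sum.elim id (fun _ => e.1) (ρ.kontsevichGraph.target e.1 e.2)
  have hA : ∀ e l, e ∈ A ∧ t e = l ↔ ρ.kontsevichGraph.target e.1 e.2 = Sum.inl l := by
    intro e l
    simp only [A, t, Finset.mem_filter, Finset.mem_univ, true_and]
    cases h : ρ.kontsevichGraph.target e.1 e.2 <;> simp
  have hcard : A.card + 1 = Nat.card (Fin m) := by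
    have h1 := ρ.isNet_toGraph.card
    have h2 : (Finset.univ.filter fun v => ρ.toGraph.parent v = v).card +
        (Finset.univ.filter fun v => ¬ρ.toGraph.parent v = v).card = m := by
      rw [Finset.card_filter_add_card_filter_not, Finset.card_univ, Fintype.card_fin]
    have h3 : A.card = (Finset.univ.filter fun v => (ρ.toGraph.left v).isSome).card +
        (Finset.univ.filter fun v => ¬ρ.toGraph.parent v = v).card := by
      simp only [A, Finset.card_filter, Fintype.sum_prod_type, Fin.sum_univ_two,
        Finset.sum_add_distrib]
      congr 1
      · refine Finset.sum_congr rfl fun v _ => ?_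
        rw [target_zero]
        cases ρ.toGraph.left v <;> simp
      · refine Finset.sum_congr rfl fun v _ => ?_
        rw [target_one]
        split_ifs <;> simp_all
    rw [Nat.card_eq_fintype_card, Fintype.card_fin]
    omega
  obtain ⟨h1, h2⟩ := isTree_fromRel_of_card A Prod.fst t (fun f hf => by
    refine ρ.isNet_toGraph.connected f (fun v => ?_) fun v b hv => ?_
    · by_cases h : ρ.toGraph.parent v = v
      · rw [h]
      · have h3 := (hA (v, 1) (ρ.toGraph.parent v)).2 (by rw [target_one, if_neg h])
        have := hf _ h3.1
        rwa [h3.2] at this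
    · have h3 := (hA (v, 0) b).2 (by rw [target_zero, hv]; rfl)
      have := hf _ h3.1
      rwa [h3.2] at this) hcard
  have h3 : ρ.kontsevichGraph.interior =
      SimpleGraph.fromRel fun x y => ∃ a ∈ A, a.1 = x ∧ t a = y := by
    unfold KontsevichGraph.interior
    congr 1
    funext x y
    refine propext ⟨fun ⟨s, hs⟩ => ⟨(x, s), ((hA (x, s) y).2 hs).1, rfl,
    ((hA (x, s) y).2 hs).2⟩, ?_⟩
    rintro ⟨⟨x, s⟩, ha, rfl, hy⟩
    exact ⟨s, (hA (x, s) y).1 ⟨ha, hy⟩⟩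
  refine ⟨h3 ▸ h1, fun k l hkl => ?_⟩
  have h4 : ∀ e : Fin m × Fin 2, ((e.1 = k ∧ ρ.kontsevichGraph.target e.1 e.2 = Sum.inl l) ∨
      (e.1 = l ∧ ρ.kontsevichGraph.target e.1 e.2 = Sum.inl k)) ↔
      e ∈ A ∧ s(e.1, t e) = s(k, l) := fun e => by
    rw [← hA, ← hA, Sym2.eq_iff]
    tauto
  simp only [h4]
  rw [h3, SimpleGraph.fromRel_adj] at hkl
  obtain ⟨-, ⟨a, ha, rfl, rfl⟩ | ⟨a, ha, rfl, rfl⟩⟩ := hkl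
  · exact ⟨a, ⟨ha, rfl⟩, fun b hb => h2 hb.1 ha hb.2⟩
  · exact ⟨a, ⟨ha, Sym2.eq_swap⟩, fun b hb => h2 hb.1 ha (hb.2.trans Sym2.eq_swap)⟩

/-- Contracting the right trees leaves a connected graph on the components with one edge fewer than
vertices, which can be rooted to give a skeleton. The root is an arbitrary choice, as `toGraph` does
not record it. -/
theorem exists_toGraph_eq (G : LeftRightGraph (Fin m)) (hG : G.IsNet) :
    ∃ ρ : Network m, ρ.toGraph = G := by
  classical
  let b : Fin m → Fin m := fun v => (G.left v).getD v
  have hb : ∀ v, (G.left v).isSome → G.left v = some (b v) := fun v hv => by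
    obtain ⟨w, hw⟩ := Option.isSome_iff_exists.1 hv
    simp [b, hw]
  obtain ⟨T, ed, hinj, hed, hsurj⟩ := exists_rootedTree_of_card
    (Finset.univ.filter fun v => (G.left v).isSome) G.forest.rootOf (fun v => G.forest.rootOf (b v))
    (fun f hf x y hx => by
      have := hG.connected (fun v => f (G.forest.rootOf v))
        (fun v => by rw [G.forest.rootOf_parent]) (fun v c hv => by
          have h1 := hf v (by simp [hv])
          have h2 : b v = c := by simp [b, hv]
          rwa [h2] at h1) x.1 y.1 (by rwa [G.forest.rootOf_root])
      rwa [G.forest.rootOf_root] at this)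
    (by rw [G.forest.card_root]; exact hG.card)
  simp only [Finset.mem_filter, Finset.mem_univ, true_and] at hed hsurj
  -- `ed e` is the source of the left edge that realizes `e`; the edge points inward when this
  -- source lies in the tree farther from the root.
  let inw : T.Edge → Bool := fun e => decide (G.forest.rootOf (ed e) = e.1)
  have hin : ∀ e, inw e = true → G.forest.rootOf (ed e) = e.1 ∧
      G.forest.rootOf (b (ed e)) = T.parent e.1 := fun e he => by
    have h1 : G.forest.rootOf (ed e) = e.1 := of_decide_eq_true he
    rcases (hed e).2 with h | h
    · exact h
    · exact absurd (T.root_of_parent_eq (h.2.symm.trans h1)) e.2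
  have hout : ∀ e, inw e = false → G.forest.rootOf (b (ed e)) = e.1 ∧
      G.forest.rootOf (ed e) = T.parent e.1 := fun e he => by
    have h1 : G.forest.rootOf (ed e) ≠ e.1 := of_decide_eq_false he
    rcases (hed e).2 with h | h
    · exact absurd h.1 h1
    · exact h
  let ρ : Network m :=
    { forest := G.forest
      skeleton := T
      inward := inw
      low := fun e => if inw e then ed e else b (ed e)
      high := fun e => if inw e then b (ed e) else ed e
      rootOf_low := fun e => by
        split_ifs with h
        · exact (hin e h).1
        · exact (hout e (by simpa using h)).1
      rootOf_high := fun e => by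
        split_ifs with h
        · exact (hin e h).2
        · exact (hout e (by simpa using h)).2
      source_injective := fun e e' h => hinj (by
        dsimp only at h
        split_ifs at h <;> exact h) }
  refine ⟨ρ, ?_⟩
  have h1 : ∀ v w, ρ.SkelEdge v w ↔ G.left v = some w := fun v w => by
    have h2 : ∀ e, ρ.source e = ed e := fun e => by
      simp only [source, ρ]; split_ifs <;> rfl
    have h3 : ∀ e, ρ.sink e = b (ed e) := fun e => by
      simp only [sink, ρ]; split_ifs <;> rfl
    constructor
    · rintro ⟨e, he, rfl⟩
      rw [h2] at he
      rw [h3, ← he]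
      exact hb _ (hed e).1
    · intro h
      obtain ⟨e, he⟩ := hsurj v (by simp [h])
      refine ⟨e, (h2 e).trans he, ?_⟩
      rw [h3, he]
      simp [b, h]
  have h4 : ρ.toGraph.left = G.left := funext fun v => Option.ext fun w => by
    rw [toGraph_left_eq_some, h1]
  have h5 : ρ.toGraph.forest = G.forest := rfl
  cases G
  cases h6 : ρ.toGraph
  simp_all

theorem incoming_inl (ρ : Network m) {d : ℕ} (I : Fin m × Fin 2 → Fin d) (v : Fin m) :
    ρ.kontsevichGraph.incoming I (Sum.inl v) =
      ρ.toGraph.incoming (fun w => (I (w, 0), I (w, 1))) v := by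
  have h : ∀ (p : Fin m × Fin 2 → Prop) [DecidablePred p], (Finset.univ.filter p).val.map I =
      ∑ e, if p e then {I e} else 0 := fun p _ => by
    rw [← Finset.sum_filter, Finset.sum,
    ← Multiset.sum_map_singleton ((Finset.filter p _).val.map I),
      Multiset.map_map]
    rfl
  rw [KontsevichGraph.incoming, h, Fintype.sum_prod_type]
  refine Finset.sum_congr rfl fun w _ => ?_
  rw [Fin.sum_univ_two]
  simp only [target_zero, target_one]
  congr 1
  · have h1 : ((ρ.toGraph.left w).elim (Sum.inr 0) Sum.inl : Fin m ⊕ Fin 2) = Sum.inl v ↔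
        ρ.toGraph.left w = some v := by
      cases ρ.toGraph.left w <;> simp
    simp only [h1]
  · have h1 : (if ρ.toGraph.parent w = w then Sum.inr 1 else Sum.inl (ρ.toGraph.parent w) :
        Fin m ⊕ Fin 2) = Sum.inl v ↔ w ≠ v ∧ ρ.toGraph.parent w = v := by
      split_ifs with h2
      · simp only [h2, false_iff]; exact fun h => h.1 h.2
      · rw [Sum.inl.injEq]
        exact ⟨fun h => ⟨fun h3 => h2 (h.trans h3.symm), h⟩, And.right⟩
    simp only [h1]

/-- Differentiating the exponentials gives a factor `p₁` for each free left leg and a factor `p₂`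
for each root, and the exponentials themselves cancel. From here on symbols are handled as
contractions `val`. -/
theorem symbol_eq_val (ρ : Network m) {d : ℕ} (π : (Fin d → ℝ) → Matrix (Fin d) (Fin d) ℝ)
    (p₁ p₂ x : Fin d → ℝ) :
    ρ.kontsevichGraph.symbol π ![p₁, p₂] x = ρ.toGraph.val π (fun _ => p₁) p₂ x := by
  unfold KontsevichGraph.symbol KontsevichGraph.operator LeftRightGraph.val
  rw [Finset.sum_div]
  let E : (Fin m × Fin 2 → Fin d) ≃ (Fin m → Fin d × Fin d) :=
    { toFun := fun I w => (I (w, 0), I (w, 1))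
      invFun := fun K e => if e.2 = 0 then (K e.1).1 else (K e.1).2
      left_inv := fun I => by
        funext ⟨v, s⟩
        fin_cases s <;> simp
      right_inv := fun K => by simp }
  refine Fintype.sum_equiv E _ _ fun I => ?_
  simp only [mixedPartial_exp, Fin.sum_univ_two, Fin.prod_univ_two, Matrix.cons_val_zero,
    Matrix.cons_val_one, add_dotProduct, Real.exp_add]
  have hprod : ∀ (p : Fin d → ℝ) (i : Fin 2),
      ((ρ.kontsevichGraph.incoming I (Sum.inr i)).map p).prod = ∏ v : Fin m, ∏ s : Fin 2,
        if ρ.kontsevichGraph.target v s = Sum.inr i then p (I (v, s)) else 1 := fun p i => by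
    rw [KontsevichGraph.incoming, Multiset.map_map, ← Fintype.prod_prod_type'
      (f := fun v s => if ρ.kontsevichGraph.target v s = Sum.inr i then p (I (v, s)) else 1),
      ← Finset.prod_filter]
    rfl
  have hterm : (∏ v, LeftRightGraph.vertexTerm π p₁ p₂ (ρ.toGraph.left v).isSome
      (decide (ρ.toGraph.parent v = v)) (ρ.toGraph.incoming (E I) v) (E I v) x) =
      (∏ v, mixedPartial (ρ.kontsevichGraph.incoming I (Sum.inl v))
        (fun y => π y (I (v, 0)) (I (v, 1))) x) *
      (((ρ.kontsevichGraph.incoming I (Sum.inr 0)).map p₁).prod *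
        ((ρ.kontsevichGraph.incoming I (Sum.inr 1)).map p₂).prod) := by
    rw [hprod, hprod, ← Finset.prod_mul_distrib, ← Finset.prod_mul_distrib]
    refine Finset.prod_congr rfl fun v _ => ?_
    rw [incoming_inl, Fin.prod_univ_two, Fin.prod_univ_two, target_zero, target_one,
      LeftRightGraph.vertexTerm]
    have h1 : (ρ.toGraph.incoming (E I) v) =
      ρ.toGraph.incoming (fun w => (I (w, 0), I (w, 1))) v := rfl
    have h2 : E I v = (I (v, 0), I (v, 1)) := rfl
    rw [h1, h2]
    by_cases h3 : ρ.toGraph.parent v = v <;> cases ρ.toGraph.left v <;> simp [h3, mul_assoc]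
  rw [hterm]
  have := (Real.exp_pos (p₁ ⬝ᵥ x)).ne'
  have := (Real.exp_pos (p₂ ⬝ᵥ x)).ne'
  field_simp

end Network

end TreeExpansion

end

noncomputable section

namespace TreeExpansion

/-! ## Universal combinations of symbols -/

/-- An open set with a smooth skew bivector field and two covectors. -/
structure Background where
  d : ℕ
  M : Set (Fin d → ℝ)
  π : (Fin d → ℝ) → Matrix (Fin d) (Fin d) ℝ
  q₁ : Fin d → ℝ
  q₂ : Fin d → ℝ
  isOpen : IsOpen M
  smooth : ∀ i j, ContDiffOn ℝ ∞ (fun x => π x i j) M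
  skew : ∀ x ∈ M, ∀ i j, π x i j = -π x j i

/-- Rescaling the second covector. -/
abbrev Background.scale (e : Background) (s : ℝ) : Background :=
  { e with q₂ := s • e.q₂ }

/-- Polynomials in the coefficients `c_τ`. -/
abbrev CoeffPoly : Type := MvPolynomial (Σ m, TopTree m) ℚ

/-- Polynomials in the coefficients `c_τ` with `|τ| ≤ m`. -/
abbrev CoeffPoly.upTo (m : ℕ) : Subalgebra ℚ CoeffPoly :=
  MvPolynomial.supported ℚ {τ : Σ m, TopTree m | τ.1 ≤ m}

theorem CoeffPoly.upTo_mono {m n : ℕ} (h : m ≤ n) : CoeffPoly.upTo m ≤ CoeffPoly.upTo n :=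
  MvPolynomial.supported_mono fun _ hτ => le_trans hτ h

theorem NRT.symbol_eq_val {m d : ℕ} (ρ : NRT m) (π : (Fin d → ℝ) → Matrix (Fin d) (Fin d) ℝ)
    (p₁ p₂ : Fin d → ℝ) :
    ρ.symbol π p₁ p₂ = (Quotient.out ρ).toGraph.val π (fun _ => p₁) p₂ := by
  funext x
  rw [← Network.symbol_eq_val]
  conv_lhs => rw [← Quotient.out_eq ρ]
  rfl

/-- The number of components of a network. -/
def NRT.componentCount {m : ℕ} (ρ : NRT m) : ℕ :=
  (Finset.univ.filter fun v => (Quotient.out ρ).toGraph.parent v = v).card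

theorem NRT.componentCount_pos {m : ℕ} (ρ : NRT m) : 0 < ρ.componentCount := by
  have := (Quotient.out ρ).isNet_toGraph.card
  unfold NRT.componentCount
  omega

theorem NRT.symbol_smul {m d : ℕ} (ρ : NRT m) (π : (Fin d → ℝ) → Matrix (Fin d) (Fin d) ℝ)
    (p₁ p₂ : Fin d → ℝ) (s : ℝ) (x : Fin d → ℝ) :
    ρ.symbol π p₁ (s • p₂) x = s ^ ρ.componentCount * ρ.symbol π p₁ p₂ x := by
  rw [NRT.symbol_eq_val, NRT.symbol_eq_val, LeftRightGraph.val_smul]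
  rfl

theorem NRT.symbol_contDiffOn {m : ℕ} (ρ : NRT m) (e : Background) :
    ContDiffOn ℝ ∞ (ρ.symbol e.π e.q₁ e.q₂) e.M := by
  rw [NRT.symbol_eq_val]
  exact LeftRightGraph.val_contDiffOn e.isOpen e.smooth _ _ _

/-- The combination of symbols with given coefficients. -/
def combination {m : ℕ} (w : NRT m → CoeffPoly) (c : (Σ m, TopTree m) → ℝ) (e : Background)
    (x : Fin e.d → ℝ) : ℝ :=
  ∑ ρ, MvPolynomial.aeval c (w ρ) * ρ.symbol e.π e.q₁ e.q₂ x

/-- `f` is a combination of the symbols of the networks with `m` vertices, whose coefficients are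
universal polynomials in the `c_τ` with `|τ| ≤ m`. -/
def IsCombination (m : ℕ)
    (f : ((Σ m, TopTree m) → ℝ) → (e : Background) → (Fin e.d → ℝ) → ℝ) : Prop :=
  ∃ w : NRT m → CoeffPoly, (∀ ρ, w ρ ∈ CoeffPoly.upTo m) ∧
    ∀ c e, Set.EqOn (f c e) (combination w c e) e.M

namespace IsCombination

variable {m : ℕ} {f g : ((Σ m, TopTree m) → ℝ) → (e : Background) → (Fin e.d → ℝ) → ℝ}

theorem congr (hf : IsCombination m f) (h : ∀ c e, ∀ x ∈ e.M, g c e x = f c e x) :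
    IsCombination m g := by
  obtain ⟨w, h1, h2⟩ := hf
  exact ⟨w, h1, fun c e x hx => (h c e x hx).trans (h2 c e hx)⟩

theorem add (hf : IsCombination m f) (hg : IsCombination m g) :
    IsCombination m fun c e x => f c e x + g c e x := by
  obtain ⟨w, h1, h2⟩ := hf
  obtain ⟨w', h1', h2'⟩ := hg
  refine ⟨fun ρ => w ρ + w' ρ, fun ρ => add_mem (h1 ρ) (h1' ρ), fun c e x hx => ?_⟩
  simp only [h2 c e hx, h2' c e hx, combination, map_add, add_mul, Finset.sum_add_distrib]

theorem mul (hf : IsCombination m f) {a : CoeffPoly} (ha : a ∈ CoeffPoly.upTo m) :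
    IsCombination m fun c e x => MvPolynomial.aeval c a * f c e x := by
  obtain ⟨w, h1, h2⟩ := hf
  refine ⟨fun ρ => a * w ρ, fun ρ => mul_mem ha (h1 ρ), fun c e x hx => ?_⟩
  simp only [h2 c e hx, combination, map_mul, Finset.mul_sum, mul_assoc]

theorem neg (hf : IsCombination m f) : IsCombination m fun c e x => -f c e x :=
  (hf.mul (a := -1) (neg_mem (one_mem _))).congr fun c e x _ => by simp

theorem zero : IsCombination m fun _ _ _ => 0 :=
  ⟨0, fun _ => zero_mem _, fun c e x _ => by simp [combination]⟩

theorem sum {ι : Type*} (t : Finset ι)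
    {f : ι → ((Σ m, TopTree m) → ℝ) → (e : Background) → (Fin e.d → ℝ) → ℝ}
    (hf : ∀ k ∈ t, IsCombination m (f k)) : IsCombination m fun c e x => ∑ k ∈ t, f k c e x := by
  classical
  induction t using Finset.induction_on with
  | empty => simpa using zero
  | insert a t ha ih =>
    simp only [Finset.sum_insert ha]
    exact (hf a (Finset.mem_insert_self a t)).add
      (ih fun k hk => hf k (Finset.mem_insert_of_mem hk))

end IsCombination

/-- After numbering the vertices, `G` is the graph of some network, and its value is the symbol of
that network alone, with coefficient `1`. -/
theorem isCombination_val {V : Type} [Fintype V] [DecidableEq V] {G : LeftRightGraph V}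
    (hG : G.IsNet) {m : ℕ} (hm : m = Fintype.card V) :
    IsCombination m fun _ e x => G.val e.π (fun _ => e.q₁) e.q₂ x := by
  classical
  subst hm
  let eq := Fintype.equivFin V
  obtain ⟨ρ, hρ⟩ := Network.exists_toGraph_eq (G.map eq) (hG.map eq)
  let r : NRT (Fintype.card V) := Quotient.mk _ ρ
  refine ⟨Pi.single r 1, fun ρ' => ?_, fun c e x _ => ?_⟩
  · rw [Pi.single_apply]
    split_ifs
    · exact one_mem _
    · exact zero_mem _
  · rw [combination, Finset.sum_eq_single r]
    · change G.val e.π (fun _ => e.q₁) e.q₂ x = _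
      rw [Pi.single_eq_same, map_one, one_mul, ← G.val_map eq, ← hρ, ← Network.symbol_eq_val]
      rfl
    · intro ρ' _ h
      rw [Pi.single_eq_of_ne h, map_zero, zero_mul]
    · simp

/-! ### Substituting derivatives of combinations into the free left legs -/

/-- The covectors that may be contracted with a left leg: `q₁ + q₂` in degree `0`, and the
differentials of combinations. -/
def IsLeg (n : ℕ)
    (η : ((Σ m, TopTree m) → ℝ) → (e : Background) → (Fin e.d → ℝ) → Fin e.d → ℝ) : Prop :=
  (n = 0 ∧ ∀ c e x, η c e x = e.q₁ + e.q₂) ∨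
    ∃ f, IsCombination n f ∧ ∀ c e, ∀ x ∈ e.M, ∀ i, η c e x i = pderiv i (f c e) x

theorem IsLeg.eq_sum {n : ℕ} {w : NRT n → CoeffPoly} {c : (Σ m, TopTree m) → ℝ} {e : Background}
    {f : (Fin e.d → ℝ) → ℝ} (hf : Set.EqOn f (combination w c e) e.M) {x : Fin e.d → ℝ}
    (hx : x ∈ e.M) (i : Fin e.d) :
    pderiv i f x = ∑ ρ, MvPolynomial.aeval c (w ρ) * pderiv i (ρ.symbol e.π e.q₁ e.q₂) x := by
  have hd : ∀ ρ : NRT n, DifferentiableAt ℝ (ρ.symbol e.π e.q₁ e.q₂) x := fun ρ =>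
    differentiableAt_of_contDiffOn e.isOpen (ρ.symbol_contDiffOn e) hx
  rw [pderiv_congr e.isOpen hf i hx]
  unfold pderiv combination
  rw [fderiv_fun_sum fun ρ _ => (hd ρ).const_mul _]
  simp only [_root_.sum_apply]
  refine Finset.sum_congr rfl fun ρ _ => ?_
  rw [fderiv_const_mul (hd ρ)]
  rfl

/-- Induction on the number of vertices in `O`, those whose covector may differ from `q₁`. A
covector `q₁ + q₂` splits: the first part needs no further work, the second is turned, or vanishes
at a root. The differential of a combination is expanded in symbols, and each of these networks is
joined to `G`. All these operations preserve nets and the total degree `m`, the number of vertices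
plus the degrees still waiting at `O`. -/
theorem isCombination_val_of_isLeg (k : ℕ) : ∀ (V : Type) [Fintype V] [DecidableEq V]
    (G : LeftRightGraph V), G.IsNet → ∀ O : Finset V, O.card = k → (∀ v ∈ O, G.left v = none) →
    ∀ (n : V → ℕ)
      (ζ : V → ((Σ m, TopTree m) → ℝ) → (e : Background) → (Fin e.d → ℝ) → Fin e.d → ℝ),
    (∀ v ∈ O, IsLeg (n v) (ζ v)) → (∀ v ∉ O, ∀ c e x, ζ v c e x = e.q₁) →
    ∀ m, m = Fintype.card V + ∑ v ∈ O, n v →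
    IsCombination m fun c e x => G.val e.π (fun v => ζ v c e x) e.q₂ x := by
  induction k with
  | zero =>
    intro V _ _ G hG O hO _ n ζ _ hζ m hm
    rw [Finset.card_eq_zero] at hO
    subst hO
    refine (isCombination_val hG (by simpa using hm)).congr fun c e x _ => ?_
    exact G.val_congr (fun v _ => hζ v (Finset.notMem_empty v) c e x) _ _
  | succ k ih =>
    intro V _ _ G hG O hO hleft n ζ hleg hζ m hm
    obtain ⟨v, hvO⟩ : O.Nonempty := Finset.card_pos.1 (by omega)
    have hv := hleft v hvO
    have hO' : (O.erase v).card = k := by rw [Finset.card_erase_of_mem hvO]; omega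
    rw [← Finset.add_sum_erase _ _ hvO] at hm
    have hne : ∀ u ∈ O.erase v, u ≠ v := fun u hu => Finset.ne_of_mem_erase hu
    -- The vertex `v` is now settled. In a turned or joined graph its left leg is occupied, so the
    -- covector `q₁` recorded there plays no role.
    let ζ' := Function.update ζ v fun _ e _ => e.q₁
    have hζ'leg : ∀ u ∈ O.erase v, IsLeg (n u) (ζ' u) := fun u hu => by
      simp only [ζ', Function.update_of_ne (hne u hu)]
      exact hleg u (Finset.mem_of_mem_erase hu)
    have hζ' : ∀ u ∉ O.erase v, ∀ c e x, ζ' u c e x = e.q₁ := fun u hu c e x => by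
      by_cases h : u = v
      · subst h; simp [ζ']
      · simp only [ζ', Function.update_of_ne h]
        exact hζ u (fun h2 => hu (Finset.mem_erase.2 ⟨h, h2⟩)) c e x
    have hupd : ∀ c (e : Background) (x : Fin e.d → ℝ), (fun u => ζ' u c e x) =
        Function.update (fun u => ζ u c e x) v e.q₁ := fun c e x => by
      funext u
      by_cases h : u = v
      · subst h; simp [ζ']
      · simp [ζ', Function.update_of_ne h]
    rcases hleg v hvO with ⟨hn, hη⟩ | ⟨f, ⟨w, hw, hf⟩, hη⟩
    · rw [hn, zero_add] at hm
      have h1 := ih V G hG (O.erase v) hO' (fun u hu => hleft u (Finset.mem_of_mem_erase hu)) n ζ'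
        hζ'leg hζ' m hm
      -- The part `q₂` of the covector at `v`.
      have h2 : IsCombination m fun c e x =>
          G.val e.π (Function.update (fun u => ζ u c e x) v e.q₂) e.q₂ x := by
        by_cases hr : G.parent v = v
        · exact IsCombination.zero.congr fun c e x hx => LeftRightGraph.val_eq_zero_of_root
            e.isOpen e.smooth e.skew G hv hr _ _ (by simp) hx
        · refine (ih V (G.turn v) (hG.turn hv hr) (O.erase v) hO' (fun u hu => ?_) n ζ'
            hζ'leg hζ' m hm).neg.congr fun c e x hx => ?_
          · rw [LeftRightGraph.turn_left, if_neg (hne u hu)]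
            exact hleft u (Finset.mem_of_mem_erase hu)
          · rw [LeftRightGraph.val_turn e.isOpen e.smooth e.skew G hv hr _ _ (by simp) hx, hupd]
            congr 1
            refine LeftRightGraph.val_congr _ (fun u hu => ?_) _ _
            have h : u ≠ v := by
              rintro rfl
              simp [LeftRightGraph.turn_left] at hu
            simp [h]
      refine (h1.add h2).congr fun c e x _ => ?_
      rw [hupd, ← G.val_update_add hv, ← hη c e x]
      exact congrArg (fun θ => G.val e.π θ e.q₂ x) (Function.update_eq_self v _).symm
    -- The `n v` vertices of each joined network replace the degree that was waiting at `v`.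
    · have h1 : IsCombination m fun c e x => ∑ ρ, MvPolynomial.aeval c (w ρ) *
          ∑ b, (G.join v (Quotient.out ρ).toGraph b).val e.π
            (fun u => (Sum.elim ζ' fun _ _ e _ => e.q₁ :
              V ⊕ Fin (n v) → ((Σ m, TopTree m) → ℝ) → (e : Background) →
                (Fin e.d → ℝ) → Fin e.d → ℝ) u c e x) e.q₂ x := by
        refine IsCombination.sum _ fun ρ _ => IsCombination.mul (IsCombination.sum _ fun b _ => ?_)
          (CoeffPoly.upTo_mono (by omega) (hw ρ))
        refine ih _ _ (hG.join hv (Network.isNet_toGraph _) b)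
          ((O.erase v).map ⟨Sum.inl, Sum.inl_injective⟩) (by rw [Finset.card_map, hO']) ?_
          (Sum.elim n fun _ => 0) _ ?_ ?_ m ?_
        · intro u hu
          obtain ⟨u, hu', rfl⟩ := Finset.mem_map.1 hu
          simp [hne u hu', hleft u (Finset.mem_of_mem_erase hu')]
        · intro u hu
          obtain ⟨u, hu', rfl⟩ := Finset.mem_map.1 hu
          exact hζ'leg u hu'
        · rintro (u | u) hu c e x
          · exact hζ' u (fun h => hu (Finset.mem_map_of_mem _ h)) c e x
          · rfl
        · rw [hm, Finset.sum_map]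
          simp only [Fintype.card_sum, Fintype.card_fin, Function.Embedding.coeFn_mk, Sum.elim_inl]
          omega
      refine h1.congr fun c e x hx => ?_
      have h2 : (fun u => ζ u c e x) = Function.update (fun u => ζ u c e x) v
          fun i => ∑ ρ, MvPolynomial.aeval c (w ρ) * pderiv i (ρ.symbol e.π e.q₁ e.q₂) x := by
        conv_lhs => rw [← Function.update_eq_self v fun u => ζ u c e x]
        congr 1
        funext i
        rw [hη c e x hx i, IsLeg.eq_sum (hf c e) hx]
      rw [h2, G.val_update_sum hv]
      refine Finset.sum_congr rfl fun ρ _ => ?_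
      rw [LeftRightGraph.val_join e.isOpen e.smooth G hv (Quotient.out ρ).toGraph _
        (fun _ => e.q₁) _ hx (by rw [Function.update_self, NRT.symbol_eq_val])]
      congr 1
      refine Finset.sum_congr rfl fun b _ => LeftRightGraph.val_congr _ ?_ _ _
      rintro (u | u) hu
      · have h : u ≠ v := by
          rintro rfl
          simp at hu
        simp [ζ', h]
      · rfl

/-! ### Elementary differentials -/

namespace RootedTree

variable {V : Type} [Fintype V] [DecidableEq V] {d : ℕ} {M : Set (Fin d → ℝ)}
  {π : (Fin d → ℝ) → Matrix (Fin d) (Fin d) ℝ}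

theorem incoming_ofTree (T : RootedTree V) (K : V → Fin d × Fin d) (v : V) :
    (LeftRightGraph.ofTree T).incoming K v =
      (Finset.univ.filter fun w => w ≠ T.root ∧ T.parent w = v).val.map fun w => (K w).2 := by
  have h : ∀ w, (w ≠ v ∧ T.parent w = v) ↔ (w ≠ T.root ∧ T.parent w = v) := fun w => by
    constructor
    · rintro ⟨h1, h2⟩
      refine ⟨?_, h2⟩
      rintro rfl
      exact h1 (T.parent_root.symm.trans h2)
    · rintro ⟨h1, h2⟩
      refine ⟨?_, h2⟩
      rintro rfl
      exact h1 (T.root_of_parent_eq h2)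
  rw [← Multiset.sum_map_singleton ((Finset.filter _ _).val.map _), Multiset.map_map]
  change _ = ∑ w ∈ Finset.filter _ _, ({(K w).2} : Multiset (Fin d))
  rw [Finset.sum_filter, LeftRightGraph.incoming]
  simp only [LeftRightGraph.ofTree_left, LeftRightGraph.ofTree_parent, reduceCtorEq, if_false,
    zero_add, h]

/-- In the vector field the first index of `π` is the free one and the second is contracted with the
covector, whereas in the graph the right index goes to the parent. Interchanging the indices costs
one sign per vertex. -/
theorem sum_mul_elemDiff (hM : IsOpen M) (hπ : ∀ i j, ContDiffOn ℝ ∞ (fun x => π x i j) M)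
    (hs : ∀ x ∈ M, ∀ i j, π x i j = -π x j i) (T : RootedTree V) (P q : Fin d → ℝ)
    {x : Fin d → ℝ} (hx : x ∈ M) :
    ∑ u, q u * T.elemDiff u (sprayField π P) x =
      (-1) ^ Fintype.card V * (LeftRightGraph.ofTree T).val π (fun _ => P) q x := by
  have h1 : ∑ u, q u * T.elemDiff u (sprayField π P) x = ∑ I : V → Fin d, q (I T.root) *
      ∏ v : V, mixedPartial ((Finset.univ.filter fun w => w ≠ T.root ∧ T.parent w = v).val.map I)
        (fun y => sprayField π P y (I v)) x := by
    unfold elemDiff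
    simp only [Finset.mul_sum]
    rw [Finset.sum_comm]
    refine Finset.sum_congr rfl fun I _ => ?_
    rw [Finset.sum_eq_single (I T.root)]
    · rw [if_pos rfl]
    · intro u _ hu
      rw [if_neg hu.symm, mul_zero]
    · simp
  have h2 : ∀ (s : Multiset (Fin d)) (i : Fin d), mixedPartial s (fun y => sprayField π P y i) x =
      ∑ k, (-1) * (mixedPartial s (fun y => π y k i) x * P k) := fun s i => by
    have h3 := mixedPartial_sum hM Finset.univ P (fun k => hπ i k) s hx
    have h4 : (fun y => sprayField π P y i) = fun y => ∑ k, P k * π y i k := by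
      funext y
      simp only [sprayField, Matrix.mulVec, dotProduct, mul_comm]
    rw [h4, h3]
    refine Finset.sum_congr rfl fun k _ => ?_
    rw [LeftRightGraph.mixedPartial_skew hM hπ hs s i k hx]
    ring
  rw [h1, LeftRightGraph.val, ← (Equiv.arrowProdEquivProdArrow V (fun _ => Fin d)
    (fun _ => Fin d)).symm.sum_comp, Fintype.sum_prod_type_right, Finset.mul_sum]
  refine Finset.sum_congr rfl fun I _ => ?_
  simp only [h2]
  rw [Finset.prod_univ_sum, Fintype.piFinset_univ, Finset.mul_sum, Finset.mul_sum]
  refine Finset.sum_congr rfl fun J _ => ?_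
  rw [Finset.prod_mul_distrib, Finset.prod_const, Finset.card_univ, mul_left_comm]
  congr 1
  have h5 : ∀ v, LeftRightGraph.vertexTerm π P q ((LeftRightGraph.ofTree T).left v).isSome
      (decide ((LeftRightGraph.ofTree T).parent v = v))
      ((LeftRightGraph.ofTree T).incoming (fun v => (J v, I v)) v) (J v, I v) x =
      (mixedPartial ((Finset.univ.filter fun w => w ≠ T.root ∧ T.parent w = v).val.map I)
        (fun y => π y (J v) (I v)) x * P (J v)) * if v = T.root then q (I v) else 1 := fun v => by
    have h6 : T.parent v = v ↔ v = T.root :=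
      ⟨T.root_of_parent_eq, fun h => by rw [h, T.parent_root]⟩
    rw [incoming_ofTree, LeftRightGraph.vertexTerm]
    simp [h6]
  refine Eq.trans ?_ (Finset.prod_congr rfl fun v _ => (h5 v).symm)
  symm
  rw [Finset.prod_mul_distrib, Finset.prod_ite_eq' Finset.univ T.root, if_pos (Finset.mem_univ _),
    mul_comm]

end RootedTree

theorem TopTree.elemDiff_out {n d : ℕ} (τ : TopTree n) :
    (τ.elemDiff : Fin d → _) = (Quotient.out τ).elemDiff := by
  conv_lhs => rw [← Quotient.out_eq τ]
  rfl

/-! ### The recursion -/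

/-- The covectors `q₁ + q₂` and `dW_n`, for the combinations `W_n` with coefficients `w`. -/
def leg (w : ∀ n, NRT n → CoeffPoly) (n : ℕ) (c : (Σ m, TopTree m) → ℝ) (e : Background)
    (x : Fin e.d → ℝ) : Fin e.d → ℝ :=
  if n = 0 then e.q₁ + e.q₂ else fun i => pderiv i (combination (w n) c e) x

/-- The part of degree `m` of the Butcher series, contracted with `q₂`, at the sum of the
covectors `Q n`. -/
def butcherPart (m : ℕ) (c : (Σ m, TopTree m) → ℝ) {d : ℕ}
    (π : (Fin d → ℝ) → Matrix (Fin d) (Fin d) ℝ) (Q : ℕ → Fin d → ℝ) (q x : Fin d → ℝ) : ℝ :=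
  ∑ r ∈ Finset.range (m + 1), ∑ τ : TopTree r,
    ∑ n ∈ (Fintype.piFinset fun _ : Fin r => Finset.range (m + 1)).filter
      (fun n => r + ∑ v, n v = m),
      ((-1) ^ r / (τ.symmetry : ℝ) * c ⟨r, τ⟩) *
        (LeftRightGraph.ofTree (Quotient.out τ)).val π (fun v => Q (n v)) q x

theorem TopTree.pos {r : ℕ} (τ : TopTree r) : 0 < r :=
  Fin.pos_iff_nonempty.2 ⟨(Quotient.out τ).root⟩

/-- There is no tree without vertices, so at least one unit of degree is used up by `τ`. This is
what makes the degree `m` equation a recursion. -/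
theorem lt_of_mem_butcherPart {m r : ℕ} (τ : TopTree r) {n : Fin r → ℕ}
    (hn : r + ∑ v, n v = m) (v : Fin r) : n v < m := by
  have h1 := Finset.single_le_sum (fun v _ => Nat.zero_le (n v)) (Finset.mem_univ v)
  have h2 := τ.pos
  omega

theorem butcherPart_congr {m : ℕ} (c : (Σ m, TopTree m) → ℝ) {d : ℕ}
    (π : (Fin d → ℝ) → Matrix (Fin d) (Fin d) ℝ) {Q Q' : ℕ → Fin d → ℝ}
    (h : ∀ n < m, Q n = Q' n) (q x : Fin d → ℝ) :
    butcherPart m c π Q q x = butcherPart m c π Q' q x := by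
  refine Finset.sum_congr rfl fun r _ => Finset.sum_congr rfl fun τ _ =>
    Finset.sum_congr rfl fun n hn => ?_
  have h1 : (fun v => Q (n v)) = fun v => Q' (n v) :=
    funext fun v => h _ (lt_of_mem_butcherPart τ (Finset.mem_filter.1 hn).2 v)
  rw [h1]

theorem isCombination_butcherPart {m : ℕ} {w : ∀ n, NRT n → CoeffPoly}
    (hw : ∀ n < m, ∀ ρ, w n ρ ∈ CoeffPoly.upTo n) :
    IsCombination m fun c e x => butcherPart m c e.π (fun n => leg w n c e x) e.q₂ x := by
  refine IsCombination.sum _ fun r hr => IsCombination.sum _ fun τ _ =>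
    IsCombination.sum _ fun n hn => ?_
  have hr : r ≤ m := Nat.lt_succ_iff.1 (Finset.mem_range.1 hr)
  have hn := (Finset.mem_filter.1 hn).2
  have hleg : ∀ v, IsLeg (n v) (leg w (n v)) := fun v => by
    by_cases h : n v = 0
    · exact Or.inl ⟨h, fun c e x => by rw [leg, if_pos h]⟩
    · exact Or.inr ⟨combination (w (n v)),
        ⟨w (n v), hw _ (lt_of_mem_butcherPart τ hn v), fun _ _ _ _ => rfl⟩,
        fun c e x _ i => by rw [leg, if_neg h]⟩
  have h1 := isCombination_val_of_isLeg r (Fin r) (LeftRightGraph.ofTree (Quotient.out τ))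
    (LeftRightGraph.isNet_ofTree _) Finset.univ (by simp) (fun _ _ => rfl) n
    (fun v => leg w (n v)) (fun v _ => hleg v) (fun v hv => absurd (Finset.mem_univ v) hv) m
    (by rw [Fintype.card_fin, hn])
  have h2 : MvPolynomial.C ((-1) ^ r / (τ.symmetry : ℚ)) * MvPolynomial.X ⟨r, τ⟩ ∈
      CoeffPoly.upTo m :=
    mul_mem (Subalgebra.algebraMap_mem (CoeffPoly.upTo m) ((-1) ^ r / (τ.symmetry : ℚ)))
      (MvPolynomial.X_mem_supported.2 hr)
  exact (h1.mul h2).congr fun c e x _ => by simp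

open Classical in
/-- The coefficients of degree `m` determined by those of lower degree. -/
def nextCoeff (m : ℕ) (w : ∀ n, NRT n → CoeffPoly) (ρ : NRT m) : CoeffPoly :=
  -- A universal representation as a combination is selected by choice. The factor in front cancels
  -- the one that `∂_s` produces at `s = 1`. For the coefficients used below the condition always
  -- holds.
  if h : IsCombination m fun c e x => butcherPart m c e.π (fun n => leg w n c e x) e.q₂ x then
    MvPolynomial.C (1 / (ρ.componentCount : ℚ)) * h.choose ρ
  else 0

/-- The coefficients of degree less than `m`, extended by `0`. -/
def truncatedCoeff : ℕ → ∀ n, NRT n → CoeffPoly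
  | 0 => fun _ _ => 0
  | m + 1 => Function.update (truncatedCoeff m) m (nextCoeff m (truncatedCoeff m))

/-- The universal coefficients `w̃_ρ`, as polynomials in the `c_τ`. -/
def treeCoeff (m : ℕ) : NRT m → CoeffPoly := nextCoeff m (truncatedCoeff m)

theorem truncatedCoeff_of_lt {m n : ℕ} (h : n < m) : truncatedCoeff m n = treeCoeff n := by
  induction m with
  | zero => omega
  | succ m ih =>
    rw [truncatedCoeff]
    rcases Nat.lt_succ_iff_lt_or_eq.1 h with h | rfl
    · rw [Function.update_of_ne h.ne, ih h]
    · rw [Function.update_self]; rfl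

theorem treeCoeff_mem (m : ℕ) (ρ : NRT m) : treeCoeff m ρ ∈ CoeffPoly.upTo m := by
  rw [treeCoeff, nextCoeff]
  split_ifs with h
  · exact mul_mem (Subalgebra.algebraMap_mem (CoeffPoly.upTo m) _) (h.choose_spec.1 ρ)
  · exact zero_mem _

/-- This is the Hamilton-Jacobi equation in degree `m` at `s = 1`, with `∂_s` evaluated by
homogeneity. It holds by the choice of `nextCoeff`, because only degrees below `m`, where truncated
and full coefficients agree, enter on the right. -/
theorem sum_componentCount_mul (m : ℕ) (c : (Σ m, TopTree m) → ℝ) (e : Background)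
    {x : Fin e.d → ℝ} (hx : x ∈ e.M) :
    ∑ ρ : NRT m, (ρ.componentCount : ℝ) * MvPolynomial.aeval c (treeCoeff m ρ) *
      ρ.symbol e.π e.q₁ e.q₂ x =
    butcherPart m c e.π (fun n => leg treeCoeff n c e x) e.q₂ x := by
  have h1 : IsCombination m fun c e x =>
      butcherPart m c e.π (fun n => leg (truncatedCoeff m) n c e x) e.q₂ x :=
    isCombination_butcherPart fun n hn ρ => by
      rw [truncatedCoeff_of_lt hn]; exact treeCoeff_mem n ρ
  have h2 : ∀ ρ, treeCoeff m ρ = MvPolynomial.C (1 / (ρ.componentCount : ℚ)) * h1.choose ρ :=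
    fun ρ => by rw [treeCoeff, nextCoeff, dif_pos h1]
  have h3 : butcherPart m c e.π (fun n => leg treeCoeff n c e x) e.q₂ x =
      butcherPart m c e.π (fun n => leg (truncatedCoeff m) n c e x) e.q₂ x :=
    butcherPart_congr c e.π (fun n hn => by rw [leg, leg, truncatedCoeff_of_lt hn]) _ _
  have h5 : butcherPart m c e.π (fun n => leg (truncatedCoeff m) n c e x) e.q₂ x =
      combination h1.choose c e x := h1.choose_spec.2 c e hx
  rw [h3, h5, combination]
  refine Finset.sum_congr rfl fun ρ _ => ?_
  have h4 : (ρ.componentCount : ℝ) ≠ 0 := Nat.cast_ne_zero.2 ρ.componentCount_pos.ne'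
  rw [h2]
  rw [map_mul, MvPolynomial.aeval_C, map_div₀, map_one, map_natCast, ← mul_assoc,
    mul_one_div_cancel h4, one_mul]

end TreeExpansion

end

noncomputable section

namespace TreeExpansion

/-! ## The formal Hamilton-Jacobi equation -/

theorem LeftRightGraph.val_ofTree_smul {V : Type} [Fintype V] [DecidableEq V] {d : ℕ}
    {π : (Fin d → ℝ) → Matrix (Fin d) (Fin d) ℝ} (T : RootedTree V) (θ : V → Fin d → ℝ) (s : ℝ)
    (q x : Fin d → ℝ) :
    (LeftRightGraph.ofTree T).val π θ (s • q) x = s * (LeftRightGraph.ofTree T).val π θ q x := by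
  have h := (LeftRightGraph.isNet_ofTree T).card
  simp only [LeftRightGraph.ofTree_left, Option.isSome_none, Bool.false_eq_true,
    Finset.filter_false, Finset.card_empty, zero_add] at h
  rw [LeftRightGraph.val_smul, ← h, pow_one]

theorem butcherPart_smul (m : ℕ) (c : (Σ m, TopTree m) → ℝ) {d : ℕ}
    (π : (Fin d → ℝ) → Matrix (Fin d) (Fin d) ℝ) (Q : ℕ → Fin d → ℝ) (s : ℝ) (q x : Fin d → ℝ) :
    butcherPart m c π Q (s • q) x = s * butcherPart m c π Q q x := by
  simp only [butcherPart, LeftRightGraph.val_ofTree_smul, Finset.mul_sum]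
  refine Finset.sum_congr rfl fun r _ => Finset.sum_congr rfl fun τ _ =>
    Finset.sum_congr rfl fun n _ => by ring

theorem pderiv_combination_scale {m : ℕ} (w : NRT m → CoeffPoly) (c : (Σ m, TopTree m) → ℝ)
    (e : Background) (s : ℝ) {x : Fin e.d → ℝ} (hx : x ∈ e.M) (i : Fin e.d) :
    pderiv i (combination w c (e.scale s)) x = ∑ ρ, MvPolynomial.aeval c (w ρ) *
      (s ^ ρ.componentCount * pderiv i (ρ.symbol e.π e.q₁ e.q₂) x) := by
  refine (IsLeg.eq_sum (e := e.scale s) (fun _ _ => rfl) hx i).trans ?_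
  refine Finset.sum_congr rfl fun ρ _ => ?_
  congr 1
  have h : ρ.symbol e.π e.q₁ (s • e.q₂) = fun x => s ^ ρ.componentCount *
      ρ.symbol e.π e.q₁ e.q₂ x := funext fun x => ρ.symbol_smul e.π e.q₁ e.q₂ s x
  change pderiv i (ρ.symbol e.π e.q₁ (s • e.q₂)) x = _
  rw [h]
  unfold pderiv
  rw [fderiv_const_mul (differentiableAt_of_contDiffOn e.isOpen (ρ.symbol_contDiffOn e) hx)]
  rfl

/-- The derivative with respect to `s` of `W_m(q₁, s q₂, x)`. -/
def combinationDeriv (m : ℕ) (c : (Σ m, TopTree m) → ℝ) (e : Background) (s : ℝ)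
    (x : Fin e.d → ℝ) : ℝ :=
  ∑ ρ : NRT m, MvPolynomial.aeval c (treeCoeff m ρ) *
    ((ρ.componentCount * s ^ (ρ.componentCount - 1)) * ρ.symbol e.π e.q₁ e.q₂ x)

/-- For `s ≠ 0` apply the previous identity to `s q₂` and cancel one factor `s`. Both sides are
continuous in `s`, which covers `s = 0`, where the characteristics start. -/
theorem combinationDeriv_eq (m : ℕ) (c : (Σ m, TopTree m) → ℝ) (e : Background) (s : ℝ)
    {x : Fin e.d → ℝ} (hx : x ∈ e.M) :
    combinationDeriv m c e s x =
      butcherPart m c e.π (fun n => leg treeCoeff n c (e.scale s) x) e.q₂ x := by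
  have hleg : ∀ (n : ℕ) (i : Fin e.d), Continuous fun s => leg treeCoeff n c (e.scale s) x i :=
      fun n i => by
    by_cases hn : n = 0
    · simp only [leg, hn, if_true, Background.scale, Pi.add_apply, Pi.smul_apply, smul_eq_mul]
      fun_prop
    · simp only [leg, hn, if_false]
      simp only [pderiv_combination_scale _ c e _ hx]
      fun_prop
  have h : (fun s => combinationDeriv m c e s x) =
      fun s => butcherPart m c e.π (fun n => leg treeCoeff n c (e.scale s) x) e.q₂ x := by
    refine Continuous.ext_on (dense_compl_singleton (0 : ℝ)) ?_ ?_ fun s hs => ?_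
    · unfold combinationDeriv
      fun_prop
    · unfold butcherPart LeftRightGraph.val LeftRightGraph.vertexTerm
      refine continuous_finsetSum _ fun r _ => continuous_finsetSum _ fun τ _ =>
        continuous_finsetSum _ fun n _ => continuous_const.mul <|
        continuous_finsetSum _ fun K _ => continuous_finsetProd _ fun v _ => ?_
      refine (continuous_const.mul ?_).mul continuous_const
      split_ifs
      · exact continuous_const
      · exact hleg _ _
    · have h1 := sum_componentCount_mul m c (e.scale s) hx
      have h2 : butcherPart m c (e.scale s).π (fun n => leg treeCoeff n c (e.scale s) x)
          (e.scale s).q₂ x =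
          s * butcherPart m c e.π (fun n => leg treeCoeff n c (e.scale s) x) e.q₂ x :=
        butcherPart_smul _ _ _ _ _ _ _
      rw [h2] at h1
      refine mul_left_cancel₀ (hs : s ≠ 0) (Eq.trans ?_ h1)
      rw [combinationDeriv, Finset.mul_sum]
      refine Finset.sum_congr rfl fun ρ _ => ?_
      have h3 : ρ.symbol (e.scale s).π (e.scale s).q₁ (e.scale s).q₂ x =
          s ^ ρ.componentCount * ρ.symbol e.π e.q₁ e.q₂ x := ρ.symbol_smul _ _ _ _ _
      rw [h3]
      obtain ⟨k, hk⟩ := Nat.exists_eq_succ_of_ne_zero ρ.componentCount_pos.ne'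
      rw [hk, Nat.succ_eq_add_one, Nat.add_sub_cancel, pow_succ s k]
      ring
  exact congrFun h s

theorem isBigO_pow_mul {N k : ℕ} (h : N ≤ k) (a : ℝ) :
    (fun t : ℝ => t ^ k * a) =O[nhds 0] fun t => t ^ N := by
  obtain ⟨j, rfl⟩ := Nat.exists_eq_add_of_le h
  have h1 : (fun t : ℝ => t ^ j * a) =O[nhds 0] fun _ => (1 : ℝ) :=
    ((continuous_pow j).mul continuous_const).continuousAt.isBigO_one ℝ
  simpa [pow_add, mul_assoc] using (Asymptotics.isBigO_refl (fun t : ℝ => t ^ N) _).mul h1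

/-- Index ranges that do not depend on `m` allow the sum over `m` to be moved inside. -/
theorem butcherPart_eq_of_le {m N : ℕ} (h : m ≤ N) (c : (Σ m, TopTree m) → ℝ) {d : ℕ}
    (π : (Fin d → ℝ) → Matrix (Fin d) (Fin d) ℝ) (Q : ℕ → Fin d → ℝ) (q x : Fin d → ℝ) :
    butcherPart m c π Q q x = ∑ r ∈ Finset.range (N + 1), ∑ τ : TopTree r,
    ∑ n ∈ Fintype.piFinset fun _ : Fin r => Finset.range (N + 1), if r + ∑ v, n v = m then
      ((-1) ^ r / (τ.symmetry : ℝ) * c ⟨r, τ⟩) *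
        (LeftRightGraph.ofTree (Quotient.out τ)).val π (fun v => Q (n v)) q x else 0 := by
  unfold butcherPart
  refine Eq.trans ?_ (Finset.sum_subset (Finset.range_mono (Nat.succ_le_succ h)) ?_)
  · refine Finset.sum_congr rfl fun r _ => Finset.sum_congr rfl fun τ _ => ?_
    rw [← Finset.sum_filter]
    refine Finset.sum_congr ?_ fun _ _ => rfl
    ext n
    simp only [Finset.mem_filter, Fintype.mem_piFinset, Finset.mem_range]
    refine ⟨fun ⟨h1, h2⟩ => ⟨fun v => (h1 v).trans_le (by omega), h2⟩,
      fun ⟨h1, h2⟩ => ⟨fun v => ?_, h2⟩⟩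
    have := lt_of_mem_butcherPart τ h2 v
    omega
  · intro r _ hr
    refine Finset.sum_eq_zero fun τ _ => Finset.sum_eq_zero fun n _ => if_neg ?_
    rw [Finset.mem_range] at hr
    omega

/-- Expansion of the truncated Butcher series at a polynomial family of covectors. -/
theorem butcher_expansion (N : ℕ) (c : (Σ m, TopTree m) → ℝ) (e : Background)
    (Q : ℕ → Fin e.d → ℝ) {x : Fin e.d → ℝ} (hx : x ∈ e.M) :
    (fun t : ℝ => ∑ r ∈ Finset.range (N + 1), t ^ r * ∑ τ : TopTree r,
        c ⟨r, τ⟩ / (τ.symmetry : ℝ) * ∑ u, e.q₂ u * τ.elemDiff u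
          (sprayField e.π fun i => ∑ n ∈ Finset.range (N + 1), t ^ n * Q n i) x -
        ∑ m ∈ Finset.range (N + 1), t ^ m * butcherPart m c e.π Q e.q₂ x)
      =O[nhds 0] fun t => t ^ (N + 1) := by
  let a : ∀ r, TopTree r → (Fin r → ℕ) → ℝ := fun r τ n =>
    ((-1) ^ r / (τ.symmetry : ℝ) * c ⟨r, τ⟩) *
      (LeftRightGraph.ofTree (Quotient.out τ)).val e.π (fun v => Q (n v)) e.q₂ x
  have h1 : ∀ (t : ℝ) (r : ℕ) (τ : TopTree r), c ⟨r, τ⟩ / (τ.symmetry : ℝ) *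
      ∑ u, e.q₂ u * τ.elemDiff u
        (sprayField e.π fun i => ∑ n ∈ Finset.range (N + 1), t ^ n * Q n i) x =
      ∑ n ∈ Fintype.piFinset fun _ : Fin r => Finset.range (N + 1), t ^ (∑ v, n v) * a r τ n :=
    fun t r τ => by
      rw [TopTree.elemDiff_out, RootedTree.sum_mul_elemDiff e.isOpen e.smooth e.skew _ _ _ hx,
        LeftRightGraph.val_sum_of_left_eq_none _ (fun _ => rfl), Fintype.card_fin, Finset.mul_sum,
        Finset.mul_sum]
      refine Finset.sum_congr rfl fun n _ => ?_
      rw [Finset.prod_pow_eq_pow_sum]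
      simp only [a]
      ring
  have h2 : ∀ t : ℝ, ∑ m ∈ Finset.range (N + 1), t ^ m * butcherPart m c e.π Q e.q₂ x =
      ∑ r ∈ Finset.range (N + 1), ∑ τ : TopTree r,
      ∑ n ∈ Fintype.piFinset fun _ : Fin r => Finset.range (N + 1),
        if r + ∑ v, n v < N + 1 then t ^ (r + ∑ v, n v) * a r τ n else 0 := fun t => by
    have h3 : ∀ m ∈ Finset.range (N + 1), t ^ m * butcherPart m c e.π Q e.q₂ x =
        ∑ r ∈ Finset.range (N + 1), ∑ τ : TopTree r,
        ∑ n ∈ Fintype.piFinset fun _ : Fin r => Finset.range (N + 1),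
          if r + ∑ v, n v = m then t ^ m * a r τ n else 0 := fun m hm => by
      rw [butcherPart_eq_of_le (Nat.lt_succ_iff.1 (Finset.mem_range.1 hm))]
      simp only [Finset.mul_sum, mul_ite, mul_zero, a]
    rw [Finset.sum_congr rfl h3, Finset.sum_comm]
    refine Finset.sum_congr rfl fun r _ => ?_
    rw [Finset.sum_comm]
    refine Finset.sum_congr rfl fun τ _ => ?_
    rw [Finset.sum_comm]
    refine Finset.sum_congr rfl fun n _ => ?_
    rw [Finset.sum_ite_eq]
    simp only [Finset.mem_range]
  simp only [h1, h2, Finset.mul_sum, ← Finset.sum_sub_distrib]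
  refine Asymptotics.IsBigO.fun_sum fun r _ => Asymptotics.IsBigO.fun_sum fun τ _ =>
    Asymptotics.IsBigO.fun_sum fun n _ => ?_
  -- Terms of total degree at most `N` cancel against the parts `butcherPart`; the others are `O(t ^
  -- (N + 1))`.
  by_cases h : r + ∑ v, n v < N + 1
  · simp only [h, if_true, pow_add, mul_assoc, sub_self]
    exact Asymptotics.isBigO_zero _ _
  · simp only [h, if_false, sub_zero, ← mul_assoc, ← pow_add]
    exact isBigO_pow_mul (not_lt.1 h) _

end TreeExpansion

end

noncomputable section

namespace TreeExpansion

/-! ## Taylor expansions depending on parameters -/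

section Slab

open Set Filter Topology

variable {Y : Type*} [NormedAddCommGroup Y] [NormedSpace ℝ Y] {O : Set (Y × ℝ)} {F : Y × ℝ → ℝ}

/-- The points `(y, t)` of `O` with `0 ≤ t ≤ 1`. -/
def slab (O : Set (Y × ℝ)) : Set (Y × ℝ) := O ∩ univ ×ˢ Icc (0 : ℝ) 1

theorem uniqueDiffOn_slab (hO : IsOpen O) : UniqueDiffOn ℝ (slab O) := by
  rw [slab, inter_comm]
  exact (uniqueDiffOn_univ.prod (uniqueDiffOn_Icc zero_lt_one)).inter hO

/-- Second derivatives within a set are symmetric at points of the closure of its interior; this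
covers the boundary `t = 0`. -/
theorem slab_subset_closure_interior (hO : IsOpen O) : slab O ⊆ closure (interior (slab O)) := by
  have h : univ ×ˢ Icc (0 : ℝ) 1 ⊆ closure (interior ((univ : Set Y) ×ˢ Icc (0 : ℝ) 1)) := by
    rw [interior_prod_eq, closure_prod_eq, interior_Icc, closure_Ioo zero_ne_one]
    simp
  rw [slab, interior_inter, hO.interior_eq]
  exact (inter_subset_inter_right _ h).trans hO.inter_closure

/-- The derivative in the direction `v` on a slab. -/
def slabDeriv (O : Set (Y × ℝ)) (v : Y × ℝ) (F : Y × ℝ → ℝ) (z : Y × ℝ) : ℝ :=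
  fderivWithin ℝ F (slab O) z v

theorem slabDeriv_contDiffOn (hO : IsOpen O) (hF : ContDiffOn ℝ ∞ F (slab O)) (v : Y × ℝ) :
    ContDiffOn ℝ ∞ (slabDeriv O v F) (slab O) :=
  (hF.fderivWithin (uniqueDiffOn_slab hO) (m := ∞) (by simp)).clm_apply contDiffOn_const

theorem iterate_slabDeriv_contDiffOn (hO : IsOpen O) (hF : ContDiffOn ℝ ∞ F (slab O))
    (v : Y × ℝ) (n : ℕ) : ContDiffOn ℝ ∞ ((slabDeriv O v)^[n] F) (slab O) := by
  induction n with
  | zero => exact hF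
  | succ n ih => rw [Function.iterate_succ_apply']; exact slabDeriv_contDiffOn hO ih v

theorem slabDeriv_congr {G : Y × ℝ → ℝ} (h : EqOn F G (slab O)) (v : Y × ℝ) :
    EqOn (slabDeriv O v F) (slabDeriv O v G) (slab O) := fun z hz => by
  unfold slabDeriv
  rw [fderivWithin_congr h (h hz)]

theorem slabDeriv_comm (hO : IsOpen O) (hF : ContDiffOn ℝ ∞ F (slab O)) (v w : Y × ℝ) :
    EqOn (slabDeriv O v (slabDeriv O w F)) (slabDeriv O w (slabDeriv O v F)) (slab O) :=
  fun z hz => by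
  have hu := uniqueDiffOn_slab hO
  have hd : DifferentiableWithinAt ℝ (fderivWithin ℝ F (slab O)) (slab O) z :=
    (hF.fderivWithin hu (m := ∞) (by simp)).differentiableOn (by simp) z hz
  have h : ∀ v w : Y × ℝ, slabDeriv O v (slabDeriv O w F) z =
      fderivWithin ℝ (fderivWithin ℝ F (slab O)) (slab O) z v w := fun v w => by
    unfold slabDeriv
    rw [fderivWithin_clm_apply (hu z hz) hd (differentiableWithinAt_const w)]
    simp
  rw [h, h]
  exact ((hF z hz).isSymmSndFDerivWithinAt
    (by simpa using WithTop.coe_le_coe.2 (le_top (a := (2 : ℕ∞)))) hu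
    (slab_subset_closure_interior hO hz) hz).eq _ _

theorem iterate_slabDeriv_comm (hO : IsOpen O) (hF : ContDiffOn ℝ ∞ F (slab O)) (v w : Y × ℝ)
    (n : ℕ) : EqOn ((slabDeriv O v)^[n] (slabDeriv O w F))
      (slabDeriv O w ((slabDeriv O v)^[n] F)) (slab O) := by
  induction n with
  | zero => exact fun _ _ => rfl
  | succ n ih =>
    rw [Function.iterate_succ_apply', Function.iterate_succ_apply']
    exact (slabDeriv_congr ih v).trans
      (slabDeriv_comm hO (iterate_slabDeriv_contDiffOn hO hF v n) v w)

/-- The chain rule along `t ↦ (y, t)`. A short interval is used because `O` need not contain `(y,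
t)` for all `t ≤ 1`. -/
theorem iteratedDerivWithin_slice (hO : IsOpen O) (hF : ContDiffOn ℝ ∞ F (slab O)) {y : Y} {δ : ℝ}
    (hδ : 0 < δ) (hδ1 : δ ≤ 1) (hy : ∀ t ∈ Icc 0 δ, (y, t) ∈ O) (n : ℕ) :
    EqOn (iteratedDerivWithin n (fun t => F (y, t)) (Icc 0 δ))
      (fun t => (slabDeriv O (0, 1))^[n] F (y, t)) (Icc 0 δ) := by
  induction n with
  | zero => simp [EqOn]
  | succ n ih =>
    intro t ht
    rw [iteratedDerivWithin_succ, derivWithin_congr ih (ih ht), Function.iterate_succ_apply']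
    have hmaps : MapsTo (fun t : ℝ => (y, t)) (Icc 0 δ) (slab O) := fun u hu =>
      ⟨hy u hu, mem_univ _, hu.1, hu.2.trans hδ1⟩
    have h1 := ((iterate_slabDeriv_contDiffOn hO hF (0, 1) n).differentiableOn (by simp) _
      (hmaps ht)).hasFDerivWithinAt
    have h2 : HasDerivWithinAt (fun t : ℝ => (y, t)) (0, 1) (Icc 0 δ) t :=
      (hasDerivWithinAt_const t _ y).prodMk (hasDerivWithinAt_id t _)
    exact (h1.comp_hasDerivWithinAt t h2 hmaps).derivWithin (uniqueDiffOn_Icc hδ t ht)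

/-- The iterated one-sided derivative at `0` depends only on the germ of the interval there, so `[0,
1]` may be shortened to `[0, δ]`. -/
theorem coeff_tay_slice (hO : IsOpen O) (hF : ContDiffOn ℝ ∞ F (slab O)) {y : Y}
    (hy : (y, (0 : ℝ)) ∈ O) (n : ℕ) :
    PowerSeries.coeff n (tay fun t => F (y, t)) =
      (slabDeriv O (0, 1))^[n] F (y, 0) / n.factorial := by
  have h1 : ∀ᶠ t : ℝ in 𝓝 0, (y, t) ∈ O :=
    (Continuous.prodMk_right y).continuousAt.eventually_mem (hO.mem_nhds hy)
  obtain ⟨ε, hε, h2⟩ := Metric.eventually_nhds_iff_ball.1 h1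
  have hδ : 0 < min (ε / 2) 1 := by positivity
  have h3 : ∀ t ∈ Icc 0 (min (ε / 2) 1), (y, t) ∈ O := fun t ht => h2 t (by
    rw [Metric.mem_ball, Real.dist_0_eq_abs, abs_of_nonneg ht.1]
    linarith [ht.2, min_le_left (ε / 2) 1])
  have h4 : iteratedDerivWithin n (fun t => F (y, t)) (Icc 0 (min (ε / 2) 1)) 0 =
      (slabDeriv O (0, 1))^[n] F (y, 0) :=
    iteratedDerivWithin_slice hO hF hδ (min_le_right _ _) h3 n (left_mem_Icc.2 hδ.le)
  rw [tay, PowerSeries.coeff_mk, ← h4, iteratedDerivWithin_eq_iteratedFDerivWithin,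
    iteratedDerivWithin_eq_iteratedFDerivWithin]
  congr 2
  refine iteratedFDerivWithin_congr_set ?_ n
  filter_upwards [Iio_mem_nhds hδ] with t ht
  refine propext ⟨fun h => ⟨h.1, (mem_Iio.1 ht).le⟩, fun h => ⟨h.1, h.2.trans (min_le_right _ _)⟩⟩

theorem continuousOn_coeff_tay (hO : IsOpen O) (hF : ContDiffOn ℝ ∞ F (slab O)) (n : ℕ) :
    ContinuousOn (fun y => PowerSeries.coeff n (tay fun t => F (y, t))) {y | (y, (0 : ℝ)) ∈ O} := by
  have h1 : ContinuousOn (fun y : Y => (slabDeriv O (0, 1))^[n] F (y, 0)) {y | (y, (0 : ℝ)) ∈ O} :=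
    (iterate_slabDeriv_contDiffOn hO hF (0, 1) n).continuousOn.comp (by fun_prop)
      fun y hy => ⟨hy, mem_univ _, left_mem_Icc.2 zero_le_one⟩
  exact (h1.div_const _).congr fun y hy => coeff_tay_slice hO hF hy n

theorem eventually_mem_of_isCompact (hO : IsOpen O) {K : Set Y} (hK : IsCompact K)
    (hKO : ∀ y ∈ K, (y, (0 : ℝ)) ∈ O) :
    ∃ δ : ℝ, 0 < δ ∧ δ ≤ 1 ∧ ∀ y ∈ K, ∀ t ∈ Icc 0 δ, (y, t) ∈ O := by
  obtain ⟨u, v, -, hv, hu, h0, huv⟩ := generalized_tube_lemma hK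
    (isCompact_singleton (x := (0 : ℝ)))
    hO (by rintro ⟨y, t⟩ ⟨hy, rfl⟩; exact hKO y hy)
  obtain ⟨ε, hε, h2⟩ := Metric.isOpen_iff.1 hv 0 (h0 rfl)
  refine ⟨min (ε / 2) 1, by positivity, min_le_right _ _, fun y hy t ht => huv ⟨hu hy, h2 ?_⟩⟩
  rw [Metric.mem_ball, Real.dist_0_eq_abs, abs_of_nonneg ht.1]
  linarith [ht.2, min_le_left (ε / 2) 1]

/-- The derivative of order `N + 1` in `t` is bounded on the compact set `K × [0, δ]`, hence one
remainder constant serves all of `K`. -/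
theorem uniform_taylor (hO : IsOpen O) (hF : ContDiffOn ℝ ∞ F (slab O)) {K : Set Y}
    (hK : IsCompact K) (hKO : ∀ y ∈ K, (y, (0 : ℝ)) ∈ O) (N : ℕ) :
    ∃ C : ℝ, 0 ≤ C ∧ ∀ᶠ t in 𝓝[>] (0 : ℝ), ∀ y ∈ K, (y, t) ∈ slab O ∧
      |F (y, t) - ∑ n ∈ Finset.range (N + 1), t ^ n *
        PowerSeries.coeff n (tay fun t => F (y, t))| ≤ C * t ^ (N + 1) := by
  obtain ⟨δ, hδ, hδ1, hKδ⟩ := eventually_mem_of_isCompact hO hK hKO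
  have hcont := (iterate_slabDeriv_contDiffOn hO hF (0, 1) (N + 1)).continuousOn.mono
    (s := slab O) (t := K ×ˢ Icc 0 δ) fun z hz =>
      ⟨hKδ z.1 hz.1 z.2 hz.2, mem_univ _, hz.2.1, hz.2.2.trans hδ1⟩
  obtain ⟨C, hC⟩ := (hK.prod isCompact_Icc).exists_bound_of_continuousOn hcont
  refine ⟨|C| / N.factorial, by positivity, ?_⟩
  filter_upwards [Ioc_mem_nhdsGT hδ] with t ht y hy
  have ht' : t ∈ Icc 0 δ := ⟨ht.1.le, ht.2⟩
  refine ⟨⟨hKδ y hy t ht', mem_univ _, ht'.1, ht'.2.trans hδ1⟩, ?_⟩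
  have hsl := iteratedDerivWithin_slice hO hF hδ hδ1 (hKδ y hy)
  have hmaps : MapsTo (fun t : ℝ => (y, t)) (Icc 0 δ) (slab O) := fun u hu =>
    ⟨hKδ y hy u hu, mem_univ _, hu.1, hu.2.trans hδ1⟩
  have hsm : ContDiffOn ℝ ∞ (fun t => F (y, t)) (Icc 0 δ) := hF.comp (by fun_prop) hmaps
  have h1 := taylor_mean_remainder_bound (f := fun t => F (y, t)) (C := |C|) (n := N) hδ.le
    (hsm.of_le (by exact_mod_cast le_top)) ht' fun u hu => by
      rw [hsl (N + 1) hu]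
      exact (hC (y, u) ⟨hy, hu⟩).trans (le_abs_self C)
  rw [sub_zero, taylor_within_apply, Real.norm_eq_abs] at h1
  rw [div_mul_eq_mul_div]
  convert h1 using 3
  refine Finset.sum_congr rfl fun n _ => ?_
  have h2 : iteratedDerivWithin n (fun t => F (y, t)) (Icc 0 δ) 0 =
      (slabDeriv O (0, 1))^[n] F (y, 0) := hsl n (left_mem_Icc.2 hδ.le)
  rw [coeff_tay_slice hO hF (hKO y hy), ← h2, sub_zero, smul_eq_mul]
  ring

/-- Derivatives in `t` and in the parameters commute, and a function that vanishes on an open set of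
parameters has vanishing derivatives there. -/
theorem coeff_tay_slabDeriv_eq_zero (hO : IsOpen O) (hF : ContDiffOn ℝ ∞ F (slab O)) {n : ℕ}
    {V : Set Y} (hV : IsOpen V) (hVO : ∀ y ∈ V, (y, (0 : ℝ)) ∈ O)
    (h0 : ∀ y ∈ V, PowerSeries.coeff n (tay fun t => F (y, t)) = 0) (v : Y) {y : Y} (hy : y ∈ V) :
    PowerSeries.coeff n (tay fun t => slabDeriv O (v, 0) F (y, t)) = 0 := by
  have hmem : (y, (0 : ℝ)) ∈ slab O := ⟨hVO y hy, mem_univ _, left_mem_Icc.2 zero_le_one⟩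
  rw [coeff_tay_slice hO (slabDeriv_contDiffOn hO hF _) (hVO y hy),
    iterate_slabDeriv_comm hO hF _ _ n hmem]
  have h1 : ∀ y ∈ V, (slabDeriv O (0, 1))^[n] F (y, 0) = 0 := fun y hy => by
    have := h0 y hy
    rw [coeff_tay_slice hO hF (hVO y hy), div_eq_zero_iff] at this
    exact this.resolve_right (by positivity)
  set G := (slabDeriv O (0, 1))^[n] F
  have hev : ∀ᶠ h : ℝ in 𝓝 0, y + h • v ∈ V := by
    have : ContinuousAt (fun h : ℝ => y + h • v) 0 := by fun_prop
    exact this.eventually_mem (hV.mem_nhds (by simpa using hy))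
  let T : Set ℝ := {h | y + h • v ∈ V}
  have hT : T ∈ 𝓝 (0 : ℝ) := hev
  have h2 : HasFDerivWithinAt G (fderivWithin ℝ G (slab O) (y, 0)) (slab O)
      ((fun h : ℝ => (y + h • v, (0 : ℝ))) 0) := by
    simp only [zero_smul, add_zero]
    exact ((iterate_slabDeriv_contDiffOn hO hF (0, 1) n).differentiableOn (by simp) _
      hmem).hasFDerivWithinAt
  have h3 : HasDerivWithinAt (fun h : ℝ => (y + h • v, (0 : ℝ))) (v, 0) T 0 := by
    refine HasDerivWithinAt.prodMk ?_ (hasDerivWithinAt_const _ _ _)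
    simpa using ((hasDerivWithinAt_id (0 : ℝ) T).smul_const v).const_add y
  have h4 := HasFDerivWithinAt.comp_hasDerivWithinAt (f := fun h : ℝ => (y + h • v, (0 : ℝ)))
    (0 : ℝ) h2 h3 fun h hh => ⟨hVO _ hh, mem_univ _, left_mem_Icc.2 zero_le_one⟩
  have h5 : HasDerivAt (fun _ : ℝ => (0 : ℝ)) (fderivWithin ℝ G (slab O) (y, 0) (v, 0)) 0 :=
    (h4.hasDerivAt hT).congr_of_eventuallyEq <| by
      filter_upwards [hev] with h hh
      exact (h1 _ hh).symm
  rw [slabDeriv, h5.unique (hasDerivAt_const _ _), zero_div]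

/-- If the leading coefficients of a sum `∑ t ^ n b_n(t) = O(t ^ (N + 1))` vanish, so does the limit
of the next one. -/
theorem limit_eq_zero_of_isBigO {N k : ℕ} (hk : k ≤ N) {b : ℕ → ℝ → ℝ} {β : ℕ → ℝ}
    (hb : ∀ n ≤ N, Tendsto (b n) (𝓝[>] 0) (𝓝 (β n)))
    (h0 : ∀ n < k, ∀ᶠ t in 𝓝[>] 0, b n t = 0)
    (hO : (fun t => ∑ n ∈ Finset.range (N + 1), t ^ n * b n t) =O[𝓝[>] 0]
      fun t : ℝ => t ^ (N + 1)) : β k = 0 := by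
  have hpow : ∀ {i j : ℕ}, i ≤ j → (fun t : ℝ => t ^ j) =O[𝓝[>] 0] fun t => t ^ i :=
    fun {i j} h => by
      simpa using (isBigO_pow_mul h 1).mono (nhdsWithin_le_nhds (s := Ioi (0 : ℝ)))
  -- Below `k` the terms vanish, and above `k` each is a bounded function times `t ^ n` with `n ≥ k
  -- + 1`.
  have h1 : (fun t => t ^ k * b k t) =O[𝓝[>] 0] fun t : ℝ => t ^ (k + 1) := by
    have h2 : ∀ t, t ^ k * b k t = ∑ n ∈ Finset.range (N + 1), t ^ n * b n t -
        ∑ n ∈ (Finset.range (N + 1)).erase k, t ^ n * b n t := fun t => by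
      rw [← Finset.add_sum_erase (Finset.range (N + 1)) (fun n => t ^ n * b n t)
        (Finset.mem_range.2 (Nat.lt_succ_of_le hk)), add_sub_cancel_right]
    simp only [h2]
    refine (hO.trans (hpow (by omega))).sub (Asymptotics.IsBigO.fun_sum fun n hn => ?_)
    rw [Finset.mem_erase, Finset.mem_range] at hn
    rcases lt_or_gt_of_ne hn.1 with h | h
    · refine ((Asymptotics.isBigO_zero _ _).congr' ?_ EventuallyEq.rfl)
      filter_upwards [h0 n h] with t ht
      rw [ht, mul_zero]
    · simpa using (hpow (show k + 1 ≤ n from h)).mul ((hb n (by omega)).isBigO_one ℝ)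
  have h3 : Tendsto (b k) (𝓝[>] 0) (𝓝 0) := by
    obtain ⟨C, hC⟩ := h1.bound
    refine squeeze_zero_norm' (a := fun t => |C| * t) ?_ ?_
    · filter_upwards [hC, self_mem_nhdsWithin] with t ht (ht0 : 0 < t)
      have h4 : 0 < t ^ k := pow_pos ht0 k
      rw [norm_mul, Real.norm_of_nonneg h4.le, Real.norm_of_nonneg (pow_pos ht0 _).le,
        pow_succ] at ht
      have h5 : t ^ k * ‖b k t‖ ≤ t ^ k * (|C| * t) := by
        refine ht.trans ?_
        have := mul_le_mul_of_nonneg_right (le_abs_self C) (mul_pos h4 ht0).le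
        linarith [this]
      exact le_of_mul_le_mul_left h5 h4
    · have : Tendsto (fun t : ℝ => |C| * t) (𝓝 0) (𝓝 (|C| * 0)) := by
        exact (continuous_const.mul continuous_id).tendsto 0
      rw [mul_zero] at this
      exact this.mono_left nhdsWithin_le_nhds
  exact tendsto_nhds_unique (hb k hk) h3

theorem coeff_tay_eq_zero_of_isBigO (hO : IsOpen O) (hF : ContDiffOn ℝ ∞ F (slab O)) {y : Y}
    (hy : (y, (0 : ℝ)) ∈ O) {N : ℕ}
    (h : (fun t => F (y, t)) =O[𝓝[>] 0] fun t : ℝ => t ^ (N + 1)) {n : ℕ} (hn : n ≤ N) :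
    PowerSeries.coeff n (tay fun t => F (y, t)) = 0 := by
  obtain ⟨C, hC0, hC⟩ := uniform_taylor hO hF (isCompact_singleton (x := y)) (by simpa using hy) N
  have h1 : (fun t => ∑ n ∈ Finset.range (N + 1), t ^ n *
      PowerSeries.coeff n (tay fun t => F (y, t))) =O[𝓝[>] 0] fun t : ℝ => t ^ (N + 1) := by
    have h2 : (fun t => F (y, t) - ∑ n ∈ Finset.range (N + 1), t ^ n *
        PowerSeries.coeff n (tay fun t => F (y, t))) =O[𝓝[>] 0] fun t : ℝ => t ^ (N + 1) := by
      refine Asymptotics.IsBigO.of_bound C ?_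
      filter_upwards [hC, self_mem_nhdsWithin] with t ht (ht0 : 0 < t)
      rw [Real.norm_eq_abs, Real.norm_of_nonneg (pow_pos ht0 _).le]
      exact (ht y rfl).2
    simpa using h.sub h2
  induction n using Nat.strong_induction_on with
  | _ n ih =>
    exact limit_eq_zero_of_isBigO hn (b := fun n _ => PowerSeries.coeff n (tay fun t => F (y, t)))
      (fun _ _ => tendsto_const_nhds)
      (fun k hk => Eventually.of_forall fun _ => ih k hk (by omega)) h1

end Slab

end TreeExpansion

end

noncomputable section

namespace TreeExpansion

/-! ## Approximate solutions of the Hamilton-Jacobi equation -/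

section HamiltonJacobi

open Set Filter Topology

variable {d : ℕ}

/-- The norms are sup norms, whence the factor `d`. -/
theorem abs_dotProduct_le (a b : Fin d → ℝ) : |a ⬝ᵥ b| ≤ d * (‖a‖ * ‖b‖) := by
  refine (Finset.abs_sum_le_sum_abs _ _).trans ?_
  have h : ∀ i ∈ Finset.univ, |a i * b i| ≤ ‖a‖ * ‖b‖ := fun i _ => by
    rw [abs_mul]
    exact mul_le_mul (norm_le_pi_norm a i) (norm_le_pi_norm b i) (abs_nonneg _) (norm_nonneg _)
  simpa using Finset.sum_le_card_nsmul _ _ _ h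

theorem fderiv_snd_eq (H : (Fin d → ℝ) × (Fin d → ℝ) → ℝ) (z : (Fin d → ℝ) × (Fin d → ℝ))
    (v : Fin d → ℝ) : fderiv ℝ H z (0, v) = -(v ⬝ᵥ (hamiltonianField H z).1) := by
  have h : ((0, v) : (Fin d → ℝ) × (Fin d → ℝ)) = ∑ j, v j • (0, Pi.single j 1) := by
    refine Prod.ext ?_ ?_
    · simp [Prod.fst_sum]
    · simp only [Prod.snd_sum, Prod.smul_snd]
      exact pi_eq_sum_univ' v
  rw [h, map_sum]
  simp only [map_smul]
  simp [hamiltonianField, dotProduct]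

theorem fderiv_fst_eq (H : (Fin d → ℝ) × (Fin d → ℝ) → ℝ) (z : (Fin d → ℝ) × (Fin d → ℝ))
    (v : Fin d → ℝ) : fderiv ℝ H z (v, 0) = v ⬝ᵥ (hamiltonianField H z).2 := by
  have h : ((v, 0) : (Fin d → ℝ) × (Fin d → ℝ)) = ∑ j, v j • (Pi.single j 1, 0) := by
    refine Prod.ext ?_ ?_
    · simp only [Prod.fst_sum, Prod.smul_fst]
      exact pi_eq_sum_univ' v
    · simp [Prod.snd_sum]
  rw [h, map_sum]
  simp only [map_smul]
  simp [hamiltonianField, dotProduct]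

theorem fderiv_eq_hamiltonianField (H : (Fin d → ℝ) × (Fin d → ℝ) → ℝ)
    (z v : (Fin d → ℝ) × (Fin d → ℝ)) : fderiv ℝ H z v =
      v.1 ⬝ᵥ (hamiltonianField H z).2 - v.2 ⬝ᵥ (hamiltonianField H z).1 := by
  have h : v = (v.1, 0) + (0, v.2) := by simp
  rw [h, map_add, fderiv_fst_eq, fderiv_snd_eq]
  simp [sub_eq_add_neg]

theorem hamiltonianField_contDiffOn {U : Set ((Fin d → ℝ) × (Fin d → ℝ))}
    {H : (Fin d → ℝ) × (Fin d → ℝ) → ℝ} (hU : IsOpen U) (hH : ContDiffOn ℝ ∞ H U) :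
    ContDiffOn ℝ ∞ (hamiltonianField H) U := by
  have h : ContDiffOn ℝ ∞ (fderiv ℝ H) U := hH.fderiv_of_isOpen hU (m := ∞) (by simp)
  exact (contDiffOn_pi.2 fun j => (h.clm_apply contDiffOn_const).neg).prodMk
    (contDiffOn_pi.2 fun j => h.clm_apply contDiffOn_const)

/-- A function with small derivative relative to its size that starts at `0` stays small. -/
theorem norm_le_of_norm_deriv_le {E : Type*} [NormedAddCommGroup E] [NormedSpace ℝ E]
    {f f' : ℝ → E} {t K ε : ℝ} (ht : 0 ≤ t) (hK : 0 ≤ K) (hKt : K * t ≤ 1 / 2)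
    (hε : 0 ≤ ε) (hf : ∀ u ∈ Icc 0 t, HasDerivWithinAt f (f' u) (Icc 0 t) u) (h0 : f 0 = 0)
    (hb : ∀ u ∈ Icc 0 t, ‖f' u‖ ≤ K * ‖f u‖ + ε) {u : ℝ} (hu : u ∈ Icc 0 t) :
    ‖f u‖ ≤ 2 * (ε * t) := by
  -- At a maximum `v` of `‖f‖` the mean value inequality gives `‖f v‖ ≤ (K ‖f v‖ + ε) t`, and `K t ≤
  -- 1/2` absorbs the first term.
  obtain ⟨v, hv, hmax⟩ := isCompact_Icc.exists_isMaxOn (nonempty_Icc.2 ht)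
    (f := fun u => ‖f u‖) (fun u hu => (hf u hu).continuousWithinAt.norm)
  have h1 := norm_image_sub_le_of_norm_deriv_le_segment' (C := K * ‖f v‖ + ε) hf
    (fun u hu => (hb u (Ico_subset_Icc_self hu)).trans (by
      have := hmax (Ico_subset_Icc_self hu)
      gcongr
      exact this)) v hv
  rw [h0, sub_zero, sub_zero] at h1
  have h2 : (K * ‖f v‖ + ε) * v ≤ (K * ‖f v‖ + ε) * t :=
    mul_le_mul_of_nonneg_left hv.2 (by positivity)
  have h3 : (K * t) * ‖f v‖ ≤ 1 / 2 * ‖f v‖ := mul_le_mul_of_nonneg_right hKt (norm_nonneg _)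
  have h4 : ‖f u‖ ≤ ‖f v‖ := hmax hu
  linarith

/-- Picard-Lindelöf with a starting point off the centre. The curve is taken directly from the fixed
point of the Picard operator, since its confinement to the ball is needed as well. -/
theorem exists_isIntegralCurveOn {E : Type*} [NormedAddCommGroup E] [NormedSpace ℝ E]
    [CompleteSpace E] {f : E → E} {z₀ z₁ : E} {a L : ℝ} (hL : 0 ≤ L) {K : NNReal}
    (hb : ∀ z ∈ Metric.closedBall z₀ a, ‖f z‖ ≤ L)
    (hl : LipschitzOnWith K f (Metric.closedBall z₀ a)) {t : ℝ} (ht : 0 ≤ t)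
    (h : ‖z₁ - z₀‖ + L * t ≤ a) :
    ∃ z : ℝ → E, z 0 = z₁ ∧ (∀ u ∈ Icc 0 t, z u ∈ Metric.closedBall z₀ a) ∧
      IsIntegralCurveOn z (fun _ => f) (Icc 0 t) := by
  have hr : 0 ≤ a - L * t := by linarith [norm_nonneg (z₁ - z₀)]
  have ha : 0 ≤ a := by nlinarith
  lift L to NNReal using hL
  lift a to NNReal using ha
  obtain ⟨r, hr'⟩ : ∃ r : NNReal, (r : ℝ) = a - L * t := ⟨⟨_, hr⟩, rfl⟩
  have hm : (L : ℝ) * max (t - (⟨0, left_mem_Icc.2 ht⟩ : Icc 0 t))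
      ((⟨0, left_mem_Icc.2 ht⟩ : Icc 0 t) - 0) ≤ a - r := by
    simp [ht, hr']
  have hf : IsPicardLindelof (fun _ => f) (⟨0, left_mem_Icc.2 ht⟩ : Icc 0 t) z₀ a r L K :=
    .of_time_independent hb hl hm
  have hx : z₁ ∈ Metric.closedBall z₀ (r : ℝ) := by
    rw [mem_closedBall_iff_norm]
    linarith
  obtain ⟨α, hα⟩ := ODE.FunSpace.exists_isFixedPt_next hf hx
  have hmem : ∀ u, α.compProj u ∈ Metric.closedBall z₀ a := fun u => α.compProj_mem_closedBall hm
  have heq : ∀ u ∈ Icc 0 t, α.compProj u = ODE.picard (fun _ => f) 0 z₁ α.compProj u :=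
    fun u hu => by
      conv_lhs => rw [ODE.FunSpace.compProj_apply, ← hα, ODE.FunSpace.next_apply,
        projIcc_of_mem _ hu]
  refine ⟨α.compProj, ?_, fun u _ => hmem u, fun u hu => ?_⟩
  · rw [heq 0 (left_mem_Icc.2 ht), ODE.picard_apply₀]
  · have h1 := ODE.hasDerivWithinAt_picard_Icc (t₀ := 0) (x₀ := z₁) (left_mem_Icc.2 ht)
      hf.continuousOn_uncurry α.continuous_compProj.continuousOn (fun u _ => hmem u) hu
    exact h1.congr heq (heq u hu)

/-- The points `((s, x), t)`. -/
abbrev PhasePoint (d : ℕ) : Type := (ℝ × (Fin d → ℝ)) × ℝ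

/-- The direction of the coordinate `x^i`. -/
def spaceDir (i : Fin d) : PhasePoint d := ((0, Pi.single i 1), 0)

/-- The gradient of `W ((s, x), t)` with respect to `x`. -/
def spaceGrad (W : PhasePoint d → ℝ) (z : PhasePoint d) : Fin d → ℝ :=
  fun i => fderiv ℝ W z (spaceDir i)

/-- The point `(x, t ∇_x W)` of the cotangent bundle. -/
def gradPoint (W : PhasePoint d → ℝ) (z : PhasePoint d) : (Fin d → ℝ) × (Fin d → ℝ) :=
  (z.1.2, z.2 • spaceGrad W z)

/-- The defect `∂_s W - H(x, t ∇_x W)` of the Hamilton-Jacobi equation. -/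
def residual (H : (Fin d → ℝ) × (Fin d → ℝ) → ℝ) (W : PhasePoint d → ℝ) (z : PhasePoint d) : ℝ :=
  fderiv ℝ W z ((1, 0), 0) - H (gradPoint W z)

variable {M : Set (Fin d → ℝ)} {U : Set ((Fin d → ℝ) × (Fin d → ℝ))}
  {H : (Fin d → ℝ) × (Fin d → ℝ) → ℝ} {W : PhasePoint d → ℝ}

theorem isOpen_space (hM : IsOpen M) : IsOpen {z : PhasePoint d | z.1.2 ∈ M} :=
  hM.preimage (by fun_prop)

theorem fderiv_space_eq (W : PhasePoint d → ℝ) (z : PhasePoint d) (v : Fin d → ℝ) :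
    fderiv ℝ W z ((0, v), 0) = v ⬝ᵥ spaceGrad W z := by
  have h : (((0, v), 0) : PhasePoint d) = ∑ j, v j • spaceDir j := by
    refine Prod.ext (Prod.ext ?_ ?_) ?_
    · simp [Prod.fst_sum, spaceDir]
    · simp only [Prod.snd_sum, Prod.fst_sum, Prod.smul_fst, Prod.smul_snd, spaceDir]
      exact pi_eq_sum_univ' v
    · simp [Prod.snd_sum, spaceDir]
  rw [h]
  simp [spaceGrad, dotProduct]

theorem fderiv_contDiffOn_space (hM : IsOpen M) (hW : ContDiffOn ℝ ∞ W {z | z.1.2 ∈ M}) :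
    ContDiffOn ℝ ∞ (fderiv ℝ W) {z | z.1.2 ∈ M} :=
  hW.fderiv_of_isOpen (isOpen_space hM) (m := ∞) (by simp)

theorem spaceGrad_contDiffOn (hM : IsOpen M) (hW : ContDiffOn ℝ ∞ W {z | z.1.2 ∈ M}) :
    ContDiffOn ℝ ∞ (spaceGrad W) {z | z.1.2 ∈ M} :=
  contDiffOn_pi.2 fun _ => (fderiv_contDiffOn_space hM hW).clm_apply contDiffOn_const

theorem gradPoint_contDiffOn (hM : IsOpen M) (hW : ContDiffOn ℝ ∞ W {z | z.1.2 ∈ M}) :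
    ContDiffOn ℝ ∞ (gradPoint W) {z | z.1.2 ∈ M} := by
  have h := spaceGrad_contDiffOn hM hW
  exact ContDiffOn.prodMk (by fun_prop) (contDiff_snd.contDiffOn.smul h)

/-- The domain of `residual`. -/
def residualDomain (M : Set (Fin d → ℝ)) (U : Set ((Fin d → ℝ) × (Fin d → ℝ)))
    (W : PhasePoint d → ℝ) : Set (PhasePoint d) :=
  {z | z.1.2 ∈ M} ∩ gradPoint W ⁻¹' U

theorem isOpen_residualDomain (hM : IsOpen M) (hU : IsOpen U)
    (hW : ContDiffOn ℝ ∞ W {z | z.1.2 ∈ M}) : IsOpen (residualDomain M U W) :=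
  (gradPoint_contDiffOn hM hW).continuousOn.isOpen_inter_preimage (isOpen_space hM) hU

theorem residual_contDiffOn (hM : IsOpen M) (hH : ContDiffOn ℝ ∞ H U)
    (hW : ContDiffOn ℝ ∞ W {z | z.1.2 ∈ M}) :
    ContDiffOn ℝ ∞ (residual H W) (residualDomain M U W) := by
  have h1 : ContDiffOn ℝ ∞ (fun z => fderiv ℝ W z ((1, 0), 0)) (residualDomain M U W) :=
    ((fderiv_contDiffOn_space hM hW).clm_apply contDiffOn_const).mono inter_subset_left
  exact h1.sub (hH.comp ((gradPoint_contDiffOn hM hW).mono inter_subset_left) fun z hz => hz.2)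

theorem fderiv_spaceGrad (hM : IsOpen M) (hW : ContDiffOn ℝ ∞ W {z | z.1.2 ∈ M})
    {z : PhasePoint d} (hz : z.1.2 ∈ M) (v : PhasePoint d) (i : Fin d) :
    fderiv ℝ (spaceGrad W) z v i = fderiv ℝ (fun z => fderiv ℝ W z v) z (spaceDir i) := by
  have hd : DifferentiableAt ℝ (fderiv ℝ W) z :=
    ((fderiv_contDiffOn_space hM hW).contDiffAt ((isOpen_space hM).mem_nhds hz)).differentiableAt
      (by simp)
  have hs := (hW.contDiffAt ((isOpen_space hM).mem_nhds hz)).isSymmSndFDerivAt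
    (by simpa using WithTop.coe_le_coe.2 (le_top (a := (2 : ℕ∞))))
  have h1 : ∀ v w, fderiv ℝ (fun z => fderiv ℝ W z v) z w = fderiv ℝ (fderiv ℝ W) z w v :=
    fun v w => by
      rw [fderiv_clm_apply hd (differentiableAt_const v)]
      simp
  have h2 : fderiv ℝ (spaceGrad W) z v i = fderiv ℝ (fun z => spaceGrad W z i) z v := by
    have hp : ∀ i, DifferentiableAt ℝ (fun z => spaceGrad W z i) z := fun i =>
      hd.clm_apply (differentiableAt_const _)
    rw [((hasFDerivAt_pi (φ := fun i z => spaceGrad W z i)).2 fun i =>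
      (hp i).hasFDerivAt).fderiv]
    rfl
  rw [h2, h1]
  unfold spaceGrad
  rw [h1]
  exact hs.eq _ _

/-- Differentiating the Hamilton-Jacobi equation along a direction that satisfies the first
half of Hamilton's equations. -/
theorem fderiv_spaceGrad_eq (hM : IsOpen M) (hU : IsOpen U) (hH : ContDiffOn ℝ ∞ H U)
    (hW : ContDiffOn ℝ ∞ W {z | z.1.2 ∈ M}) {z : PhasePoint d} (hz : z ∈ residualDomain M U W)
    (a : ℝ) (w : Fin d → ℝ) (i : Fin d) :
    fderiv ℝ (spaceGrad W) z ((a, w), 0) i =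
      a * (fderiv ℝ (residual H W) z (spaceDir i) + (hamiltonianField H (gradPoint W z)).2 i -
        z.2 * (fderiv ℝ (spaceGrad W) z (spaceDir i) ⬝ᵥ (hamiltonianField H (gradPoint W z)).1)) +
      fderiv ℝ (spaceGrad W) z (spaceDir i) ⬝ᵥ w := by
  have hopen := isOpen_space hM
  have hQ : DifferentiableAt ℝ (spaceGrad W) z :=
    ((spaceGrad_contDiffOn hM hW).contDiffAt (hopen.mem_nhds hz.1)).differentiableAt (by simp)
  have hR : DifferentiableAt ℝ (residual H W) z :=
    ((residual_contDiffOn hM hH hW).contDiffAt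
      ((isOpen_residualDomain hM hU hW).mem_nhds hz)).differentiableAt (by simp)
  have hHd : HasFDerivAt H (fderiv ℝ H (gradPoint W z)) (gradPoint W z) :=
    ((hH.contDiffAt (hU.mem_nhds hz.2)).differentiableAt (by simp)).hasFDerivAt
  have h1 : (((a, w), 0) : PhasePoint d) = a • ((1, 0), 0) + ((0, w), 0) := by simp
  have h2 : fderiv ℝ (spaceGrad W) z ((0, w), 0) i =
      fderiv ℝ (spaceGrad W) z (spaceDir i) ⬝ᵥ w := by
    rw [fderiv_spaceGrad hM hW hz.1]
    simp only [fderiv_space_eq]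
    have h3 : HasFDerivAt (fun z => w ⬝ᵥ spaceGrad W z)
        (∑ j, w j • (ContinuousLinearMap.proj j).comp (fderiv ℝ (spaceGrad W) z)) z := by
      unfold dotProduct
      exact HasFDerivAt.fun_sum fun j _ => (((hasFDerivAt_pi'.1 hQ.hasFDerivAt) j).const_mul (w j))
    rw [h3.fderiv, dotProduct_comm]
    simp [dotProduct]
  have h4 : fderiv ℝ (spaceGrad W) z ((1, 0), 0) i = fderiv ℝ (residual H W) z (spaceDir i) +
      ((hamiltonianField H (gradPoint W z)).2 i - z.2 *
        (fderiv ℝ (spaceGrad W) z (spaceDir i) ⬝ᵥ (hamiltonianField H (gradPoint W z)).1)) := by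
    rw [fderiv_spaceGrad hM hW hz.1]
    -- By symmetry of second derivatives `∂_s ∂_i W = ∂_i ∂_s W`, and `∂_s W` is the residual plus
    -- `H(x, t ∇W)`, to which the chain rule applies.
    have h5 : (fun z => fderiv ℝ W z ((1, 0), 0)) =
        fun z => residual H W z + H (gradPoint W z) := by
      funext z; simp [residual]
    have h6 : HasFDerivAt (gradPoint W) (((ContinuousLinearMap.snd ℝ ℝ (Fin d → ℝ)).comp
        (ContinuousLinearMap.fst ℝ _ ℝ)).prod (z.2 • fderiv ℝ (spaceGrad W) z +
        (ContinuousLinearMap.snd ℝ _ ℝ).smulRight (spaceGrad W z))) z :=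
      HasFDerivAt.prodMk (hasFDerivAt_snd.comp z hasFDerivAt_fst)
        (hasFDerivAt_snd.smul hQ.hasFDerivAt)
    have h7 := hR.hasFDerivAt.fun_add (hHd.comp z h6)
    simp only [Function.comp_apply] at h7
    rw [h5, h7.fderiv, _root_.add_apply]
    congr 1
    rw [ContinuousLinearMap.comp_apply, fderiv_eq_hamiltonianField]
    simp [spaceDir]
  rw [h1, map_add, map_smul, Pi.add_apply, Pi.smul_apply, h2, h4, smul_eq_mul]
  ring

end HamiltonJacobi

end TreeExpansion

end

noncomputable section

namespace TreeExpansion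

/-! ### The action along a trajectory -/

section HamiltonJacobi

open Set Filter Topology

variable {d : ℕ} {M : Set (Fin d → ℝ)} {U : Set ((Fin d → ℝ) × (Fin d → ℝ))}
  {H : (Fin d → ℝ) × (Fin d → ℝ) → ℝ} {W : PhasePoint d → ℝ}

theorem hamiltonian_const (hU : IsOpen U) (hH : ContDiffOn ℝ ∞ H U)
    {z : ℝ → (Fin d → ℝ) × (Fin d → ℝ)} {t : ℝ} (hzU : ∀ u ∈ Icc 0 t, z u ∈ U)
    (hz : IsIntegralCurveOn z (fun _ => hamiltonianField H) (Icc 0 t)) {u : ℝ} (hu : u ∈ Icc 0 t) :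
    H (z u) = H (z 0) := by
  have h1 : ∀ u ∈ Icc 0 t, HasDerivWithinAt (fun u => H (z u)) 0 (Icc 0 t) u := fun u hu => by
    have h2 : HasFDerivAt H (fderiv ℝ H (z u)) (z u) :=
      ((hH.contDiffAt (hU.mem_nhds (hzU u hu))).differentiableAt (by simp)).hasFDerivAt
    have h3 := h2.comp_hasDerivWithinAt u (hz u hu)
    rwa [fderiv_eq_hamiltonianField, dotProduct_comm, sub_self] at h3
  have h2 := norm_image_sub_le_of_norm_deriv_le_segment' (C := 0) h1 (by simp) u hu
  rw [zero_mul] at h2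
  exact sub_eq_zero.1 (norm_le_zero_iff.1 h2)

/-- Along a trajectory, an approximate solution `W` of the Hamilton-Jacobi equation is close to the
action. -/
theorem action_estimate (hM : IsOpen M) (hU : IsOpen U) (hH : ContDiffOn ℝ ∞ H U)
    (hW : ContDiffOn ℝ ∞ W {z | z.1.2 ∈ M}) {p x₁ : Fin d → ℝ} (hx₁ : x₁ ∈ M)
    (hW0 : ∀ x ∈ M, ∀ t, W ((0, x), t) = p ⬝ᵥ x)
    {B : Set ((Fin d → ℝ) × (Fin d → ℝ))} (hBU : B ⊆ U) {K K' : NNReal} {A G ε t : ℝ}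
    (hlip : LipschitzOnWith K (hamiltonianField H) B) (hlip' : LipschitzOnWith K' H B)
    (hA : ∀ z ∈ B, ‖hamiltonianField H z‖ ≤ A) (hG : 0 ≤ G) (hε : 0 ≤ ε) (ht : 0 < t)
    (ht1 : t ≤ 1) (hsmall : (K + d * (G * K)) * t ≤ 1 / 2)
    {z : ℝ → (Fin d → ℝ) × (Fin d → ℝ)} (hz0 : z 0 = (x₁, t • p)) (hzB : ∀ u ∈ Icc 0 t, z u ∈ B)
    (hz : IsIntegralCurveOn z (fun _ => hamiltonianField H) (Icc 0 t))
    (hdom : ∀ u ∈ Icc 0 t, ((u / t, (z u).1), t) ∈ residualDomain M U W)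
    (hgrad : ∀ u ∈ Icc 0 t, gradPoint W ((u / t, (z u).1), t) ∈ B)
    (hR : ∀ u ∈ Icc 0 t, |residual H W ((u / t, (z u).1), t)| ≤ ε)
    (hR' : ∀ u ∈ Icc 0 t, ∀ i, |fderiv ℝ (residual H W) ((u / t, (z u).1), t) (spaceDir i)| ≤ ε)
    (hG' : ∀ u ∈ Icc 0 t, ∀ i,
      ‖fderiv ℝ (spaceGrad W) ((u / t, (z u).1), t) (spaceDir i)‖ ≤ G) :
    |W ((1, (z t).1), t) - (p ⬝ᵥ x₁ + H (x₁, t • p) -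
      1 / t * ∫ u in (0 : ℝ)..t, eulerDeriv H (z u))| ≤ ε * (1 + 2 * K' + d * (2 * A)) := by
  set γ : ℝ → PhasePoint d := fun u => ((u / t, (z u).1), t) with hγ
  set f := hamiltonianField H with hf
  have h0 : (0 : ℝ) ∈ Icc 0 t := left_mem_Icc.2 ht.le
  have hopen := isOpen_space (d := d) hM
  have hγ' : ∀ u ∈ Icc 0 t, HasDerivWithinAt γ ((1 / t, (f (z u)).1), 0) (Icc 0 t) u := fun u hu =>
    (((hasDerivWithinAt_id u _).div_const t).prodMk (hz u hu).fst).prodMk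
      (hasDerivWithinAt_const _ _ _)
  -- the momentum is close to `t ∇ W`
  let δ : ℝ → Fin d → ℝ := fun u => spaceGrad W (γ u) - (1 / t) • (z u).2
  have hdiff : ∀ u, gradPoint W (γ u) - z u = (0, t • δ u) := fun u => by
    refine Prod.ext (by simp [gradPoint, hγ]) ?_
    simp only [gradPoint, hγ, δ, Prod.snd_sub, smul_sub, smul_smul]
    rw [mul_one_div_cancel ht.ne', one_smul]
  have hnorm : ∀ u, ‖gradPoint W (γ u) - z u‖ = t * ‖δ u‖ := fun u => by
    rw [hdiff, Prod.norm_mk, norm_zero, max_eq_right (norm_nonneg _), norm_smul,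
      Real.norm_of_nonneg ht.le]
  have hff : ∀ u ∈ Icc 0 t, ‖f (gradPoint W (γ u)) - f (z u)‖ ≤ K * (t * ‖δ u‖) := fun u hu => by
    rw [← hnorm]
    exact hlip.norm_sub_le (hgrad u hu) (hzB u hu)
  have hδ' : ∀ u ∈ Icc 0 t, HasDerivWithinAt δ
      (fderiv ℝ (spaceGrad W) (γ u) ((1 / t, (f (z u)).1), 0) - (1 / t) • (f (z u)).2)
      (Icc 0 t) u := fun u hu => by
    have h1 : HasFDerivAt (spaceGrad W) (fderiv ℝ (spaceGrad W) (γ u)) (γ u) :=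
      (((spaceGrad_contDiffOn hM hW).contDiffAt
        (hopen.mem_nhds (hdom u hu).1)).differentiableAt (by simp)).hasFDerivAt
    have h2 : HasDerivWithinAt (fun u => (z u).2) (f (z u)).2 (Icc 0 t) u := (hz u hu).snd
    exact (h1.comp_hasDerivWithinAt u (hγ' u hu)).fun_sub (h2.fun_const_smul (1 / t))
  -- At `s = 0` the gradient of `W` is `p`, and the trajectory starts with momentum `t • p`.
  have hδ0 : δ 0 = 0 := by
    have h1 : spaceGrad W (γ 0) = p := by
      funext i
      have h2 : HasFDerivAt W (fderiv ℝ W (γ 0)) (γ 0) :=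
        ((hW.contDiffAt (hopen.mem_nhds (hdom 0 h0).1)).differentiableAt (by simp)).hasFDerivAt
      have h3 : γ 0 = ((0, x₁), t) := by simp [hγ, hz0]
      have h4 : HasFDerivAt (fun x : Fin d → ℝ => (((0, x), t) : PhasePoint d))
          ((ContinuousLinearMap.inr ℝ ℝ (Fin d → ℝ)).prod 0) x₁ :=
        (hasFDerivAt_prodMk_right 0 x₁).prodMk (hasFDerivAt_const t x₁)
      rw [h3] at h2
      have h5 := h2.comp x₁ h4
      have h6 : HasFDerivAt (fun x => p ⬝ᵥ x) (∑ j, p j • ContinuousLinearMap.proj (R := ℝ)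
          (φ := fun _ : Fin d => ℝ) j) x₁ := by
        unfold dotProduct
        exact HasFDerivAt.fun_sum fun j _ => (hasFDerivAt_apply j x₁).const_mul (p j)
      have h7 : (W ∘ fun x : Fin d → ℝ => (((0, x), t) : PhasePoint d)) =ᶠ[𝓝 x₁]
          fun x => p ⬝ᵥ x := by
        filter_upwards [hM.mem_nhds hx₁] with x hx
        exact hW0 x hx t
      have h8 := congrArg (fun L => L (Pi.single i 1)) (h5.unique (h6.congr_of_eventuallyEq h7))
      simpa [spaceGrad, spaceDir, h3, Pi.single_apply] using h8
    simp only [δ, h1, hz0]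
    rw [smul_smul, one_div_mul_cancel ht.ne', one_smul, sub_self]
  -- With the Hamiltonian field taken at `gradPoint W (γ u)` instead of `z u`, everything except the
  -- derivative of the residual would cancel. The exchange costs `K t ‖δ u‖`, and this factor `t`
  -- compensates `1 / t`.
  have hbound : ∀ u ∈ Icc 0 t, ‖fderiv ℝ (spaceGrad W) (γ u) ((1 / t, (f (z u)).1), 0) -
      (1 / t) • (f (z u)).2‖ ≤ (K + d * (G * K)) * ‖δ u‖ + ε / t := fun u hu => by
    refine (pi_norm_le_iff_of_nonneg (by positivity)).2 fun i => ?_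
    rw [Pi.sub_apply, fderiv_spaceGrad_eq hM hU hH hW (hdom u hu)]
    set Y := fderiv ℝ (spaceGrad W) (γ u) (spaceDir i)
    have e1 : 1 / t * (fderiv ℝ (residual H W) (γ u) (spaceDir i) + (f (gradPoint W (γ u))).2 i -
        (γ u).2 * (Y ⬝ᵥ (f (gradPoint W (γ u))).1)) + Y ⬝ᵥ (f (z u)).1 - ((1 / t) • (f (z u)).2) i =
        1 / t * fderiv ℝ (residual H W) (γ u) (spaceDir i) +
        1 / t * (f (gradPoint W (γ u)) - f (z u)).2 i -
        Y ⬝ᵥ (f (gradPoint W (γ u)) - f (z u)).1 := by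
      simp only [hγ, Prod.snd_sub, Prod.fst_sub, Pi.sub_apply, dotProduct_sub, Pi.smul_apply,
        smul_eq_mul]
      field_simp
      ring
    have h2 := hff u hu
    set F := f (gradPoint W (γ u)) - f (z u)
    refine (congrArg norm e1).trans_le ?_
    have h3 : |F.2 i| ≤ K * (t * ‖δ u‖) :=
      ((norm_le_pi_norm F.2 i).trans (norm_snd_le F)).trans h2
    have h4 : |Y ⬝ᵥ F.1| ≤ d * (G * (K * (t * ‖δ u‖))) := by
      refine (abs_dotProduct_le _ _).trans ?_
      have := (norm_fst_le F).trans h2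
      have := hG' u hu i
      gcongr
    have h5 : |1 / t * fderiv ℝ (residual H W) (γ u) (spaceDir i)| ≤ ε / t := by
      rw [abs_mul, abs_of_pos (by positivity), one_div_mul_eq_div]
      exact div_le_div_of_nonneg_right (hR' u hu i) ht.le
    have h6 : |1 / t * F.2 i| ≤ K * ‖δ u‖ := by
      rw [abs_mul, abs_of_pos (by positivity), one_div_mul_eq_div, div_le_iff₀ ht]
      linarith
    have h7 : d * (G * (K * (t * ‖δ u‖))) ≤ d * (G * K) * ‖δ u‖ := by
      have : d * (G * (K * (t * ‖δ u‖))) = (d * (G * K) * ‖δ u‖) * t := by ring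
      rw [this]
      exact mul_le_of_le_one_right (by positivity) ht1
    rw [Real.norm_eq_abs]
    have h8 := abs_sub (1 / t * fderiv ℝ (residual H W) (γ u) (spaceDir i) + 1 / t * F.2 i)
      (Y ⬝ᵥ F.1)
    have h9 := abs_add_le (1 / t * fderiv ℝ (residual H W) (γ u) (spaceDir i)) (1 / t * F.2 i)
    linarith
  have hδ : ∀ u ∈ Icc 0 t, ‖δ u‖ ≤ 2 * ε := fun u hu => by
    have := norm_le_of_norm_deriv_le ht.le (by positivity) hsmall (by positivity) hδ' hδ0 hbound hu
    rwa [div_mul_cancel₀ _ ht.ne'] at this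
  -- the action
  let g : ℝ → ℝ := fun u => 1 / t * (residual H W (γ u) + H (gradPoint W (γ u)) - H (z u) +
    (t • δ u) ⬝ᵥ (f (z u)).1)
  -- By conservation of energy `H (x₁, t • p)` may be replaced by `H (z u)`. Then `g` collects the
  -- errors: the residual, and the effect of replacing `t ∇W` by the momentum in `H` and in the
  -- pairing with the velocity.
  have hΦ : ∀ u ∈ Icc 0 t, HasDerivWithinAt (fun u => W (γ u) - u / t * H (x₁, t • p))
      (g u - 1 / t * eulerDeriv H (z u)) (Icc 0 t) u := fun u hu => by
    have h1 : HasFDerivAt W (fderiv ℝ W (γ u)) (γ u) :=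
      ((hW.contDiffAt (hopen.mem_nhds (hdom u hu).1)).differentiableAt (by simp)).hasFDerivAt
    refine ((h1.comp_hasDerivWithinAt u (hγ' u hu)).fun_sub
      (((hasDerivWithinAt_id u (Icc 0 t)).div_const t).mul_const (H (x₁, t • p)))).congr_deriv ?_
    have h3 : (((1 / t, (f (z u)).1), 0) : PhasePoint d) =
      (1 / t) • ((1, 0), 0) + ((0, (f (z u)).1), 0) := by simp
    rw [h3, map_add, map_smul, fderiv_space_eq, smul_eq_mul]
    have h4 : fderiv ℝ W (γ u) ((1, 0), 0) = residual H W (γ u) + H (gradPoint W (γ u)) := by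
      simp [residual]
    rw [h4, ← hz0, ← hamiltonian_const hU hH (fun u hu => hBU (hzB u hu)) hz hu]
    have h5 : eulerDeriv H (z u) = -((z u).2 ⬝ᵥ (f (z u)).1) := fderiv_snd_eq _ _ _
    have h6 : t • δ u = t • spaceGrad W (γ u) - (z u).2 := by
      simp only [δ, smul_sub, smul_smul]
      rw [mul_one_div_cancel ht.ne', one_smul]
    simp only [g]
    rw [h5, h6, sub_dotProduct, smul_dotProduct, smul_eq_mul, dotProduct_comm (f (z u)).1]
    field_simp
    ring
  have hcz : ContinuousOn z (Icc 0 t) := fun u hu => (hz u hu).continuousWithinAt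
  have hmaps : MapsTo z (Icc 0 t) U := fun u hu => hBU (hzB u hu)
  have hcγ : ContinuousOn γ (Icc 0 t) := fun u hu => (hγ' u hu).continuousWithinAt
  have hmγ : MapsTo γ (Icc 0 t) (residualDomain M U W) := hdom
  have hcf : ContinuousOn (fun u => f (z u)) (Icc 0 t) :=
    (hamiltonianField_contDiffOn hU hH).continuousOn.comp hcz hmaps
  have hdot : ∀ {a b : ℝ → Fin d → ℝ}, ContinuousOn a (Icc 0 t) → ContinuousOn b (Icc 0 t) →
      ContinuousOn (fun u => a u ⬝ᵥ b u) (Icc 0 t) := fun ha hb =>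
    (continuous_fst.dotProduct continuous_snd).comp_continuousOn (ha.prodMk hb)
  have hcE : ContinuousOn (fun u => eulerDeriv H (z u)) (Icc 0 t) := by
    have h5 : ∀ u, eulerDeriv H (z u) = -((z u).2 ⬝ᵥ (f (z u)).1) := fun u => fderiv_snd_eq _ _ _
    simp only [h5]
    exact (hdot hcz.snd hcf.fst).neg
  have hcg : ContinuousOn g (Icc 0 t) := by
    have h1 : ContinuousOn (fun u => residual H W (γ u)) (Icc 0 t) :=
      (residual_contDiffOn hM hH hW).continuousOn.comp hcγ hmγ
    have h2 : ContinuousOn (fun u => H (gradPoint W (γ u))) (Icc 0 t) :=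
      hH.continuousOn.comp ((gradPoint_contDiffOn hM hW).continuousOn.comp hcγ
        fun u hu => (hdom u hu).1) fun u hu => (hdom u hu).2
    have h3 : ContinuousOn (fun u => H (z u)) (Icc 0 t) := hH.continuousOn.comp hcz hmaps
    have h4 : ContinuousOn δ (Icc 0 t) := fun u hu => (hδ' u hu).continuousWithinAt
    exact continuousOn_const.mul (((h1.add h2).sub h3).add (hdot (h4.const_smul t) hcf.fst))
  have hgb : ∀ u ∈ Icc 0 t, ‖g u‖ ≤ ε * (1 + 2 * K' + d * (2 * A)) / t := fun u hu => by
    have h1 : |H (gradPoint W (γ u)) - H (z u)| ≤ K' * (2 * ε) := by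
      have h2 := hlip'.norm_sub_le (hgrad u hu) (hzB u hu)
      rw [hnorm, Real.norm_eq_abs] at h2
      have h3 : t * ‖δ u‖ ≤ 2 * ε :=
        (mul_le_of_le_one_left (norm_nonneg _) ht1).trans (hδ u hu)
      exact h2.trans (mul_le_mul_of_nonneg_left h3 K'.2)
    have h2 : |(t • δ u) ⬝ᵥ (f (z u)).1| ≤ d * (2 * ε * A) := by
      refine (abs_dotProduct_le _ _).trans ?_
      have h3 : ‖t • δ u‖ ≤ 2 * ε := by
        rw [norm_smul, Real.norm_of_nonneg ht.le]
        exact (mul_le_of_le_one_left (norm_nonneg _) ht1).trans (hδ u hu)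
      have h4 := (norm_fst_le _).trans (hA _ (hzB u hu))
      gcongr
    have h3 := hR u hu
    simp only [g]
    rw [Real.norm_eq_abs, abs_mul, abs_of_pos (by positivity), one_div_mul_eq_div]
    refine div_le_div_of_nonneg_right ?_ ht.le
    have h4 : residual H W (γ u) + H (gradPoint W (γ u)) - H (z u) + (t • δ u) ⬝ᵥ (f (z u)).1 =
      residual H W (γ u) + (H (gradPoint W (γ u)) - H (z u)) + (t • δ u) ⬝ᵥ (f (z u)).1 := by ring
    rw [h4]
    refine (abs_add_three _ _ _).trans ?_
    have h5 : |residual H W (γ u)| ≤ ε := h3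
    linarith
  have hint := intervalIntegral.integral_eq_sub_of_hasDeriv_right_of_le ht.le
    (fun u hu => (hΦ u hu).continuousWithinAt)
    (fun u hu => (hΦ u (Ioo_subset_Icc_self hu)).mono_of_mem_nhdsWithin
      (Icc_mem_nhdsGT_of_mem ⟨hu.1.le, hu.2⟩))
    ((hcg.sub (hcE.const_mul (1 / t))).intervalIntegrable_of_Icc ht.le)
  rw [intervalIntegral.integral_sub (hcg.intervalIntegrable_of_Icc ht.le)
    ((hcE.const_mul (1 / t)).intervalIntegrable_of_Icc ht.le),
    intervalIntegral.integral_const_mul (1 / t) fun u => eulerDeriv H (z u)] at hint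
  have hγt : γ t = ((1, (z t).1), t) := by simp [hγ, ht.ne']
  have hγ0 : W (γ 0) = p ⬝ᵥ x₁ := by simp [hγ, hz0, hW0 x₁ hx₁]
  simp only [hγt, hγ0, zero_div, zero_mul, sub_zero, div_self ht.ne', one_mul] at hint
  have hfin : W ((1, (z t).1), t) - (p ⬝ᵥ x₁ + H (x₁, t • p) -
      1 / t * ∫ u in (0 : ℝ)..t, eulerDeriv H (z u)) = ∫ u in (0 : ℝ)..t, g u := by
    linarith
  rw [hfin]
  have := intervalIntegral.norm_integral_le_of_norm_le_const (a := 0) (b := t)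
    (f := g) (C := ε * (1 + 2 * K' + d * (2 * A)) / t) fun u hu => by
      rw [uIoc_of_le ht.le] at hu
      exact hgb u (Ioc_subset_Icc_self hu)
  rwa [sub_zero, abs_of_pos ht, div_mul_cancel₀ _ ht.ne'] at this

end HamiltonJacobi

end TreeExpansion

end

noncomputable section

namespace TreeExpansion

/-! ### Uniform residual bounds and short trajectories -/

section HamiltonJacobi

open Set Filter Topology

section Flat

variable {Y : Type*} [NormedAddCommGroup Y] [NormedSpace ℝ Y] {O : Set (Y × ℝ)} {F : Y × ℝ → ℝ}
  {K V : Set Y} {N : ℕ}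

theorem bound_of_coeff_tay_eq_zero (hO : IsOpen O) (hF : ContDiffOn ℝ ∞ F (slab O))
    (hK : IsCompact K) (hKO : ∀ y ∈ K, (y, (0 : ℝ)) ∈ O)
    (h : ∀ y ∈ K, ∀ n ≤ N, PowerSeries.coeff n (tay fun t => F (y, t)) = 0) :
    ∃ C : ℝ, 0 ≤ C ∧ ∀ᶠ t in 𝓝[>] (0 : ℝ), ∀ y ∈ K, (y, t) ∈ slab O ∧
      |F (y, t)| ≤ C * t ^ (N + 1) := by
  obtain ⟨C, hC0, hC⟩ := uniform_taylor hO hF hK hKO N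
  refine ⟨C, hC0, hC.mono fun t ht y hy => ⟨(ht y hy).1, ?_⟩⟩
  have h1 := (ht y hy).2
  rwa [Finset.sum_eq_zero fun n hn => by
    rw [h y hy n (Nat.lt_succ_iff.1 (Finset.mem_range.1 hn)), mul_zero], sub_zero] at h1

/-- Pointwise smallness of a smooth function as `t → 0` is uniform on compact sets, and carries
over to the derivatives with respect to the parameters. -/
theorem uniform_bound_of_isBigO (hO : IsOpen O) (hF : ContDiffOn ℝ ∞ F O) (hK : IsCompact K)
    (hV : IsOpen V) (hKV : K ⊆ V) (hVO : ∀ y ∈ V, (y, (0 : ℝ)) ∈ O)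
    (h : ∀ y ∈ V, (fun t => F (y, t)) =O[𝓝[>] 0] fun t : ℝ => t ^ (N + 1))
    {ι : Type*} [Fintype ι] (v : ι → Y) :
    ∃ C : ℝ, 0 ≤ C ∧ ∀ᶠ t in 𝓝[>] (0 : ℝ), ∀ y ∈ K, (y, t) ∈ O ∧ |F (y, t)| ≤ C * t ^ (N + 1) ∧
      ∀ i, |fderiv ℝ F (y, t) (v i, 0)| ≤ C * t ^ (N + 1) := by
  have hF' : ContDiffOn ℝ ∞ F (slab O) := hF.mono inter_subset_left
  have h0 : ∀ n ≤ N, ∀ y ∈ V, PowerSeries.coeff n (tay fun t => F (y, t)) = 0 := fun n hn y hy =>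
    coeff_tay_eq_zero_of_isBigO hO hF' (hVO y hy) (h y hy) hn
  have hKO : ∀ y ∈ K, (y, (0 : ℝ)) ∈ O := fun y hy => hVO y (hKV hy)
  obtain ⟨C, hC0, hC⟩ := bound_of_coeff_tay_eq_zero hO hF' hK hKO fun y hy n hn =>
    h0 n hn y (hKV hy)
  have h1 : ∀ i, ∃ C : ℝ, 0 ≤ C ∧ ∀ᶠ t in 𝓝[>] (0 : ℝ), ∀ y ∈ K, (y, t) ∈ slab O ∧
      |slabDeriv O (v i, 0) F (y, t)| ≤ C * t ^ (N + 1) := fun i =>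
    bound_of_coeff_tay_eq_zero hO (slabDeriv_contDiffOn hO hF' _) hK hKO fun y hy n hn =>
      coeff_tay_slabDeriv_eq_zero hO hF' hV hVO (h0 n hn) (v i) (hKV hy)
  choose C' hC0' hC' using h1
  refine ⟨C + ∑ i, C' i, add_nonneg hC0 (Finset.sum_nonneg fun i _ => hC0' i), ?_⟩
  filter_upwards [hC, eventually_all.2 hC', self_mem_nhdsWithin] with t ht ht' (ht0 : 0 < t) y hy
  have hz := (ht y hy).1
  refine ⟨hz.1, (ht y hy).2.trans ?_, fun i => ?_⟩
  · have := Finset.sum_nonneg fun i (_ : i ∈ Finset.univ) => hC0' i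
    gcongr
    linarith
  · have h2 : DifferentiableAt ℝ F (y, t) :=
      (hF.contDiffAt (hO.mem_nhds hz.1)).differentiableAt (by simp)
    rw [← h2.fderivWithin (uniqueDiffOn_slab hO _ hz)]
    refine (ht' i y hy).2.trans ?_
    have := Finset.single_le_sum (fun i _ => hC0' i) (Finset.mem_univ i)
    gcongr
    linarith

end Flat

theorem eventually_mul_le (c : ℝ) {b : ℝ} (hb : 0 < b) : ∀ᶠ t in 𝓝[>] (0 : ℝ), c * t ≤ b := by
  have h : Tendsto (fun t : ℝ => c * t) (𝓝 0) (𝓝 (c * 0)) :=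
    (continuous_const.mul continuous_id).tendsto 0
  rw [mul_zero] at h
  exact (h.mono_left nhdsWithin_le_nhds).eventually (eventually_le_nhds hb)

variable {d : ℕ} {M : Set (Fin d → ℝ)} {U : Set ((Fin d → ℝ) × (Fin d → ℝ))}
  {H : (Fin d → ℝ) × (Fin d → ℝ) → ℝ} {W : PhasePoint d → ℝ}

/-- On a small ball around `(x₁, 0)` the function `H` and its field are Lipschitz and the field is
bounded, so for small `t` a trajectory from `(x₁, t • p)` exists up to time `t` and moves by `O(t)`.
The residual is uniformly small over the compact set of relevant `(s, x)`, and `action_estimate`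
applies with `ε = C * t ^ (N + 1)`. -/
theorem exists_trajectory (hM : IsOpen M) (hU : IsOpen U) (hbase : ∀ z ∈ U, z.1 ∈ M)
    (hzero : ∀ x ∈ M, (x, 0) ∈ U) (hH : ContDiffOn ℝ ∞ H U)
    (hW : ContDiffOn ℝ ∞ W {z | z.1.2 ∈ M}) {p x₁ : Fin d → ℝ} (hx₁ : x₁ ∈ M)
    (hW0 : ∀ x ∈ M, ∀ t, W ((0, x), t) = p ⬝ᵥ x) {N : ℕ}
    (hres : ∀ s, ∀ x ∈ M, (fun t => residual H W ((s, x), t)) =O[𝓝[>] 0]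
      fun t : ℝ => t ^ (N + 1)) :
    ∃ C : ℝ, ∀ᶠ t in 𝓝[>] (0 : ℝ), ∃ z : ℝ → (Fin d → ℝ) × (Fin d → ℝ),
      z 0 = (x₁, t • p) ∧ (∀ u ∈ Icc 0 t, z u ∈ U) ∧
      IsIntegralCurveOn z (fun _ => hamiltonianField H) (Icc 0 t) ∧ ‖(z t).1 - x₁‖ ≤ C * t ∧
      |W ((1, (z t).1), t) - (p ⬝ᵥ x₁ + H (x₁, t • p) -
        1 / t * ∫ u in (0 : ℝ)..t, eulerDeriv H (z u))| ≤ C * t ^ (N + 1) := by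
  have hz₀ : U ∈ 𝓝 ((x₁, 0) : (Fin d → ℝ) × (Fin d → ℝ)) := hU.mem_nhds (hzero x₁ hx₁)
  set f := hamiltonianField H with hf
  have hfd : ContDiffAt ℝ ∞ f (x₁, 0) := (hamiltonianField_contDiffOn hU hH).contDiffAt hz₀
  obtain ⟨K, s, hs, hlip⟩ := (hfd.of_le (by simp) : ContDiffAt ℝ 1 f (x₁, 0)).exists_lipschitzOnWith
  obtain ⟨K', s', hs', hlip'⟩ :=
    ((hH.contDiffAt hz₀).of_le (by simp) : ContDiffAt ℝ 1 H (x₁, 0)).exists_lipschitzOnWith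
  have hbd : {z | ‖f z‖ ≤ ‖f (x₁, 0)‖ + 1} ∈ 𝓝 ((x₁, 0) : (Fin d → ℝ) × (Fin d → ℝ)) :=
    hfd.continuousAt.norm.eventually (eventually_le_nhds (lt_add_one _))
  set A := ‖f (x₁, 0)‖ + 1
  have hA0 : 0 ≤ A := by positivity
  obtain ⟨ρ, hρ, hρs⟩ := Metric.nhds_basis_closedBall.mem_iff.1
    (inter_mem (inter_mem hs hs') (inter_mem hz₀ hbd))
  set B := Metric.closedBall ((x₁, 0) : (Fin d → ℝ) × (Fin d → ℝ)) ρ with hB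
  have hmemB : ∀ x q, (x, q) ∈ B ↔ ‖x - x₁‖ ≤ ρ ∧ ‖q‖ ≤ ρ := fun x q => by
    rw [hB, mem_closedBall_iff_norm, Prod.mk_sub_mk, sub_zero, Prod.norm_mk, max_le_iff]
  have hBU : B ⊆ U := fun z hz => (hρs hz).2.1
  have hBM : ∀ x ∈ Metric.closedBall x₁ ρ, x ∈ M := fun x hx => by
    rw [mem_closedBall_iff_norm] at hx
    exact hbase (x, 0) (hBU ((hmemB _ _).2 ⟨hx, by simpa using hρ.le⟩))
  have hA : ∀ z ∈ B, ‖f z‖ ≤ A := fun z hz => (hρs hz).2.2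
  have hKc : IsCompact (Icc (0 : ℝ) 1 ×ˢ Metric.closedBall x₁ ρ) :=
    isCompact_Icc.prod (isCompact_closedBall _ _)
  have hopen := isOpen_space (d := d) hM
  have hQ := spaceGrad_contDiffOn hM hW
  have hsub : (Icc (0 : ℝ) 1 ×ˢ Metric.closedBall x₁ ρ) ×ˢ Icc (0 : ℝ) 1 ⊆
    {z : PhasePoint d | z.1.2 ∈ M} := fun z hz => hBM _ hz.1.2
  obtain ⟨Q, hQb⟩ := (hKc.prod isCompact_Icc).exists_bound_of_continuousOn
    (hQ.continuousOn.mono hsub)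
  obtain ⟨G, hGb⟩ := (hKc.prod isCompact_Icc).exists_bound_of_continuousOn
    ((hQ.fderiv_of_isOpen hopen (m := ∞) (by simp)).continuousOn.mono hsub)
  obtain ⟨C, hC0, hC⟩ := uniform_bound_of_isBigO (V := {y : ℝ × (Fin d → ℝ) | y.2 ∈ M})
    (isOpen_residualDomain hM hU hW) (residual_contDiffOn hM hH hW) hKc
    (hM.preimage continuous_snd) (fun y hy => hBM _ hy.2)
    (fun y hy => ⟨hy, by simpa [gradPoint] using hzero _ hy⟩) (fun y hy => hres y.1 y.2 hy)
    (fun i : Fin d => (0, Pi.single i 1))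
  refine ⟨A + C * (1 + 2 * K' + d * (2 * A)), ?_⟩
  -- The smallness conditions on `t` are, in turn: `t ≤ 1`, absorption in the estimate of `δ`, `t
  -- ∇W` within the ball, and the trajectory within the ball.
  filter_upwards [hC, self_mem_nhdsWithin, eventually_mul_le 1 one_pos,
    eventually_mul_le (K + d * (|G| * K)) (one_half_pos (α := ℝ)), eventually_mul_le Q hρ,
    eventually_mul_le (‖p‖ + A) hρ] with t hCt (ht : 0 < t) ht1 htK htQ htA
  rw [one_mul] at ht1
  obtain ⟨z, hz0, hzB, hz⟩ := exists_isIntegralCurveOn (f := f) (z₀ := ((x₁, 0) :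
    (Fin d → ℝ) × (Fin d → ℝ))) (z₁ := (x₁, t • p)) hA0 hA
    (hlip.mono fun z hz => (hρs hz).1.1) ht.le (by
      rw [Prod.mk_sub_mk, sub_self, sub_zero, Prod.norm_mk, norm_zero, norm_smul,
        Real.norm_of_nonneg ht.le, max_eq_right (by positivity)]
      linarith)
  have hy : ∀ u ∈ Icc 0 t, (u / t, (z u).1) ∈ Icc (0 : ℝ) 1 ×ˢ Metric.closedBall x₁ ρ :=
    fun u hu => ⟨⟨div_nonneg hu.1 ht.le, div_le_one_of_le₀ hu.2 ht.le⟩, by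
      rw [mem_closedBall_iff_norm]
      exact ((hmemB (z u).1 (z u).2).1 (hzB u hu)).1⟩
  have hyt : ∀ u ∈ Icc 0 t, ((u / t, (z u).1), t) ∈
      (Icc (0 : ℝ) 1 ×ˢ Metric.closedBall x₁ ρ) ×ˢ Icc (0 : ℝ) 1 :=
    fun u hu => ⟨hy u hu, ht.le, ht1⟩
  have hest := action_estimate (ε := C * t ^ (N + 1)) (G := |G|) hM hU hH hW hx₁ hW0 hBU
    (hlip.mono fun z hz => (hρs hz).1.1) (hlip'.mono fun z hz => (hρs hz).1.2) hA (abs_nonneg G)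
    (by positivity) ht ht1 htK hz0 hzB hz (fun u hu => (hCt _ (hy u hu)).1)
    (fun u hu => (hmemB _ _).2 ⟨mem_closedBall_iff_norm.1 (hy u hu).2, by
      rw [norm_smul, Real.norm_of_nonneg ht.le]
      exact (mul_le_mul_of_nonneg_left (hQb _ (hyt u hu)) ht.le).trans (by linarith)⟩)
    (fun u hu => (hCt _ (hy u hu)).2.1) (fun u hu i => (hCt _ (hy u hu)).2.2 i)
    (fun u hu i => by
      refine (ContinuousLinearMap.le_opNorm _ _).trans ?_
      have h1 : ‖(spaceDir i : PhasePoint d)‖ ≤ 1 := by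
        simp [spaceDir, Prod.norm_def, Pi.norm_single]
      exact (mul_le_of_le_one_right (norm_nonneg _) h1).trans
        ((hGb _ (hyt u hu)).trans (le_abs_self G)))
  have hC' : 0 ≤ C * (1 + 2 * K' + d * (2 * A)) := by positivity
  refine ⟨z, hz0, fun u hu => hBU (hzB u hu), hz, ?_, hest.trans ?_⟩
  · have h1 := norm_image_sub_le_of_norm_deriv_le_segment' (C := A) hz
      (fun u hu => hA _ (hzB u (Ico_subset_Icc_self hu))) t (right_mem_Icc.2 ht.le)
    rw [hz0, sub_zero] at h1
    exact ((norm_fst_le (z t - (x₁, t • p))).trans h1).trans (by nlinarith)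
  · have h1 : 0 ≤ A * t ^ (N + 1) := by positivity
    nlinarith

end HamiltonJacobi

end TreeExpansion

end

noncomputable section

namespace TreeExpansion

/-! ## The tree series solves the Hamilton-Jacobi equation -/

open Set Filter Topology

theorem NRT.isEmpty_zero : IsEmpty (NRT 0) :=
  ⟨fun ρ => Quotient.inductionOn ρ fun ρ => ρ.skeleton.root.1.elim0⟩

theorem combination_scale {m : ℕ} (w : NRT m → CoeffPoly) (c : (Σ m, TopTree m) → ℝ)
    (e : Background) (s : ℝ) (x : Fin e.d → ℝ) :
    combination w c (e.scale s) x = ∑ ρ, MvPolynomial.aeval c (w ρ) *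
      (s ^ ρ.componentCount * ρ.symbol e.π e.q₁ e.q₂ x) :=
  Finset.sum_congr rfl fun ρ _ => congrArg _ (ρ.symbol_smul e.π e.q₁ e.q₂ s x)

/-- The truncation of the tree series, as a function of `((s, x), t)`; the scalar `s` multiplies
`q₂`. -/
def treeSeries (N : ℕ) (c : (Σ m, TopTree m) → ℝ) (e : Background) (z : PhasePoint e.d) : ℝ :=
  (e.q₁ + z.1.1 • e.q₂) ⬝ᵥ z.1.2 +
    ∑ m ∈ Finset.range (N + 1), z.2 ^ m * combination (treeCoeff m) c (e.scale z.1.1) z.1.2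

variable {N : ℕ} {c : (Σ m, TopTree m) → ℝ} {e : Background}

theorem treeSeries_contDiffOn : ContDiffOn ℝ ∞ (treeSeries N c e) {z | z.1.2 ∈ e.M} := by
  unfold treeSeries
  simp only [combination_scale, dotProduct]
  refine ContDiffOn.add ?_ (ContDiffOn.sum fun m _ => ContDiffOn.mul (by fun_prop)
    (ContDiffOn.sum fun ρ _ => contDiffOn_const.mul (ContDiffOn.mul (by fun_prop)
      ((ρ.symbol_contDiffOn e).comp (by fun_prop) fun z hz => hz))))
  simp only [Pi.add_apply, Pi.smul_apply, smul_eq_mul]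
  exact ContDiffOn.sum fun i _ => by fun_prop

/-- Each network has at least one component, so its symbol contains a positive power of `s`. -/
theorem treeSeries_zero (x : Fin e.d → ℝ) (t : ℝ) : treeSeries N c e ((0, x), t) = e.q₁ ⬝ᵥ x := by
  simp only [treeSeries, combination_scale, zero_smul, add_zero]
  rw [Finset.sum_eq_zero fun m _ => ?_, add_zero]
  rw [Finset.sum_eq_zero fun ρ _ => ?_, mul_zero]
  rw [zero_pow ρ.componentCount_pos.ne', zero_mul, mul_zero]

theorem treeSeries_hasFDerivAt {z : PhasePoint e.d} (hz : z.1.2 ∈ e.M) :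
    HasFDerivAt (treeSeries N c e) (fderiv ℝ (treeSeries N c e) z) z :=
  ((treeSeries_contDiffOn.contDiffAt
    ((isOpen_space e.isOpen).mem_nhds hz)).differentiableAt (by simp)).hasFDerivAt

theorem fderiv_treeSeries_scale (s t : ℝ) {x : Fin e.d → ℝ} (hx : x ∈ e.M) :
    fderiv ℝ (treeSeries N c e) ((s, x), t) ((1, 0), 0) =
      e.q₂ ⬝ᵥ x + ∑ m ∈ Finset.range (N + 1), t ^ m * combinationDeriv m c e s x := by
  have h1 : HasDerivAt (fun s : ℝ => (((s, x), t) : PhasePoint e.d)) ((1, 0), 0) s :=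
    ((hasDerivAt_id s).prodMk (hasDerivAt_const s x)).prodMk (hasDerivAt_const s t)
  have h2 := (treeSeries_hasFDerivAt (N := N) (c := c) (z := ((s, x), t)) hx).comp_hasDerivAt s h1
  refine h2.unique ?_
  have h3 : treeSeries N c e ∘ (fun s : ℝ => (((s, x), t) : PhasePoint e.d)) =
      fun s => (e.q₁ ⬝ᵥ x + s * (e.q₂ ⬝ᵥ x)) + ∑ m ∈ Finset.range (N + 1), t ^ m *
        ∑ ρ : NRT m, MvPolynomial.aeval c (treeCoeff m ρ) *
          (s ^ ρ.componentCount * ρ.symbol e.π e.q₁ e.q₂ x) := by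
    funext s
    simp only [Function.comp_apply, treeSeries, combination_scale, add_dotProduct, smul_dotProduct,
      smul_eq_mul]
  rw [h3]
  refine HasDerivAt.fun_add ?_ (HasDerivAt.fun_sum fun m _ => HasDerivAt.const_mul _
    (HasDerivAt.fun_sum fun ρ _ => HasDerivAt.const_mul _
      ((hasDerivAt_pow ρ.componentCount s).mul_const _)))
  simpa using ((hasDerivAt_id s).mul_const (e.q₂ ⬝ᵥ x)).const_add (e.q₁ ⬝ᵥ x)

theorem spaceGrad_treeSeries (s t : ℝ) {x : Fin e.d → ℝ} (hx : x ∈ e.M) :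
    spaceGrad (treeSeries N c e) ((s, x), t) = fun i =>
      ∑ n ∈ Finset.range (N + 1), t ^ n * leg treeCoeff n c (e.scale s) x i := by
  funext i
  have h1 : HasFDerivAt (fun x : Fin e.d → ℝ => (((s, x), t) : PhasePoint e.d))
      ((ContinuousLinearMap.inr ℝ ℝ (Fin e.d → ℝ)).prod 0) x :=
    (hasFDerivAt_prodMk_right s x).prodMk (hasFDerivAt_const t x)
  have h2 := (treeSeries_hasFDerivAt (N := N) (c := c) (z := ((s, x), t)) hx).comp x h1
  have h3 : ∀ m, HasFDerivAt (combination (treeCoeff m) c (e.scale s))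
      (fderiv ℝ (combination (treeCoeff m) c (e.scale s)) x) x := fun m => by
    refine (differentiableAt_of_contDiffOn (O := e.M) e.isOpen ?_ hx).hasFDerivAt
    unfold combination
    exact ContDiffOn.sum fun ρ _ => contDiffOn_const.mul (ρ.symbol_contDiffOn (e.scale s))
  have h4 : HasFDerivAt (fun x => (e.q₁ + s • e.q₂) ⬝ᵥ x) (∑ j, (e.q₁ + s • e.q₂) j •
      ContinuousLinearMap.proj (R := ℝ) (φ := fun _ : Fin e.d => ℝ) j) x := by
    unfold dotProduct
    exact HasFDerivAt.fun_sum fun j _ => (hasFDerivAt_apply j x).const_mul _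
  have h5 := congrArg (fun L => L (Pi.single i 1)) (h2.unique
    (h4.fun_add (HasFDerivAt.fun_sum fun m (_ : m ∈ Finset.range (N + 1)) =>
      (h3 m).const_mul (t ^ m))))
  have h6 : spaceGrad (treeSeries N c e) ((s, x), t) i = (e.q₁ + s • e.q₂) i +
      ∑ m ∈ Finset.range (N + 1), t ^ m *
        pderiv i (combination (treeCoeff m) c (e.scale s)) x := by
    simpa [spaceGrad, spaceDir, Pi.single_apply, pderiv] using h5
  -- There is no network without vertices, so degree `0` contains only the linear term, as in `leg`.
  have h7 : pderiv i (combination (treeCoeff 0) c (e.scale s)) x = 0 := by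
    have h8 : combination (treeCoeff 0) c (e.scale s) = fun _ => 0 := by
      have := NRT.isEmpty_zero
      funext x
      exact Finset.sum_of_isEmpty _
    rw [h8, pderiv]
    simp
  rw [h6, Finset.sum_range_succ', Finset.sum_range_succ', h7]
  simp only [leg, Nat.succ_ne_zero, if_false, if_true, mul_zero, add_zero, pow_zero, one_mul]
  rw [add_comm]

variable {U : Set ((Fin e.d → ℝ) × (Fin e.d → ℝ))}
  {α : (Fin e.d → ℝ) × (Fin e.d → ℝ) → (Fin e.d → ℝ)}

/-- The given expansion is for a fixed covector, while here `Q t` varies with `t`. The Taylor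
remainder is uniform for covectors in the compact set `Q '' [0, 1]`, which permits the substitution.
-/
theorem IsButcherMap.isBigO (hα : IsButcherMap c e.M e.π U α) {x : Fin e.d → ℝ} (hx : x ∈ e.M)
    {Q : ℝ → Fin e.d → ℝ} (hQ : Continuous Q) (N : ℕ) (j : Fin e.d) :
    (fun t => α (x, t • Q t) j - (x j + ∑ r ∈ Finset.range (N + 1), t ^ r * ∑ τ : TopTree r,
      c ⟨r, τ⟩ / (τ.symmetry : ℝ) * τ.elemDiff j (sprayField e.π (Q t)) x)) =O[𝓝[>] 0]
      fun t : ℝ => t ^ (N + 1) := by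
  let O : Set ((Fin e.d → ℝ) × ℝ) := {y | (x, y.2 • y.1) ∈ U}
  have hO : IsOpen O := hα.isOpen.preimage (by fun_prop)
  have hF : ContDiffOn ℝ ∞ (fun y : (Fin e.d → ℝ) × ℝ => α (x, y.2 • y.1) j) (slab O) :=
    ((contDiffOn_pi.1 hα.smooth j).comp (t := U) (f := fun y : (Fin e.d → ℝ) × ℝ =>
      (x, y.2 • y.1)) (by fun_prop) (fun y hy => hy)).mono inter_subset_left
  obtain ⟨C, -, hC⟩ := uniform_taylor hO hF (isCompact_Icc.image hQ : IsCompact (Q '' Icc 0 1))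
    (fun y _ => by simpa [O] using hα.zero_mem x hx) N
  refine Asymptotics.IsBigO.of_bound C ?_
  filter_upwards [hC, Ioc_mem_nhdsGT zero_lt_one] with t ht ht1
  rw [Real.norm_of_nonneg (pow_pos ht1.1 _).le]
  refine Eq.trans_le ?_ (ht (Q t) ⟨t, ⟨ht1.1.le, ht1.2⟩, rfl⟩).2
  rw [Real.norm_eq_abs]
  congr 2
  simp only [hα.expansion x hx, map_add, PowerSeries.coeff_mk, mul_add, Finset.sum_add_distrib]
  congr 1
  rw [Finset.sum_range_succ']
  simp [PowerSeries.coeff_succ_C]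

/-- Two errors add up: replacing `α` by its truncated Butcher series at `Q t = ∇W`, and replacing
that by its parts of degree at most `N`. These parts are the coefficients of `∂_s W`, by the
recursion. -/
theorem isBigO_residual (hα : IsButcherMap c e.M e.π U α) (N : ℕ) (s : ℝ) {x : Fin e.d → ℝ}
    (hx : x ∈ e.M) :
    (fun t => residual (fun w => e.q₂ ⬝ᵥ α w) (treeSeries N c e) ((s, x), t)) =O[𝓝[>] 0]
      fun t : ℝ => t ^ (N + 1) := by
  let Q : ℝ → Fin e.d → ℝ := fun t i =>
    ∑ n ∈ Finset.range (N + 1), t ^ n * leg treeCoeff n c (e.scale s) x i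
  have hQ : Continuous Q := by
    refine continuous_pi fun i => continuous_finsetSum _ fun n _ => ?_
    fun_prop
  have h1 : (fun t => ∑ j, e.q₂ j * (α (x, t • Q t) j - (x j + ∑ r ∈ Finset.range (N + 1),
      t ^ r * ∑ τ : TopTree r, c ⟨r, τ⟩ / (τ.symmetry : ℝ) *
        τ.elemDiff j (sprayField e.π (Q t)) x))) =O[𝓝[>] 0] fun t : ℝ => t ^ (N + 1) :=
    Asymptotics.IsBigO.fun_sum fun j _ => (hα.isBigO hx hQ N j).const_mul_left _
  have h2 := (butcher_expansion N c e (fun n i => leg treeCoeff n c (e.scale s) x i) hx).mono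
    (nhdsWithin_le_nhds (s := Ioi (0 : ℝ)))
  refine ((h1.add h2).neg_left).congr_left fun t => ?_
  simp only [residual, gradPoint, fderiv_treeSeries_scale s t hx, spaceGrad_treeSeries s t hx,
    combinationDeriv_eq _ _ _ _ hx]
  have h3 : ∀ r, ∑ j, e.q₂ j * (t ^ r * ∑ τ : TopTree r, c ⟨r, τ⟩ / (τ.symmetry : ℝ) *
      τ.elemDiff j (sprayField e.π (Q t)) x) = t ^ r * ∑ τ : TopTree r,
      c ⟨r, τ⟩ / (τ.symmetry : ℝ) * ∑ u, e.q₂ u * τ.elemDiff u (sprayField e.π (Q t)) x := by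
    intro r
    simp only [Finset.mul_sum]
    rw [Finset.sum_comm]
    exact Finset.sum_congr rfl fun τ _ => Finset.sum_congr rfl fun j _ => by ring
  have h4 : ∑ j, e.q₂ j * (α (x, t • Q t) j - (x j + ∑ r ∈ Finset.range (N + 1),
      t ^ r * ∑ τ : TopTree r, c ⟨r, τ⟩ / (τ.symmetry : ℝ) *
        τ.elemDiff j (sprayField e.π (Q t)) x)) = e.q₂ ⬝ᵥ α (x, t • Q t) - e.q₂ ⬝ᵥ x -
      ∑ r ∈ Finset.range (N + 1), t ^ r * ∑ τ : TopTree r,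
      c ⟨r, τ⟩ / (τ.symmetry : ℝ) * ∑ u, e.q₂ u * τ.elemDiff u (sprayField e.π (Q t)) x := by
    simp only [← h3]
    rw [Finset.sum_comm]
    simp only [← Finset.mul_sum, mul_sub, mul_add, Finset.sum_sub_distrib, Finset.sum_add_distrib,
      dotProduct]
    ring
  rw [h4]
  simp only [Q]
  ring

end TreeExpansion

end

noncomputable section

/-! ### Comparison of the generating family with the tree series -/

namespace TreeExpansion

open Set Filter Topology

/-- A coefficient of the expansion of the generating function. -/
def seriesCoeff (c : (Σ m, TopTree m) → ℝ) (e : Background) (n : ℕ) (x : Fin e.d → ℝ) : ℝ :=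
  PowerSeries.coeff n (PowerSeries.C ((e.q₁ + e.q₂) ⬝ᵥ x) + PowerSeries.mk fun m =>
    combination (treeCoeff m) c e x)

theorem seriesCoeff_continuousOn (c : (Σ m, TopTree m) → ℝ) (e : Background) (n : ℕ) :
    ContinuousOn (seriesCoeff c e n) e.M := by
  have h : ContinuousOn (combination (treeCoeff n) c e) e.M :=
    continuousOn_finsetSum _ fun ρ _ =>
      continuousOn_const.mul (ρ.symbol_contDiffOn e).continuousOn
  unfold seriesCoeff
  simp only [map_add, PowerSeries.coeff_mk, PowerSeries.coeff_C]
  refine ContinuousOn.add ?_ h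
  split_ifs
  · exact (continuous_const.dotProduct continuous_id).continuousOn
  · exact continuousOn_const

theorem treeSeries_one (N : ℕ) (c : (Σ m, TopTree m) → ℝ) (e : Background) (x : Fin e.d → ℝ)
    (t : ℝ) : treeSeries N c e ((1, x), t) =
      ∑ n ∈ Finset.range (N + 1), t ^ n * seriesCoeff c e n x := by
  simp only [seriesCoeff, map_add, PowerSeries.coeff_mk, mul_add, Finset.sum_add_distrib,
    treeSeries, one_smul, combination_scale, one_pow, one_mul]
  refine congrArg₂ _ ?_ rfl
  rw [Finset.sum_range_succ']
  simp [PowerSeries.coeff_succ_C]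

variable {c : (Σ m, TopTree m) → ℝ} {e : Background} {U : Set ((Fin e.d → ℝ) × (Fin e.d → ℝ))}
  {α : (Fin e.d → ℝ) × (Fin e.d → ℝ) → (Fin e.d → ℝ)}
  {Ω : Set (((Fin e.d → ℝ) × (Fin e.d → ℝ) × (Fin e.d → ℝ)) × ℝ)}
  {S : ((Fin e.d → ℝ) × (Fin e.d → ℝ) × (Fin e.d → ℝ)) × ℝ → ℝ}

/-- `y t` is the endpoint of the trajectory from `(x₁, t • q₁)`, where the formula for `S` applies;
as it stays within `O(t)` of `x₁`, the points in question lie in `Ω` for small `t`. -/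
theorem IsGeneratedFamily.exists_close (hα : IsButcherMap c e.M e.π U α)
    (hS : IsGeneratedFamily e.M U α Ω S) (N : ℕ) {x₁ : Fin e.d → ℝ}
    (hx₁ : ((e.q₁, e.q₂, x₁), (0 : ℝ)) ∈ Ω) :
    ∃ y : ℝ → Fin e.d → ℝ, Tendsto y (𝓝[>] 0) (𝓝 x₁) ∧
      (fun t => S ((e.q₁, e.q₂, y t), t) - treeSeries N c e ((1, y t), t)) =O[𝓝[>] 0]
        fun t : ℝ => t ^ (N + 1) := by
  have hxM : x₁ ∈ e.M := hS.base _ hx₁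
  have hH : ContDiffOn ℝ ∞ (fun w => e.q₂ ⬝ᵥ α w) U := by
    unfold dotProduct
    exact ContDiffOn.sum fun j _ => contDiffOn_const.mul (contDiffOn_pi.1 hα.smooth j)
  obtain ⟨C, hC⟩ := exists_trajectory (N := N) e.isOpen hα.isOpen hα.base hα.zero_mem hH
    (treeSeries_contDiffOn (N := N) (c := c)) (p := e.q₁) hxM
    (fun x _ t => treeSeries_zero x t) fun s x hx => isBigO_residual hα N s hx
  obtain ⟨ε, hε, hεΩ⟩ := Metric.isOpen_iff.1 (hS.isOpen.preimage (f := fun w :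
    (Fin e.d → ℝ) × ℝ => ((e.q₁, e.q₂, w.1), w.2)) (by fun_prop)) (x₁, 0) hx₁
  have hmem : ∀ (x : Fin e.d → ℝ) (t : ℝ), 0 < t → t ≤ ε / 2 → ‖x - x₁‖ ≤ ε / 2 →
      ((e.q₁, e.q₂, x), t) ∈ Ω := fun x t ht ht1 hx => hεΩ (a := (x, t)) (by
    rw [mem_ball_iff_norm, Prod.mk_sub_mk, sub_zero, Prod.norm_mk, Real.norm_of_nonneg ht.le]
    exact (max_le hx ht1).trans_lt (half_lt_self hε))
  have h1 : ∀ᶠ t in 𝓝[>] (0 : ℝ), ∃ y : Fin e.d → ℝ, ‖y - x₁‖ ≤ C * t ∧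
      |S ((e.q₁, e.q₂, y), t) - treeSeries N c e ((1, y), t)| ≤ C * t ^ (N + 1) := by
    filter_upwards [hC, Ioc_mem_nhdsGT zero_lt_one, eventually_mul_le 1 (half_pos hε),
      eventually_mul_le C (half_pos hε)] with t ⟨z, hz0, hzU, hz, hzt, hW⟩ ht ht1 htC
    rw [one_mul] at ht1
    refine ⟨(z t).1, hzt, ?_⟩
    rw [hS.formula e.q₁ e.q₂ x₁ t z ht.1 ht.2 (hmem _ _ ht.1 ht1 (by simpa using (half_pos hε).le)) hz0
      hzU hz
      (hmem _ _ ht.1 ht1 (hzt.trans htC)), abs_sub_comm]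
    exact hW
  obtain ⟨y, hy⟩ := h1.choice
  refine ⟨y, ?_, Asymptotics.IsBigO.of_bound C ?_⟩
  · refine tendsto_iff_norm_sub_tendsto_zero.2 (squeeze_zero' (Eventually.of_forall fun t =>
      norm_nonneg _) (hy.mono fun t h => h.1) ?_)
    have h2 : Tendsto (fun t : ℝ => C * t) (𝓝 0) (𝓝 (C * 0)) :=
      (continuous_const.mul continuous_id).tendsto 0
    rw [mul_zero] at h2
    exact h2.mono_left nhdsWithin_le_nhds
  · filter_upwards [hy, self_mem_nhdsWithin] with t h (ht : 0 < t)
    rw [Real.norm_eq_abs, Real.norm_of_nonneg (pow_pos ht _).le]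
    exact h.2

/-- The two functions are known to be close only at points `y t` that move with `t`. The induction
on `n` therefore runs over all `x` at once: lower coefficient differences vanish near `x`, hence at
`y t`, and the next one at `y t` tends to its value at `x` by continuity. -/
theorem IsGeneratedFamily.coeff_tay_eq (hα : IsButcherMap c e.M e.π U α)
    (hS : IsGeneratedFamily e.M U α Ω S) {n N : ℕ} (hn : n ≤ N) :
    ∀ x : Fin e.d → ℝ, ((e.q₁, e.q₂, x), (0 : ℝ)) ∈ Ω →
      PowerSeries.coeff n (tay fun t => S ((e.q₁, e.q₂, x), t)) = seriesCoeff c e n x := by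
  let O : Set ((Fin e.d → ℝ) × ℝ) := {w | ((e.q₁, e.q₂, w.1), w.2) ∈ Ω}
  have hO : IsOpen O := hS.isOpen.preimage (by fun_prop)
  have hF : ContDiffOn ℝ ∞ (fun w : (Fin e.d → ℝ) × ℝ => S ((e.q₁, e.q₂, w.1), w.2)) (slab O) :=
    hS.smooth.comp (f := fun w : (Fin e.d → ℝ) × ℝ => ((e.q₁, e.q₂, w.1), w.2))
      (by fun_prop) fun w hw => ⟨hw.1, mem_univ _, hw.2.2⟩
  let V : Set (Fin e.d → ℝ) := {y | (y, (0 : ℝ)) ∈ O}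
  have hV : IsOpen V := hO.preimage (by fun_prop)
  let b : ℕ → (Fin e.d → ℝ) → ℝ := fun n y =>
    PowerSeries.coeff n (tay fun t => S ((e.q₁, e.q₂, y), t)) - seriesCoeff c e n y
  have hb : ∀ n, ContinuousOn (b n) V := fun n =>
    (continuousOn_coeff_tay hO hF n).sub ((seriesCoeff_continuousOn c e n).mono
      fun y hy => hS.base _ hy)
  suffices h : ∀ x ∈ V, b n x = 0 from fun x hx => sub_eq_zero.1 (h x hx)
  induction n using Nat.strong_induction_on with
  | _ n ih =>
    intro x hx
    obtain ⟨y, hy, hyO⟩ := hS.exists_close hα N hx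
    obtain ⟨r, hr, hrV⟩ := Metric.nhds_basis_closedBall.mem_iff.1 (hV.mem_nhds hx)
    obtain ⟨C, -, hC⟩ := uniform_taylor hO hF (isCompact_closedBall x r) (fun y hy => hrV hy) N
    have hyr : ∀ᶠ t in 𝓝[>] (0 : ℝ), y t ∈ Metric.closedBall x r :=
      hy.eventually_mem (Metric.closedBall_mem_nhds x hr)
    refine limit_eq_zero_of_isBigO hn (b := fun n t => b n (y t)) (β := fun n => b n x)
      (fun k _ => (((hb k).continuousAt (hV.mem_nhds hx)).tendsto).comp hy)
      (fun k hk => hyr.mono fun t ht => ih k hk (by omega) _ (hrV ht)) ?_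
    have h1 : (fun t => S ((e.q₁, e.q₂, y t), t) - ∑ n ∈ Finset.range (N + 1), t ^ n *
        PowerSeries.coeff n (tay fun u => S ((e.q₁, e.q₂, y t), u))) =O[𝓝[>] 0]
        fun t : ℝ => t ^ (N + 1) := by
      refine Asymptotics.IsBigO.of_bound C ?_
      filter_upwards [hC, hyr, self_mem_nhdsWithin] with t ht hyt (ht0 : 0 < t)
      rw [Real.norm_eq_abs, Real.norm_of_nonneg (pow_pos ht0 _).le]
      exact (ht _ hyt).2
    refine (hyO.sub h1).congr_left fun t => ?_
    simp only [treeSeries_one, b, mul_sub, Finset.sum_sub_distrib]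
    ring

end TreeExpansion

end

theorem proposition4p4 :
    -- the graph of a network is a Kontsevich tree
    (∀ (m : ℕ) (ρ : TreeExpansion.Network m), ρ.kontsevichGraph.IsKontsevichTree) ∧
    -- a universal recursion: a polynomial for each network
    ∃ R : (Σ m, TreeExpansion.NRT m) →
        MvPolynomial ((Σ m, TreeExpansion.TopTree m) ⊕ (Σ m, TreeExpansion.NRT m)) ℚ,
      (∀ ρ τ, Sum.inl τ ∈ (R ρ).vars → τ.1 ≤ ρ.1) ∧
      (∀ ρ ρ', Sum.inr ρ' ∈ (R ρ).vars → ρ'.1 < ρ.1) ∧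
      ∀ c : (Σ m, TreeExpansion.TopTree m) → ℝ,
        ∃ w : (Σ m, TreeExpansion.NRT m) → ℝ,
          (∀ ρ, w ρ = MvPolynomial.aeval (Sum.elim c w) (R ρ)) ∧
          ∀ (d : ℕ) (M : Set (Fin d → ℝ)) (π : (Fin d → ℝ) → Matrix (Fin d) (Fin d) ℝ)
            (U : Set ((Fin d → ℝ) × (Fin d → ℝ)))
            (α : (Fin d → ℝ) × (Fin d → ℝ) → (Fin d → ℝ))
            (Ω : Set (((Fin d → ℝ) × (Fin d → ℝ) × (Fin d → ℝ)) × ℝ))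
            (S : ((Fin d → ℝ) × (Fin d → ℝ) × (Fin d → ℝ)) × ℝ → ℝ),
            IsOpen M → TreeExpansion.IsPoisson M π →
            TreeExpansion.IsButcherMap c M π U α →
            TreeExpansion.IsGeneratedFamily M U α Ω S →
            ∀ p₁ p₂ x : Fin d → ℝ, ((p₁, p₂, x), (0 : ℝ)) ∈ Ω →
              TreeExpansion.tay (fun t => S ((p₁, p₂, x), t)) =
                PowerSeries.C ((p₁ + p₂) ⬝ᵥ x) + PowerSeries.mk fun m =>
                  ∑ ρ : TreeExpansion.NRT m, w ⟨m, ρ⟩ * ρ.symbol π p₁ p₂ x := by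
  classical
  refine ⟨fun m ρ => ρ.isKontsevichTree,
    -- The recursion is already solved inside `treeCoeff`, so these polynomials contain only the
    -- variables `c_τ`.
    fun ρ => MvPolynomial.rename Sum.inl (TreeExpansion.treeCoeff ρ.1 ρ.2), ?_, ?_, ?_⟩
  · intro ρ τ hτ
    have h := MvPolynomial.vars_rename _ _ hτ
    rw [Finset.mem_image] at h
    obtain ⟨τ', h1, h2⟩ := h
    rw [← Sum.inl_injective h2]
    exact MvPolynomial.mem_supported.1 (TreeExpansion.treeCoeff_mem ρ.1 ρ.2) h1
  · intro ρ ρ' hρ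
    have h := MvPolynomial.vars_rename _ _ hρ
    rw [Finset.mem_image] at h
    obtain ⟨τ, -, h2⟩ := h
    cases h2
  · intro c
    refine ⟨fun ρ => MvPolynomial.aeval c (TreeExpansion.treeCoeff ρ.1 ρ.2), fun ρ => ?_, ?_⟩
    · rw [MvPolynomial.aeval_rename]
      rfl
    · intro d M π U α Ω S hM hπ hα hS p₁ p₂ x hx
      refine PowerSeries.ext fun n => ?_
      exact TreeExpansion.IsGeneratedFamily.coeff_tay_eq
        (e := ⟨d, M, π, p₁, p₂, hM, hπ.smooth, hπ.skew⟩) hα hS le_rfl x hx
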